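/- Let $k$ be a field and $G$ a finite group. Let $\mathsf{M}^c_k(G)$ be the category of cohomological Mackey functors for $G$ over $k$ (in the sense of Green), and let $\mathsf{Fun}^+_k(G)$ be the category of $k$-linear contravariant functors to $k$-modules from the category $\mathsf{perm}^+_k(G)$ of direct summands of finitely generated permutation $kG$-modules. Let $Y_G:\mathsf{Fun}^+_k(G)\to\mathsf{M}^c_k(G)$, $F\mapsto\big(H\mapsto F(k[G/H])\big)$, be the evaluation functor (an equivalence, by Yoshida's theorem). Here restrictions, transfers and conjugations of $Y_G(F)$ are induced by the projections $k[G/K]\to k[G/H]$, the maps $k[G/H]\to k[G/K]$, $xH\mapsto\sum_{hK\in H/K}xhK$ (for $K\le H$), and the maps $k[G/gHg^{-1}]\to k[G/H]$, $x\,gHg^{-1}\mapsto xgH$. For a simple $kG$-module $V$, let $S_{\mathbf 1,V}^G\in\mathsf{M}^c_k(G)$ be the functor corresponding under $Y_G$ to $W\mapsto \mathrm{tr}_{\mathbf 1}^G\,\mathrm{Hom}_k(W,V)$, where for a subgroup $K\le G$ and a $kG$-module $U$, $\mathrm{tr}_{\mathbf 1}^K(U)=\{\sum_{x\in K}xu :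 u\in U\}$. Let $N$ be a normal subgroup of $G$. Then there is an exact $k$-linear functor $\sigma_{G/N}^G:\mathsf{M}^c_k(G/N)\to\mathsf{M}^c_k(G)$ which is induced by the functor $\mathrm{tr}_{\mathbf 1}^N:\mathsf{perm}^+_k(G)\to\mathsf{perm}^+_k(G/N)$, $W\mapsto\mathrm{tr}_{\mathbf 1}^N(W)$, in the sense that $\sigma_{G/N}^G\circ Y_{G/N}\cong Y_G\circ\big(F\mapsto F\circ \mathrm{tr}_{\mathbf 1}^N\big)$, and such that for every simple $k(G/N)$-module $V$ $$\sigma_{G/N}^G(S_{\mathbf 1,V}^{G/N})\cong S_{\mathbf 1,\mathrm{Inf}_{G/N}^GV}^G .$$ Suppose moreover that $H$ is a subgroup of $G$ such that $G=N\rtimes H$. Then: 1. For every $kH$-module $V$, let $\tilde V$ be the $kG$-module $\mathrm{Inf}_{G/N}^G\mathrm{Iso}_H^{G/N}V$. The restriction of $\tilde V$ to $H$ is isomorphic to $V$. 2. The composition $\mathrm{Res}_H^G\,\sigma_{G/N}^G\,\mathrm{Iso}_H^{G/N}$ is isomorphic to the identity functor of $\mathsf{M}^c_k(H)$. 3. For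 every simple $kH$-module $V$ there is an isomorphism $\mathrm{Res}_H^GS_{\mathbf 1,\tilde V}^G\cong S_{\mathbf 1,V}^H$. If $V$ and $W$ are simple $kH$-modules, then for any choice of such isomorphisms for $V$ and for $W$ and for every $n\in\mathbb N$, the $k$-linear map $$r_H^G:\mathrm{Ext}^n_{\mathsf{M}^c_k(G)}(S_{\mathbf 1,\tilde V}^G,S_{\mathbf 1,\tilde W}^G)\to\mathrm{Ext}^n_{\mathsf{M}^c_k(H)}(S_{\mathbf 1,V}^H,S_{\mathbf 1,W}^H)$$ induced by the exact functor $\mathrm{Res}_H^G$ has a $k$-linear right inverse, i.e. it is a split surjection. -/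

import Mathlib

open CategoryTheory CategoryTheory.Limits
open scoped Pointwise

universe u

namespace Subgroup

/-- `S` is a system of representatives of the double cosets `L \ H / K`
(used for subgroups `K, L ≤ H`). -/
def IsDoubleCosetReps {G : Type u} [Group G] (L H K : Subgroup G) (S : Finset G) : Prop :=
  (∀ s ∈ S, s ∈ H) ∧ ∀ h ∈ H, ∃! s, s ∈ S ∧ ∃ l ∈ L, ∃ q ∈ K, h = l * s * q

theorem conj_smul_inf_conj_inv {G : Type u} [Group G] (x : G) (K L : Subgroup G) :
    MulAut.conj x • (K ⊓ MulAut.conj x⁻¹ • L) = MulAut.conj x • K ⊓ L := by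
  rw [Subgroup.smul_inf, map_inv, smul_inv_smul]

end Subgroup

/-- A cohomological Mackey functor for the group `G` over `k` (Green's definition): modules `M(H)`
for the subgroups `H ≤ G`, restrictions `r^H_K : M(H) → M(K)` and transfers `t^H_K : M(K) → M(H)`
for `K ≤ H`, and conjugations `c_g : M(H) → M(gHg⁻¹)`. -/
structure CohMackey (k G : Type u) [CommRing k] [Group G] where
  /-- the value at a subgroup -/
  obj : Subgroup G → ModuleCat.{u} k
  /-- restriction -/
  res : ∀ {K H : Subgroup G}, K ≤ H → (obj H ⟶ obj K)
  /-- transfer -/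
  tr : ∀ {K H : Subgroup G}, K ≤ H → (obj K ⟶ obj H)
  /-- conjugation; the target `L` is `gHg⁻¹` -/
  conj : ∀ (g : G) {H L : Subgroup G}, MulAut.conj g • H = L → (obj H ⟶ obj L)
  res_self : ∀ H : Subgroup G, res (le_refl H) = 𝟙 _
  tr_self : ∀ H : Subgroup G, tr (le_refl H) = 𝟙 _
  conj_self : ∀ (g : G) {H : Subgroup G} (h : MulAut.conj g • H = H), g ∈ H → conj g h = 𝟙 _
  res_res : ∀ {L K H : Subgroup G} (h : L ≤ K) (h' : K ≤ H),
    res h' ≫ res h = res (h.trans h')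
  tr_tr : ∀ {L K H : Subgroup G} (h : L ≤ K) (h' : K ≤ H),
    tr h ≫ tr h' = tr (h.trans h')
  conj_conj : ∀ (g g' : G) {H H' H'' : Subgroup G} (h : MulAut.conj g • H = H')
    (h' : MulAut.conj g' • H' = H'') (h'' : MulAut.conj (g' * g) • H = H''),
    conj g h ≫ conj g' h' = conj (g' * g) h''
  res_conj : ∀ (g : G) {K H K' H' : Subgroup G} (h : K ≤ H) (h' : K' ≤ H')
    (hK : MulAut.conj g • K = K') (hH : MulAut.conj g • H = H'),
    res h ≫ conj g hK = conj g hH ≫ res h'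
  tr_conj : ∀ (g : G) {K H K' H' : Subgroup G} (h : K ≤ H) (h' : K' ≤ H')
    (hK : MulAut.conj g • K = K') (hH : MulAut.conj g • H = H'),
    tr h ≫ conj g hH = conj g hK ≫ tr h'
  /-- the Mackey formula -/
  mackey : ∀ {K L H : Subgroup G} (hK : K ≤ H) (hL : L ≤ H) (S : Finset G),
    Subgroup.IsDoubleCosetReps L H K S →
    tr hK ≫ res hL = ∑ x ∈ S,
      res (inf_le_left : K ⊓ MulAut.conj x⁻¹ • L ≤ K) ≫
        conj x (Subgroup.conj_smul_inf_conj_inv x K L) ≫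
          tr (inf_le_right : MulAut.conj x • K ⊓ L ≤ L)
  /-- the cohomological condition -/
  res_tr : ∀ {K H : Subgroup G} (h : K ≤ H), res h ≫ tr h = (K.relIndex H : k) • 𝟙 (obj H)

namespace CohMackey

section Category

variable {k G : Type u} [CommRing k] [Group G]

/-- A morphism of Mackey functors: a family of linear maps commuting with restrictions, transfers
and conjugations. -/
@[ext]
structure Hom (M M' : CohMackey k G) where
  /-- the components -/
  app : ∀ H : Subgroup G, M.obj H ⟶ M'.obj H
  res : ∀ {K H : Subgroup G} (h : K ≤ H), M.res h ≫ app K = app H ≫ M'.res h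
  tr : ∀ {K H : Subgroup G} (h : K ≤ H), M.tr h ≫ app H = app K ≫ M'.tr h
  conj : ∀ (g : G) {H L : Subgroup G} (h : MulAut.conj g • H = L),
    M.conj g h ≫ app L = app H ≫ M'.conj g h


instance : Category (CohMackey k G) where
  Hom := Hom
  id M := { app := fun H => 𝟙 _, res := by simp, tr := by simp, conj := by simp }
  comp f f' :=
    { app := fun H => f.app H ≫ f'.app H
      res := fun h => by rw [← Category.assoc, f.res, Category.assoc, f'.res, Category.assoc]
      tr := fun h => by rw [← Category.assoc, f.tr, Category.assoc, f'.tr, Category.assoc]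
      conj := fun g _ _ h => by
        rw [← Category.assoc, f.conj, Category.assoc, f'.conj, Category.assoc] }

@[ext]
theorem hom_ext {M M' : CohMackey k G} {f f' : M ⟶ M'} (h : ∀ H, f.app H = f'.app H) : f = f' :=
  Hom.ext (funext h)

@[simp]
theorem id_app (M : CohMackey k G) (H : Subgroup G) : Hom.app (𝟙 M) H = 𝟙 _ := rfl

@[simp]
theorem comp_app {M M' M'' : CohMackey k G} (f : M ⟶ M') (f' : M' ⟶ M'') (H : Subgroup G) :
    Hom.app (f ≫ f') H = f.app H ≫ f'.app H := rfl

variable (M M' : CohMackey k G)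

instance : Add (M ⟶ M') :=
  ⟨fun f f' => ⟨fun H => f.app H + f'.app H, by simp [f.res, f'.res], by simp [f.tr, f'.tr],
    by simp [f.conj, f'.conj]⟩⟩

instance : Zero (M ⟶ M') := ⟨⟨fun _ => 0, by simp, by simp, by simp⟩⟩

instance : Neg (M ⟶ M') :=
  ⟨fun f => ⟨fun H => -f.app H, by simp [f.res], by simp [f.tr], by simp [f.conj]⟩⟩

instance : Sub (M ⟶ M') :=
  ⟨fun f f' => ⟨fun H => f.app H - f'.app H, by simp [f.res, f'.res], by simp [f.tr, f'.tr],
    by simp [f.conj, f'.conj]⟩⟩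

instance {R : Type*} [Semiring R] [Linear R (ModuleCat.{u} k)] : SMul R (M ⟶ M') :=
  ⟨fun r f => ⟨fun H => r • f.app H, by simp [f.res], by simp [f.tr], by simp [f.conj]⟩⟩

@[simp]
theorem add_app (f f' : M ⟶ M') (H : Subgroup G) : (f + f').app H = f.app H + f'.app H := rfl

@[simp]
theorem zero_app (H : Subgroup G) : Hom.app (0 : M ⟶ M') H = 0 := rfl

@[simp]
theorem smul_app (r : k) (f : M ⟶ M') (H : Subgroup G) : Hom.app (r • f) H = r • f.app H := rfl

theorem app_injective :
    Function.Injective (fun (f : M ⟶ M') (H : Subgroup G) => f.app H) :=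
  fun _ _ h => hom_ext fun H => congrFun h H

instance : AddCommGroup (M ⟶ M') :=
  (app_injective M M').addCommGroup _ rfl (fun _ _ => rfl) (fun _ => rfl) (fun _ _ => rfl)
    (fun _ _ => rfl) (fun _ _ => rfl)

instance : Module k (M ⟶ M') :=
  (app_injective M M').module k ⟨⟨_, rfl⟩, fun _ _ => rfl⟩ fun _ _ => rfl

instance : Preadditive (CohMackey k G) where

instance : Linear k (CohMackey k G) where

end Category

section Abelian

variable {k G : Type u} [CommRing k] [Group G]

/-- Evaluation at a subgroup. -/
abbrev eval (k : Type u) [CommRing k] {G : Type u} [Group G] (H : Subgroup G) :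
    CohMackey k G ⥤ ModuleCat.{u} k where
  obj M := M.obj H
  map f := f.app H


theorem eval_obj (M : CohMackey k G) (H : Subgroup G) : (eval k H).obj M = M.obj H := rfl


theorem eval_map {M M' : CohMackey k G} (f : M ⟶ M') (H : Subgroup G) :
    (eval k H).map f = f.app H := rfl

instance (H : Subgroup G) : (eval k H).Additive where

instance (H : Subgroup G) : (eval k H).PreservesZeroMorphisms where

theorem isIso_of_app {M M' : CohMackey k G} (f : M ⟶ M') (h : ∀ H, IsIso (f.app H)) :
    IsIso f :=
  ⟨⟨⟨fun H => inv (f.app H),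
      fun h => by rw [IsIso.eq_inv_comp, ← Category.assoc, ← f.res, Category.assoc,
        IsIso.hom_inv_id, Category.comp_id],
      fun h => by rw [IsIso.eq_inv_comp, ← Category.assoc, ← f.tr, Category.assoc,
        IsIso.hom_inv_id, Category.comp_id],
      fun g _ _ h => by rw [IsIso.eq_inv_comp, ← Category.assoc, ← f.conj, Category.assoc,
        IsIso.hom_inv_id, Category.comp_id]⟩,
    by ext1; simp, by ext1; simp⟩⟩

variable {J : Type} [SmallCategory J] [FinCategory J] (F : J ⥤ CohMackey k G)

/-- The natural transformation given by restriction. -/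

abbrev resNat {K H : Subgroup G} (h : K ≤ H) : eval k H ⟶ eval k K where
  app M := M.res h
  naturality _ _ f := (f.res h).symm

/-- The natural transformation given by transfer. -/

abbrev trNat {K H : Subgroup G} (h : K ≤ H) : eval k K ⟶ eval k H where
  app M := M.tr h
  naturality _ _ f := (f.tr h).symm

/-- The natural transformation given by conjugation. -/

abbrev conjNat (g : G) {H L : Subgroup G} (h : MulAut.conj g • H = L) : eval k H ⟶ eval k L where
  app M := M.conj g h
  naturality _ _ f := (f.conj g h).symm


/-- The limit of a finite diagram, computed subgroup by subgroup. -/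
noncomputable def limitObj : CohMackey k G where
  obj H := limit (F ⋙ eval k H)
  res h := limMap (Functor.whiskerLeft F (resNat h))
  tr h := limMap (Functor.whiskerLeft F (trNat h))
  conj g _ _ h := limMap (Functor.whiskerLeft F (conjNat g h))
  res_self H := limit.hom_ext fun j => by simp [res_self]
  tr_self H := limit.hom_ext fun j => by simp [tr_self]
  conj_self g _ h hg := limit.hom_ext fun j => by simp [conj_self _ _ h hg]
  res_res h h' := limit.hom_ext fun j => by simp [res_res]
  tr_tr h h' := limit.hom_ext fun j => by simp [tr_tr]
  conj_conj g g' _ _ _ h h' h'' := limit.hom_ext fun j => by simp [conj_conj _ _ _ h h' h'']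
  res_conj g _ _ _ _ h h' hK hH := limit.hom_ext fun j => by simp [res_conj _ g h h' hK hH]
  tr_conj g _ _ _ _ h h' hK hH := limit.hom_ext fun j => by simp [tr_conj _ g h h' hK hH]
  mackey hK hL S hS := limit.hom_ext fun j => by
    simp [mackey _ hK hL S hS, Preadditive.sum_comp, Preadditive.comp_sum]
  res_tr h := limit.hom_ext fun j => by simp [res_tr]

/-- The limit cone. -/
@[simps]
noncomputable def limitCone : Cone F where
  pt := limitObj F
  π :=
    { app := fun j =>
        { app := fun H => limit.π (F ⋙ eval k H) j
          res := fun h => limMap_π _ _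
          tr := fun h => limMap_π _ _
          conj := fun g _ _ h => limMap_π _ _ }
      naturality := fun i j f => by
        ext1 H
        exact (Category.id_comp _).trans (limit.w (F ⋙ eval k H) f).symm }

variable {F} in
/-- A cone is a limit cone if it is one at every subgroup. -/
noncomputable def isLimitOfEval (c : Cone F) (hc : ∀ H, IsLimit ((eval k H).mapCone c)) :
    IsLimit c where
  lift s :=
    { app := fun H => (hc H).lift ((eval k H).mapCone s)
      res := fun {K H} h => (hc K).hom_ext fun j => by
        have e1 := (hc K).fac ((eval k K).mapCone s) j
        have e2 := (hc H).fac ((eval k H).mapCone s) j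
        have e3 := (c.π.app j).res h
        have e4 := (s.π.app j).res h
        dsimp at e1 e2 e3 e4 ⊢
        rw [Category.assoc, Category.assoc, e1, e3, e4, reassoc_of% e2]
      tr := fun {K H} h => (hc H).hom_ext fun j => by
        have e1 := (hc K).fac ((eval k K).mapCone s) j
        have e2 := (hc H).fac ((eval k H).mapCone s) j
        have e3 := (c.π.app j).tr h
        have e4 := (s.π.app j).tr h
        dsimp at e1 e2 e3 e4 ⊢
        rw [Category.assoc, Category.assoc, e2, e3, e4, reassoc_of% e1]
      conj := fun g {H L} h => (hc L).hom_ext fun j => by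
        have e1 := (hc L).fac ((eval k L).mapCone s) j
        have e2 := (hc H).fac ((eval k H).mapCone s) j
        have e3 := (c.π.app j).conj g h
        have e4 := (s.π.app j).conj g h
        dsimp at e1 e2 e3 e4 ⊢
        rw [Category.assoc, Category.assoc, e1, e3, e4, reassoc_of% e2] }
  fac s j := hom_ext fun H => (hc H).fac ((eval k H).mapCone s) j
  uniq s m hm := hom_ext fun H => (hc H).uniq ((eval k H).mapCone s) (m.app H) fun j =>
    congrArg (fun f => Hom.app f H) (hm j)

/-- The cone `limitCone F` is a limit cone at every subgroup. -/
noncomputable def isLimitEvalLimitCone (H : Subgroup G) :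
    IsLimit ((eval k H).mapCone (limitCone F)) :=
  IsLimit.ofIsoLimit (limit.isLimit (F ⋙ eval k H)) (Cone.ext (Iso.refl _) fun j => by
    exact (Category.id_comp _).symm)

/-- The cone `limitCone F` is a limit cone. -/
noncomputable def isLimitLimitCone : IsLimit (limitCone F) :=
  isLimitOfEval _ (isLimitEvalLimitCone F)

/-- The colimit of a finite diagram, computed subgroup by subgroup. -/
noncomputable def colimitObj : CohMackey k G where
  obj H := colimit (F ⋙ eval k H)
  res h := colimMap (Functor.whiskerLeft F (resNat h))
  tr h := colimMap (Functor.whiskerLeft F (trNat h))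
  conj g _ _ h := colimMap (Functor.whiskerLeft F (conjNat g h))
  res_self H := colimit.hom_ext fun j => by simp [res_self]
  tr_self H := colimit.hom_ext fun j => by simp [tr_self]
  conj_self g _ h hg := colimit.hom_ext fun j => by simp [conj_self _ _ h hg]
  res_res h h' := colimit.hom_ext fun j => by simp [← res_res _ h h']
  tr_tr h h' := colimit.hom_ext fun j => by simp [← tr_tr _ h h']
  conj_conj g g' _ _ _ h h' h'' := colimit.hom_ext fun j => by simp [← conj_conj _ _ _ h h' h'']
  res_conj g _ _ _ _ h h' hK hH := colimit.hom_ext fun j => by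
    have := res_conj (F.obj j) g h h' hK hH
    simp [reassoc_of% this]
  tr_conj g _ _ _ _ h h' hK hH := colimit.hom_ext fun j => by
    have := tr_conj (F.obj j) g h h' hK hH
    simp [reassoc_of% this]
  mackey hK hL S hS := colimit.hom_ext fun j => by
    have := mackey (F.obj j) hK hL S hS
    simp [reassoc_of% this, Preadditive.sum_comp, Preadditive.comp_sum]
  res_tr h := colimit.hom_ext fun j => by
    have := res_tr (F.obj j) h
    simp [reassoc_of% this]

/-- The colimit cocone. -/
@[simps]
noncomputable def colimitCocone : Cocone F where
  pt := colimitObj F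
  ι :=
    { app := fun j =>
        { app := fun H => colimit.ι (F ⋙ eval k H) j
          res := fun h => (ι_colimMap (Functor.whiskerLeft F (resNat h)) j).symm
          tr := fun h => (ι_colimMap (Functor.whiskerLeft F (trNat h)) j).symm
          conj := fun g _ _ h => (ι_colimMap (Functor.whiskerLeft F (conjNat g h)) j).symm }
      naturality := fun i j f => by
        ext1 H
        exact (colimit.w (F ⋙ eval k H) f).trans (Category.comp_id _).symm }

variable {F} in
/-- A cocone is a colimit cocone if it is one at every subgroup. -/
noncomputable def isColimitOfEval (c : Cocone F)
    (hc : ∀ H, IsColimit ((eval k H).mapCocone c)) : IsColimit c where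
  desc s :=
    { app := fun H => (hc H).desc ((eval k H).mapCocone s)
      res := fun {K H} h => (hc H).hom_ext fun j => by
        have e1 := (hc K).fac ((eval k K).mapCocone s) j
        have e2 := (hc H).fac ((eval k H).mapCocone s) j
        have e3 := (c.ι.app j).res h
        have e4 := (s.ι.app j).res h
        dsimp at e1 e2 e3 e4 ⊢
        rw [← reassoc_of% e3, e1, reassoc_of% e2, e4]
      tr := fun {K H} h => (hc K).hom_ext fun j => by
        have e1 := (hc K).fac ((eval k K).mapCocone s) j
        have e2 := (hc H).fac ((eval k H).mapCocone s) j
        have e3 := (c.ι.app j).tr h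
        have e4 := (s.ι.app j).tr h
        dsimp at e1 e2 e3 e4 ⊢
        rw [← reassoc_of% e3, e2, reassoc_of% e1, e4]
      conj := fun g {H L} h => (hc H).hom_ext fun j => by
        have e1 := (hc L).fac ((eval k L).mapCocone s) j
        have e2 := (hc H).fac ((eval k H).mapCocone s) j
        have e3 := (c.ι.app j).conj g h
        have e4 := (s.ι.app j).conj g h
        dsimp at e1 e2 e3 e4 ⊢
        rw [← reassoc_of% e3, e1, reassoc_of% e2, e4] }
  fac s j := hom_ext fun H => (hc H).fac ((eval k H).mapCocone s) j
  uniq s m hm := hom_ext fun H => (hc H).uniq ((eval k H).mapCocone s) (m.app H) fun j =>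
    congrArg (fun f => Hom.app f H) (hm j)

/-- The cocone `colimitCocone F` is a colimit cocone at every subgroup. -/
noncomputable def isColimitEvalColimitCocone (H : Subgroup G) :
    IsColimit ((eval k H).mapCocone (colimitCocone F)) :=
  IsColimit.ofIsoColimit (colimit.isColimit (F ⋙ eval k H)) (Cocone.ext (Iso.refl _) fun j => by
    exact Category.comp_id _)

/-- The cocone `colimitCocone F` is a colimit cocone. -/
noncomputable def isColimitColimitCocone : IsColimit (colimitCocone F) :=
  isColimitOfEval _ (isColimitEvalColimitCocone F)

instance : HasFiniteLimits (CohMackey k G) :=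
  ⟨fun _ _ _ => ⟨fun F => ⟨⟨⟨limitCone F, isLimitLimitCone F⟩⟩⟩⟩⟩

instance : HasFiniteColimits (CohMackey k G) :=
  ⟨fun _ _ _ => ⟨fun F => ⟨⟨⟨colimitCocone F, isColimitColimitCocone F⟩⟩⟩⟩⟩

instance (H : Subgroup G) : PreservesFiniteLimits (eval k H) :=
  ⟨fun _ _ _ => ⟨fun {F} =>
    preservesLimit_of_preserves_limit_cone (isLimitLimitCone F) (isLimitEvalLimitCone F H)⟩⟩

instance (H : Subgroup G) : PreservesFiniteColimits (eval k H) :=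
  ⟨fun _ _ _ => ⟨fun {F} =>
    preservesColimit_of_preserves_colimit_cocone (isColimitColimitCocone F)
      (isColimitEvalColimitCocone F H)⟩⟩

instance {M M' : CohMackey k G} (f : M ⟶ M') : IsIso (Abelian.coimageImageComparison f) :=
  isIso_of_app _ fun H =>
    ((MorphismProperty.isomorphisms (ModuleCat.{u} k)).arrow_mk_iso_iff
      (Abelian.PreservesCoimageImageComparison.iso (eval k H) f)).2
      (inferInstanceAs (IsIso (Abelian.coimageImageComparison ((eval k H).map f))))

noncomputable instance : Abelian (CohMackey k G) := Abelian.ofCoimageImageComparisonIsIso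

instance : HasExt.{u + 1} (CohMackey k G) := HasExt.standard _

end Abelian

section Restrict

variable {k G H : Type u} [CommRing k] [Group G] [Group H]

theorem mackey_term (M : CohMackey k G) {K L A A' B B' : Subgroup G} (x : G) (hA : A = A')
    (hB : B = B') (h₁ : A ≤ K) (h₂ : MulAut.conj x • A = B) (h₃ : B ≤ L) (h₁' : A' ≤ K)
    (h₂' : MulAut.conj x • A' = B') (h₃' : B' ≤ L) :
    M.res h₁ ≫ M.conj x h₂ ≫ M.tr h₃ = M.res h₁' ≫ M.conj x h₂' ≫ M.tr h₃' := by
  subst hA hB; rfl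

theorem conj_smul_map (f : H →* G) (h : H) (L : Subgroup H) :
    MulAut.conj (f h) • L.map f = (MulAut.conj h • L).map f := by
  ext x
  simp only [Subgroup.mem_smul_pointwise_iff_exists, Subgroup.mem_map]
  constructor
  · rintro ⟨_, ⟨l, hl, rfl⟩, rfl⟩
    exact ⟨_, ⟨l, hl, rfl⟩, by simp⟩
  · rintro ⟨_, ⟨l, hl, rfl⟩, rfl⟩
    exact ⟨_, ⟨l, hl, rfl⟩, by simp⟩

theorem isDoubleCosetReps_map (f : H →* G) (hf : Function.Injective f) {L P K : Subgroup H}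
    {S : Finset H} (hS : Subgroup.IsDoubleCosetReps L P K S) :
    Subgroup.IsDoubleCosetReps (L.map f) (P.map f) (K.map f) (S.map ⟨f, hf⟩) := by
  refine ⟨?_, ?_⟩
  · simp only [Finset.mem_map, Function.Embedding.coeFn_mk]
    rintro _ ⟨s, hs, rfl⟩
    exact ⟨s, hS.1 s hs, rfl⟩
  · rintro _ ⟨p, hp, rfl⟩
    obtain ⟨s, ⟨hs, l, hl, q, hq, e⟩, hu⟩ := hS.2 p hp
    refine ⟨f s, ⟨Finset.mem_map.2 ⟨s, hs, rfl⟩, f l, ⟨l, hl, rfl⟩, f q, ⟨q, hq, rfl⟩, by simp [e]⟩,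
      ?_⟩
    simp only [Finset.mem_map, Function.Embedding.coeFn_mk]
    rintro _ ⟨⟨t, ht, rfl⟩, _, ⟨l', hl', rfl⟩, _, ⟨q', hq', rfl⟩, e'⟩
    rw [hu t ⟨ht, l', hl', q', hq', hf (by simpa using e')⟩]

/-- Restriction of cohomological Mackey functors along an injective group homomorphism
`f : H → G`: the functor with value `M(f(L))` at `L ≤ H`. For the inclusion of a subgroup this is
the restriction functor `Res_H^G`, and for an isomorphism `f` it is transport of structure. -/
def restrict (k : Type u) [CommRing k] (f : H →* G) (hf : Function.Injective f) :
    CohMackey k G ⥤ CohMackey k H where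
  obj M :=
    { obj := fun L => M.obj (L.map f)
      res := fun h => M.res (Subgroup.map_mono h)
      tr := fun h => M.tr (Subgroup.map_mono h)
      conj := fun g _ _ h => M.conj (f g) (by rw [conj_smul_map, h])
      res_self := fun _ => M.res_self _
      tr_self := fun _ => M.tr_self _
      conj_self := fun g _ _ hg => M.conj_self _ _ (Subgroup.mem_map_of_mem f hg)
      res_res := fun _ _ => M.res_res _ _
      tr_tr := fun _ _ => M.tr_tr _ _
      conj_conj := fun g g' _ _ _ h h' h'' => by
        simp only [map_mul]
        exact M.conj_conj _ _ _ _ _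
      res_conj := fun g _ _ _ _ _ _ _ _ => M.res_conj _ _ _ _ _
      tr_conj := fun g _ _ _ _ _ _ _ _ => M.tr_conj _ _ _ _ _
      mackey := fun {K L P} hK hL S hS => by
        rw [M.mackey _ _ _ (isDoubleCosetReps_map f hf hS), Finset.sum_map]
        refine Finset.sum_congr rfl fun x _ => mackey_term M _ ?_ ?_ _ _ _ _ _ _
        · rw [Subgroup.map_inf _ _ _ hf, ← conj_smul_map, map_inv f]; rfl
        · rw [Subgroup.map_inf _ _ _ hf, ← conj_smul_map]; rfl
      res_tr := fun {K P} h => by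
        rw [M.res_tr, Subgroup.relIndex_map_map_of_injective _ _ hf] }
  map φ :=
    { app := fun L => φ.app (L.map f)
      res := fun _ => φ.res _
      tr := fun _ => φ.tr _
      conj := fun _ _ _ _ => φ.conj _ _ }

variable (f : H →* G) (hf : Function.Injective f)

instance : (restrict k f hf).Additive where

instance : (restrict k f hf).Linear k where

instance : PreservesFiniteLimits (restrict k f hf) :=
  ⟨fun _ _ _ => ⟨fun {F} => preservesLimit_of_preserves_limit_cone (isLimitLimitCone F)
    (isLimitOfEval _ fun L => isLimitEvalLimitCone F (L.map f))⟩⟩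

instance : PreservesFiniteColimits (restrict k f hf) :=
  ⟨fun _ _ _ => ⟨fun {F} => preservesColimit_of_preserves_colimit_cocone
    (isColimitColimitCocone F)
    (isColimitOfEval _ fun L => isColimitEvalColimitCocone F (L.map f))⟩⟩

end Restrict

end CohMackey

namespace Rep

section Permutation

variable {k G : Type u} [CommRing k] [Group G]
variable {X Y Z : Type u} [MulAction G X] [MulAction G Y] [MulAction G Z]

/-- The morphism `k[X] ⟶ W` of `kG`-modules extending a `G`-equivariant map `X → W`. -/
noncomputable def permHom {W : Rep.{u} k G} (φ : X → W) (hφ : ∀ (g : G) x, φ (g • x) = W.ρ g (φ x)) :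
    ofMulAction k G X ⟶ W :=
  Rep.ofHom ⟨Finsupp.lift W k X φ ∘ₗ (MonoidAlgebra.coeffLinearEquiv _).toLinearMap,
    fun g ↦ by ext; simp [hφ]⟩

theorem permHom_single {W : Rep.{u} k G} (φ : X → W) (hφ : ∀ (g : G) x, φ (g • x) = W.ρ g (φ x))
    (x : X) (r : k) : (permHom φ hφ).hom (MonoidAlgebra.single x r) = r • φ x := by
  simp [permHom]

theorem perm_hom_ext {W : Rep.{u} k G} {a b : ofMulAction k G X ⟶ W}
    (h : ∀ x, a.hom (MonoidAlgebra.single x 1) = b.hom (MonoidAlgebra.single x 1)) : a = b := by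
  ext x
  simpa using h x

variable (k) in
/-- The morphism `k[X] ⟶ k[Y]`, `x ↦ φ(x)`, for a map of `G`-sets `φ : X → Y`. -/
noncomputable def push (φ : X → Y) (hφ : ∀ (g : G) x, φ (g • x) = g • φ x) :
    ofMulAction k G X ⟶ ofMulAction k G Y :=
  permHom (fun x => MonoidAlgebra.single (φ x) 1) fun g x => by simp [hφ]

open Classical in
/-- The sum in `k[X]` of the elements of the fibre of `φ : X → Y` over `y`. -/
noncomputable def fibreSum (k : Type u) [CommRing k] [Finite X] (φ : X → Y) (y : Y) :
    MonoidAlgebra k X :=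
  letI := Fintype.ofFinite X
  ∑ x with φ x = y, MonoidAlgebra.single x (1 : k)

variable (k) in
/-- The morphism `k[Y] ⟶ k[X]`, `y ↦ ∑_{φ(x) = y} x`, for a map of finite `G`-sets
`φ : X → Y`. -/
noncomputable def pull [Finite X] (φ : X → Y) (hφ : ∀ (g : G) x, φ (g • x) = g • φ x) :
    ofMulAction k G Y ⟶ ofMulAction k G X :=
  permHom (fibreSum k φ) fun g y => by
    classical
    let _ := Fintype.ofFinite X
    simp only [fibreSum, map_sum, Representation.ofMulAction_single]
    refine Finset.sum_bij' (fun x _ => g⁻¹ • x) (fun x _ => g • x) ?_ ?_ ?_ ?_ ?_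
    all_goals simp +contextual [hφ]

theorem push_single (φ : X → Y) (hφ : ∀ (g : G) x, φ (g • x) = g • φ x) (x : X) :
    (push k φ hφ).hom (MonoidAlgebra.single x 1) = MonoidAlgebra.single (φ x) (1 : k) :=
  (permHom_single _ _ x 1).trans (one_smul _ _)

theorem pull_single [Finite X] (φ : X → Y) (hφ : ∀ (g : G) x, φ (g • x) = g • φ x) (y : Y) :
    (pull k φ hφ).hom (MonoidAlgebra.single y 1) = fibreSum k φ y :=
  (permHom_single _ _ y 1).trans (one_smul _ _)

theorem push_id (φ : X → X) (hφ : ∀ (g : G) x, φ (g • x) = g • φ x) (h : ∀ x, φ x = x) :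
    push k φ hφ = 𝟙 _ :=
  perm_hom_ext fun x => by rw [push_single, h]; rfl

theorem push_comp (φ : X → Y) (hφ : ∀ (g : G) x, φ (g • x) = g • φ x)
    (ψ : Y → Z) (hψ : ∀ (g : G) x, ψ (g • x) = g • ψ x)
    (χ : X → Z) (hχ : ∀ (g : G) x, χ (g • x) = g • χ x) (h : ∀ x, ψ (φ x) = χ x) :
    push k φ hφ ≫ push k ψ hψ = push k χ hχ :=
  perm_hom_ext fun x => by
    rw [push_single, ← h, ← push_single ψ hψ, ← push_single φ hφ]; rfl

theorem pull_id [Finite X] (φ : X → X) (hφ : ∀ (g : G) x, φ (g • x) = g • φ x)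
    (h : ∀ x, φ x = x) : pull k φ hφ = 𝟙 _ :=
  perm_hom_ext fun x => by
    classical
    rw [pull_single]
    simp [fibreSum, h, Finset.sum_filter]

/-- Base change, for a fibre product of `G`-sets decomposed as a disjoint union. -/
theorem push_pull {ι : Type u} (S : Finset ι) [Finite Y] (W : ι → Type u)
    [∀ i, MulAction G (W i)] [∀ i, Finite (W i)]
    (φ : X → Z) (hφ : ∀ (g : G) x, φ (g • x) = g • φ x)
    (ψ : Y → Z) (hψ : ∀ (g : G) x, ψ (g • x) = g • ψ x)
    (p : ∀ i, W i → X) (hp : ∀ i (g : G) x, p i (g • x) = g • p i x)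
    (q : ∀ i, W i → Y) (hq : ∀ i (g : G) x, q i (g • x) = g • q i x)
    (h : ∀ i ∈ S, ∀ w, φ (p i w) = ψ (q i w))
    (hu : ∀ x y, φ x = ψ y → ∃ i ∈ S, ∃ w, p i w = x ∧ q i w = y)
    (hu' : ∀ i ∈ S, ∀ j ∈ S, ∀ w w', p i w = p j w' → q i w = q j w' →
      (⟨i, w⟩ : Sigma W) = ⟨j, w'⟩) :
    push k φ hφ ≫ pull k ψ hψ = ∑ i ∈ S, pull k (p i) (hp i) ≫ push k (q i) (hq i) :=
  perm_hom_ext fun x => by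
    classical
    let _ := Fintype.ofFinite Y
    let _ := fun i => Fintype.ofFinite (W i)
    have e1 : (push k φ hφ ≫ pull k ψ hψ).hom (MonoidAlgebra.single x 1)
        = fibreSum k ψ (φ x) := by
      rw [← pull_single ψ hψ, ← push_single φ hφ]; rfl
    have e2 : (∑ i ∈ S, pull k (p i) (hp i) ≫ push k (q i) (hq i)).hom
        (MonoidAlgebra.single x 1) = ∑ i ∈ S, ∑ w with p i w = x,
          MonoidAlgebra.single (q i w) (1 : k) := by
      rw [sum_hom]
      simp only [Representation.IntertwiningMap.sum_apply, hom_comp,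
        Representation.IntertwiningMap.comp_apply]
      refine Finset.sum_congr rfl fun i _ => ?_
      rw [pull_single, fibreSum, map_sum]
      exact Finset.sum_congr rfl fun w _ => push_single _ (hq i) w
    rw [e1, e2, Finset.sum_sigma']
    simp only [fibreSum]
    symm
    refine Finset.sum_bij (fun a _ => q a.1 a.2) ?_ ?_ ?_ ?_
    · rintro ⟨i, w⟩ hiw
      simp only [Finset.mem_sigma, Finset.mem_filter, Finset.mem_univ, true_and] at hiw ⊢
      rw [← h i hiw.1, hiw.2]
    · rintro ⟨i, w⟩ hiw ⟨j, w'⟩ hjw' e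
      simp only [Finset.mem_sigma, Finset.mem_filter, Finset.mem_univ, true_and] at hiw hjw'
      exact hu' i hiw.1 j hjw'.1 w w' (hiw.2.trans hjw'.2.symm) e
    · intro y hy
      simp only [Finset.mem_filter, Finset.mem_univ, true_and] at hy
      obtain ⟨i, hi, w, hw, hw'⟩ := hu x y hy.symm
      exact ⟨⟨i, w⟩, by simpa using ⟨hi, hw⟩, hw'⟩
    · intros; rfl

theorem pull_comp [Finite X] [Finite Y] (φ : X → Y) (hφ : ∀ (g : G) x, φ (g • x) = g • φ x)
    (ψ : Y → Z) (hψ : ∀ (g : G) x, ψ (g • x) = g • ψ x)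
    (χ : X → Z) (hχ : ∀ (g : G) x, χ (g • x) = g • χ x) (h : ∀ x, ψ (φ x) = χ x) :
    pull k ψ hψ ≫ pull k φ hφ = pull k χ hχ :=
  perm_hom_ext fun z => by
    classical
    let _ := Fintype.ofFinite X
    let _ := Fintype.ofFinite Y
    rw [pull_single, hom_comp, Representation.IntertwiningMap.comp_apply, pull_single]
    rw [fibreSum, map_sum, Finset.sum_congr rfl fun y _ => (pull_single φ hφ y).trans
      (rfl : _ = ∑ x with φ x = y, MonoidAlgebra.single x (1 : k))]
    simp only [fibreSum]
    rw [Finset.sum_sigma']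
    refine Finset.sum_bij (fun a _ => a.2) ?_ ?_ ?_ ?_
    · rintro ⟨y, x⟩ hyx
      simp only [Finset.mem_sigma, Finset.mem_filter, Finset.mem_univ, true_and] at hyx ⊢
      rw [← h, hyx.2, hyx.1]
    · rintro ⟨y, x⟩ hyx ⟨y', x'⟩ hyx' e
      simp only [Finset.mem_sigma, Finset.mem_filter, Finset.mem_univ, true_and] at hyx hyx' e
      obtain rfl := e
      obtain rfl : y = y' := hyx.2.symm.trans hyx'.2
      rfl
    · intro x hx
      simp only [Finset.mem_filter, Finset.mem_univ, true_and] at hx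
      exact ⟨⟨φ x, x⟩, by simp [h, hx], rfl⟩
    · intros; rfl

theorem pull_push [Finite X] (φ : X → Y) (hφ : ∀ (g : G) x, φ (g • x) = g • φ x) (n : ℕ)
    (hn : ∀ y, Nat.card {x // φ x = y} = n) : pull k φ hφ ≫ push k φ hφ = (n : k) • 𝟙 _ :=
  perm_hom_ext fun y => by
    classical
    let _ := Fintype.ofFinite X
    rw [hom_comp, Representation.IntertwiningMap.comp_apply, pull_single]
    rw [fibreSum, map_sum, Finset.sum_congr rfl (g := fun _ => MonoidAlgebra.single y (1 : k))
      (fun x hx => (push_single φ hφ x).trans (by rw [(Finset.mem_filter.1 hx).2])),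
      Finset.sum_const,
      ← hn y, Nat.card_eq_fintype_card, Fintype.card_subtype, smul_hom]
    change _ = (_ : k) • MonoidAlgebra.single y (1 : k)
    simp

end Permutation

end Rep

section FunPlus

variable (k G : Type u) [CommRing k] [Group G]

/-- The `kG`-modules which are direct summands of finitely generated permutation modules `k[X]`,
`X` a finite `G`-set. -/
def IsPermSummand : ObjectProperty (Rep.{u} k G) := fun W =>
  ∃ (X : Type u) (_ : MulAction G X) (_ : Finite X), Nonempty (Retract W (Rep.ofMulAction k G X))

/-- The category `perm⁺_k(G)` of direct summands of finitely generated permutation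
`kG`-modules, a full subcategory of the category of `kG`-modules. -/
abbrev PermPlus := (IsPermSummand k G).FullSubcategory

variable {k G} in
/-- A contravariant functor from `perm⁺_k(G)` to `k`-modules is `k`-linear if its maps on morphisms
are. -/
def IsLinearContravariant : ObjectProperty ((PermPlus k G)ᵒᵖ ⥤ ModuleCat.{u} k) := fun F =>
  (∀ (X Y : PermPlus k G) (a b : X ⟶ Y), F.map (a + b).op = F.map a.op + F.map b.op) ∧
    ∀ (X Y : PermPlus k G) (r : k) (a : X ⟶ Y), F.map (r • a).op = r • F.map a.op

/-- The category `Fun⁺_k(G)` of contravariant `k`-linear functors from `perm⁺_k(G)` to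
`k`-modules. -/
abbrev FunPlus := (IsLinearContravariant (k := k) (G := G)).FullSubcategory

variable {G} in
/-- The permutation module `k[X]` of a finite `G`-set, as an object of `perm⁺_k(G)`. -/
noncomputable abbrev PermPlus.perm (X : Type u) [MulAction G X] [Finite X] : PermPlus k G :=
  ⟨Rep.ofMulAction k G X, X, inferInstance, inferInstance, ⟨Retract.refl _⟩⟩

end FunPlus

namespace Subgroup

variable {G : Type u} [Group G]

/-- The map `G/gHg⁻¹ → G/H`, `xgHg⁻¹ ↦ xgH`. -/
def quotientConj (g : G) {H L : Subgroup G} (h : MulAut.conj g • H = L) : G ⧸ L → G ⧸ H :=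
  Quotient.map' (· * g) fun a b hab => by
    rw [QuotientGroup.leftRel_apply] at hab ⊢
    subst h
    obtain ⟨x, hx, e⟩ := Subgroup.mem_smul_pointwise_iff_exists _ _ _ |>.1 hab
    have : (a * g)⁻¹ * (b * g) = x := by
      rw [mul_inv_rev, mul_assoc, ← mul_assoc a⁻¹, ← e]
      simp [mul_assoc]
    rwa [this]

@[simp]
theorem quotientConj_mk (g : G) {H L : Subgroup G} (h : MulAut.conj g • H = L) (x : G) :
    quotientConj g h (x : G ⧸ L) = ((x * g : G) : G ⧸ H) := rfl

theorem quotientConj_smul (g : G) {H L : Subgroup G} (h : MulAut.conj g • H = L) (a : G)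
    (x : G ⧸ L) : quotientConj g h (a • x) = a • quotientConj g h x := by
  induction x using QuotientGroup.induction_on with
  | H x => rw [MulAction.Quotient.smul_coe, quotientConj_mk, quotientConj_mk,
      MulAction.Quotient.smul_coe, smul_eq_mul, smul_eq_mul, mul_assoc]

theorem quotientMapOfLE_smul {K H : Subgroup G} (h : K ≤ H) (a : G)
    (x : G ⧸ K) : quotientMapOfLE h (a • x) = a • quotientMapOfLE h x := by
  induction x using QuotientGroup.induction_on with
  | H x => rfl

theorem card_fibre_quotientMapOfLE {K H : Subgroup G} (h : K ≤ H) (y : G ⧸ H) :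
    Nat.card {x : G ⧸ K // quotientMapOfLE h x = y} = K.relIndex H := by
  let e := quotientEquivProdOfLE h
  have he : ∀ x, (e x).1 = quotientMapOfLE h x := fun x => rfl
  refine Nat.card_congr
    { toFun := fun x => (e x.1).2
      invFun := fun z => ⟨e.symm (y, z), by rw [← he, Equiv.apply_symm_apply]⟩
      left_inv := ?_
      right_inv := fun z => by simp }
  rintro ⟨x, rfl⟩
  refine Subtype.ext ?_
  change e.symm (quotientMapOfLE h x, (e x).2) = x
  rw [← he, Prod.mk.eta, Equiv.symm_apply_apply]

end Subgroup

namespace CohMackey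

section OfFun

variable {k G : Type u} [CommRing k] [Group G]

open Subgroup Rep

variable (k) in
/-- The projection `k[G/K] ⟶ k[G/H]`, `xK ↦ xH`, for `K ≤ H`. -/
noncomputable abbrev projHom {K H : Subgroup G} (h : K ≤ H) :
    ofMulAction k G (G ⧸ K) ⟶ ofMulAction k G (G ⧸ H) :=
  push k (quotientMapOfLE h) (quotientMapOfLE_smul h)

variable (k) in
/-- The morphism `k[G/H] ⟶ k[G/K]`, `xH ↦ ∑_{hK ∈ H/K} xhK`, for `K ≤ H`: the sum is over the
elements of `G/K` lying over `xH`. -/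
noncomputable abbrev sumHom [Finite G] {K H : Subgroup G} (h : K ≤ H) :
    ofMulAction k G (G ⧸ H) ⟶ ofMulAction k G (G ⧸ K) :=
  pull k (quotientMapOfLE h) (quotientMapOfLE_smul h)

variable (k) in
/-- The morphism `k[G/gHg⁻¹] ⟶ k[G/H]`, `xgHg⁻¹ ↦ xgH`. -/
noncomputable abbrev conjHom (g : G) {H L : Subgroup G} (h : MulAut.conj g • H = L) :
    ofMulAction k G (G ⧸ L) ⟶ ofMulAction k G (G ⧸ H) :=
  push k (quotientConj g h) (quotientConj_smul g h)

theorem sumHom_conjHom [Finite G] (g : G) {K H K' H' : Subgroup G} (h : K ≤ H) (h' : K' ≤ H')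
    (hK : MulAut.conj g • K = K') (hH : MulAut.conj g • H = H') :
    conjHom k g hH ≫ sumHom k h = sumHom k h' ≫ conjHom k g hK := by
  refine (push_pull {PUnit.unit} (fun _ : PUnit => G ⧸ K') _ _ _ _
    (fun _ => quotientMapOfLE h') (fun _ => quotientMapOfLE_smul h')
    (fun _ => quotientConj g hK) (fun _ => quotientConj_smul g hK) ?_ ?_ ?_).trans
    (Finset.sum_singleton _ _)
  · rintro _ _ w
    induction w using QuotientGroup.induction_on with
    | H w => simp
  · intro x y hxy
    induction x using QuotientGroup.induction_on with
    | H x =>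
    induction y using QuotientGroup.induction_on with
    | H y =>
    refine ⟨PUnit.unit, by simp, ((y * g⁻¹ : G) : G ⧸ K'), ?_, by simp⟩
    rw [quotientConj_mk, quotientMapOfLE_apply_mk, QuotientGroup.eq] at hxy
    rw [quotientMapOfLE_apply_mk, eq_comm, QuotientGroup.eq, ← hH,
      Subgroup.mem_smul_pointwise_iff_exists]
    exact ⟨_, hxy, by simp [mul_assoc]⟩
  · rintro _ _ _ _ w w' - e
    induction w using QuotientGroup.induction_on with
    | H w =>
    induction w' using QuotientGroup.induction_on with
    | H w' =>
    rw [quotientConj_mk, quotientConj_mk, QuotientGroup.eq] at e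
    congr 1
    rw [QuotientGroup.eq, ← hK, Subgroup.mem_smul_pointwise_iff_exists]
    exact ⟨_, e, by simp [mul_assoc]⟩

theorem projHom_sumHom [Finite G] {K L H : Subgroup G} (hK : K ≤ H) (hL : L ≤ H) (S : Finset G)
    (hS : IsDoubleCosetReps L H K S) :
    projHom k hL ≫ sumHom k hK = ∑ x ∈ S,
      sumHom k (inf_le_right : MulAut.conj x • K ⊓ L ≤ L) ≫
        conjHom k x (conj_smul_inf_conj_inv x K L) ≫
          projHom k (inf_le_left : K ⊓ MulAut.conj x⁻¹ • L ≤ K) := by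
  let q : ∀ x : G, G ⧸ (MulAut.conj x • K ⊓ L) → G ⧸ K := fun x w =>
    quotientMapOfLE (inf_le_left : K ⊓ MulAut.conj x⁻¹ • L ≤ K)
      (quotientConj x (conj_smul_inf_conj_inv x K L) w)
  have hq : ∀ x (g : G) w, q x (g • w) = g • q x w := fun x g w => by
    simp only [q, quotientConj_smul, quotientMapOfLE_smul]
  have hqm : ∀ x w : G, q x (w : G ⧸ (MulAut.conj x • K ⊓ L)) = ((w * x : G) : G ⧸ K) :=
    fun _ _ => rfl
  refine (push_pull S (fun x : G => G ⧸ (MulAut.conj x • K ⊓ L)) _ _ _ _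
    (fun x => quotientMapOfLE inf_le_right) (fun _ => quotientMapOfLE_smul _)
    q hq ?_ ?_ ?_).trans ?_
  · intro x hx w
    induction w using QuotientGroup.induction_on with
    | H w =>
    rw [hqm, quotientMapOfLE_apply_mk, quotientMapOfLE_apply_mk, quotientMapOfLE_apply_mk,
      QuotientGroup.eq, inv_mul_cancel_left]
    exact hS.1 x hx
  · intro a b hab
    induction a using QuotientGroup.induction_on with
    | H a =>
    induction b using QuotientGroup.induction_on with
    | H b =>
    rw [quotientMapOfLE_apply_mk, quotientMapOfLE_apply_mk, QuotientGroup.eq] at hab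
    obtain ⟨s, ⟨hs, l, hl, p, hp, e⟩, -⟩ := hS.2 _ hab
    refine ⟨s, hs, ((a * l : G) : G ⧸ _), ?_, ?_⟩
    · rw [quotientMapOfLE_apply_mk, eq_comm, QuotientGroup.eq, inv_mul_cancel_left]
      exact hl
    · rw [hqm, QuotientGroup.eq]
      have : b = a * (l * s * p) := by rw [← e, mul_inv_cancel_left]
      rw [this]
      simpa [mul_assoc] using hp
  · intro x hx y hy w w' e e'
    induction w using QuotientGroup.induction_on with
    | H w =>
    induction w' using QuotientGroup.induction_on with
    | H w' =>
    rw [quotientMapOfLE_apply_mk, quotientMapOfLE_apply_mk, QuotientGroup.eq] at e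
    rw [hqm, hqm, QuotientGroup.eq] at e'
    obtain rfl : x = y := (hS.2 x (hS.1 x hx)).unique
      ⟨hx, 1, one_mem _, 1, one_mem _, by simp⟩
      ⟨hy, w⁻¹ * w', e, ((w * x)⁻¹ * (w' * y))⁻¹, inv_mem e', by simp [mul_assoc]⟩
    congr 1
    rw [QuotientGroup.eq]
    refine ⟨?_, e⟩
    change w⁻¹ * w' ∈ MulAut.conj x • K
    rw [Subgroup.mem_smul_pointwise_iff_exists]
    exact ⟨_, e', by simp [mul_assoc]⟩
  · refine Finset.sum_congr rfl fun x _ => ?_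
    rw [push_comp (quotientConj x (conj_smul_inf_conj_inv x K L)) (quotientConj_smul _ _)
      (quotientMapOfLE inf_le_left) (quotientMapOfLE_smul _) (q x) (hq x) fun _ => rfl]

theorem projHom_self (H : Subgroup G) : projHom k (le_refl H) = 𝟙 _ :=
  push_id _ _ fun x => by induction x using QuotientGroup.induction_on; rfl

theorem sumHom_self [Finite G] (H : Subgroup G) : sumHom k (le_refl H) = 𝟙 _ :=
  pull_id _ _ fun x => by induction x using QuotientGroup.induction_on; rfl

theorem conjHom_self (g : G) {H : Subgroup G} (h : MulAut.conj g • H = H) (hg : g ∈ H) :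
    conjHom k g h = 𝟙 _ :=
  push_id _ _ fun x => by
    induction x using QuotientGroup.induction_on with
    | H x => rw [quotientConj_mk, eq_comm, QuotientGroup.eq, inv_mul_cancel_left]; exact hg

theorem projHom_projHom {L K H : Subgroup G} (h : L ≤ K) (h' : K ≤ H) :
    projHom k h ≫ projHom k h' = projHom k (h.trans h') :=
  push_comp _ (quotientMapOfLE_smul h) _ (quotientMapOfLE_smul h') _ _ fun x => by
    induction x using QuotientGroup.induction_on; rfl

theorem sumHom_sumHom [Finite G] {L K H : Subgroup G} (h : L ≤ K) (h' : K ≤ H) :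
    sumHom k h' ≫ sumHom k h = sumHom k (h.trans h') :=
  pull_comp _ (quotientMapOfLE_smul h) _ (quotientMapOfLE_smul h') _ _ fun x => by
    induction x using QuotientGroup.induction_on; rfl

theorem conjHom_conjHom (g g' : G) {H H' H'' : Subgroup G} (h : MulAut.conj g • H = H')
    (h' : MulAut.conj g' • H' = H'') (h'' : MulAut.conj (g' * g) • H = H'') :
    conjHom k g' h' ≫ conjHom k g h = conjHom k (g' * g) h'' :=
  push_comp _ (quotientConj_smul g' h') _ (quotientConj_smul g h) _ _ fun x => by
    induction x using QuotientGroup.induction_on with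
    | H x => simp [mul_assoc]

theorem conjHom_projHom (g : G) {K H K' H' : Subgroup G} (h : K ≤ H) (h' : K' ≤ H')
    (hK : MulAut.conj g • K = K') (hH : MulAut.conj g • H = H') :
    conjHom k g hK ≫ projHom k h = projHom k h' ≫ conjHom k g hH :=
  (push_comp _ (quotientConj_smul g hK) _ (quotientMapOfLE_smul h)
    (fun x => quotientMapOfLE h (quotientConj g hK x))
    (fun _ _ => by rw [quotientConj_smul, quotientMapOfLE_smul]) fun _ => rfl).trans
  (push_comp _ (quotientMapOfLE_smul h') _ (quotientConj_smul g hH) _ _ fun x => by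
    induction x using QuotientGroup.induction_on; rfl).symm

theorem sumHom_projHom [Finite G] {K H : Subgroup G} (h : K ≤ H) :
    sumHom k h ≫ projHom k h = (K.relIndex H : k) • 𝟙 _ :=
  pull_push _ _ _ (card_fibre_quotientMapOfLE h)

section FunMap

variable (F : FunPlus k G) {X Y Z : Type u} [MulAction G X] [MulAction G Y] [MulAction G Z]
  [Finite X] [Finite Y] [Finite Z]

/-- The map `F(k[Y]) ⟶ F(k[X])` induced by a morphism `k[X] ⟶ k[Y]`. -/
noncomputable def funMap (a : ofMulAction k G X ⟶ ofMulAction k G Y) :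
    F.obj.obj (.op (PermPlus.perm k Y)) ⟶ F.obj.obj (.op (PermPlus.perm k X)) :=
  F.obj.map (Quiver.Hom.op (X := PermPlus.perm k X) (Y := PermPlus.perm k Y)
    (ObjectProperty.homMk a))

theorem funMap_id : funMap F (𝟙 (ofMulAction k G X)) = 𝟙 _ := F.obj.map_id _

theorem funMap_comp (a : ofMulAction k G X ⟶ ofMulAction k G Y)
    (b : ofMulAction k G Y ⟶ ofMulAction k G Z) :
    funMap F (a ≫ b) = funMap F b ≫ funMap F a := by
  simp only [funMap, ← F.obj.map_comp]
  rfl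

theorem funMap_sum {ι : Type*} (S : Finset ι)
    (a : ι → (ofMulAction k G X ⟶ ofMulAction k G Y)) :
    funMap F (∑ i ∈ S, a i) = ∑ i ∈ S, funMap F (a i) :=
  map_sum (AddMonoidHom.mk' (funMap F) fun _ _ => F.property.1 _ _ _ _) a S

theorem funMap_smul (r : k) (a : ofMulAction k G X ⟶ ofMulAction k G Y) :
    funMap F (r • a) = r • funMap F a := F.property.2 _ _ _ _

end FunMap

/-- The cohomological Mackey functor `H ↦ F(k[G/H])` of a functor `F` in `Fun⁺_k(G)`; restrictions,
transfers and conjugations are induced by the projections `k[G/K] ⟶ k[G/H]`, the maps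
`k[G/H] ⟶ k[G/K]`, `xH ↦ ∑ xhK`, and the maps `k[G/gHg⁻¹] ⟶ k[G/H]`. This is the functor
which Yoshida's theorem asserts to be an equivalence of categories. -/
noncomputable def ofFun (k G : Type u) [CommRing k] [Group G] [Finite G] :
    FunPlus k G ⥤ CohMackey k G where
  obj F :=
    { obj := fun H => F.obj.obj (.op (PermPlus.perm k (G ⧸ H)))
      res := fun h => funMap F (projHom k h)
      tr := fun h => funMap F (sumHom k h)
      conj := fun g _ _ h => funMap F (conjHom k g h)
      res_self := fun H => by rw [projHom_self, funMap_id]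
      tr_self := fun H => by rw [sumHom_self, funMap_id]
      conj_self := fun g H h hg => by rw [conjHom_self g h hg, funMap_id]
      res_res := fun h h' => by rw [← funMap_comp, projHom_projHom]
      tr_tr := fun h h' => by rw [← funMap_comp, sumHom_sumHom]
      conj_conj := fun g g' _ _ _ h h' h'' => by
        rw [← funMap_comp, conjHom_conjHom g g' h h' h'']
      res_conj := fun g _ _ _ _ h h' hK hH => by
        rw [← funMap_comp, ← funMap_comp, conjHom_projHom g h h' hK hH]
      tr_conj := fun g _ _ _ _ h h' hK hH => by
        rw [← funMap_comp, ← funMap_comp, sumHom_conjHom g h h' hK hH]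
      mackey := fun hK hL S hS => by
        rw [← funMap_comp, projHom_sumHom hK hL S hS, funMap_sum]
        exact Finset.sum_congr rfl fun x _ => by rw [funMap_comp, funMap_comp, Category.assoc]
      res_tr := fun h => by rw [← funMap_comp, sumHom_projHom, funMap_smul, funMap_id] }
  map φ :=
    { app := fun H => φ.hom.app _
      res := fun h => φ.hom.naturality _
      tr := fun h => φ.hom.naturality _
      conj := fun g _ _ h => φ.hom.naturality _ }

end OfFun

end CohMackey

section Trace

open Representation

variable {k G : Type u} [CommRing k] [Group G] (N : Subgroup G) [Finite N]

/-- The relative trace `tr_1^N : V → V`, `v ↦ ∑_{n ∈ N} n v`. -/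
noncomputable def relTrace {V : Type u} [AddCommGroup V] [Module k V] (ρ : Representation k G V) :
    V →ₗ[k] V :=
  letI := Fintype.ofFinite N
  ∑ n : N, ρ n

section

variable {V : Type u} [AddCommGroup V] [Module k V] (ρ : Representation k G V)

theorem relTrace_apply [Fintype N] (v : V) : relTrace N ρ v = ∑ n : N, ρ n v := by
  simp only [relTrace, LinearMap.sum_apply]
  exact Finset.sum_congr (by ext; simp) fun _ _ => rfl

theorem self_relTrace (n : G) (hn : n ∈ N) (v : V) : ρ n (relTrace N ρ v) = relTrace N ρ v := by
  let _ := Fintype.ofFinite N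
  rw [relTrace_apply, map_sum]
  exact Fintype.sum_equiv (Equiv.mulLeft (⟨n, hn⟩ : N)) _ _ fun x => by simp

theorem relTrace_self (n : G) (hn : n ∈ N) (v : V) : relTrace N ρ (ρ n v) = relTrace N ρ v := by
  let _ := Fintype.ofFinite N
  rw [relTrace_apply, relTrace_apply]
  exact Fintype.sum_equiv (Equiv.mulRight (⟨n, hn⟩ : N)) _ _ fun x => by simp

theorem relTrace_comm [N.Normal] (g : G) (v : V) :
    ρ g (relTrace N ρ v) = relTrace N ρ (ρ g v) := by
  let _ := Fintype.ofFinite N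
  rw [relTrace_apply, relTrace_apply, map_sum]
  refine Fintype.sum_equiv (MulAut.conjNormal g).toEquiv _ _ fun x => ?_
  simp [← Module.End.mul_apply, ← map_mul]

theorem range_relTrace_le [N.Normal] (g : G) :
    LinearMap.range (relTrace N ρ) ≤ (LinearMap.range (relTrace N ρ)).comap (ρ g) := by
  rintro _ ⟨v, rfl⟩
  exact ⟨ρ g v, (relTrace_comm N ρ g v).symm⟩

instance [N.Normal] : IsTrivial ((ρ.subrepresentation (LinearMap.range (relTrace N ρ))
    (range_relTrace_le N ρ)).comp N.subtype) where
  out n := by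
    ext ⟨_, v, rfl⟩
    exact self_relTrace N ρ n n.2 v

end

variable [N.Normal]

/-- The functor `W ↦ tr_1^N(W)` from `kG`-modules to `k(G/N)`-modules. -/
noncomputable def traceFunctor : Rep.{u} k G ⥤ Rep.{u} k (G ⧸ N) where
  obj W := Rep.of (ofQuotient (W.ρ.subrepresentation (LinearMap.range (relTrace N W.ρ))
    (range_relTrace_le N W.ρ)) N)
  map {W W'} f := Rep.ofHom
    ⟨f.hom.toLinearMap.restrict (p := LinearMap.range (relTrace N W.ρ))
      (q := LinearMap.range (relTrace N W'.ρ)) (by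
        rintro _ ⟨v, rfl⟩
        let _ := Fintype.ofFinite N
        refine ⟨f.hom v, ?_⟩
        change _ = f.hom (relTrace N W.ρ v)
        rw [relTrace_apply, relTrace_apply, map_sum]
        exact Finset.sum_congr rfl fun n _ => (Rep.hom_comm_apply f n v).symm),
    fun g ↦ QuotientGroup.induction_on g fun g ↦ by
      ext v
      exact Rep.hom_comm_apply f g v.1⟩

theorem traceFunctor_map_add {W W' : Rep.{u} k G} (a b : W ⟶ W') :
    (traceFunctor N).map (a + b) = (traceFunctor N).map a + (traceFunctor N).map b := rfl

theorem traceFunctor_map_smul {W W' : Rep.{u} k G} (r : k) (a : W ⟶ W') :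
    (traceFunctor N).map (r • a) = r • (traceFunctor N).map a := rfl

end Trace

section OrbitSet

variable {G : Type u} [Group G] (N : Subgroup G) (X : Type u) [MulAction G X]

/-- The set `N\X` of `N`-orbits of a `G`-set `X`. -/
abbrev OrbitSet := MulAction.orbitRel.Quotient N X

variable {X}

/-- The orbit of a point. -/
abbrev OrbitSet.mk (x : X) : OrbitSet N X := Quotient.mk'' x

theorem OrbitSet.mk_eq_iff {x y : X} : mk N x = mk N y ↔ ∃ n ∈ N, n • y = x := by
  rw [mk, mk, Quotient.eq'', MulAction.orbitRel_apply, MulAction.mem_orbit_iff]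
  simp [Subgroup.smul_def]

variable (X) in
/-- The action of `G/N` on `N\X`. -/
instance [N.Normal] : MulAction (G ⧸ N) (OrbitSet N X) where
  smul q o := Quotient.liftOn₂' q o (fun g x => OrbitSet.mk N (g • x)) fun g x g' x' hg hx => by
    rw [QuotientGroup.leftRel_apply] at hg
    obtain ⟨n, hn, rfl⟩ := (OrbitSet.mk_eq_iff N).1 (Quotient.sound' hx)
    refine (OrbitSet.mk_eq_iff N).2 ⟨g * (n * (g⁻¹ * g')⁻¹) * g⁻¹,
      Subgroup.Normal.conj_mem inferInstance _ (mul_mem hn (inv_mem hg)) g, ?_⟩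
    rw [smul_smul, smul_smul]
    congr 1
    group
  one_smul o := by
    induction o using Quotient.inductionOn' with
    | h x => exact congrArg _ (one_smul G x)
  mul_smul p q o := by
    induction o using Quotient.inductionOn' with
    | h x =>
    induction p using QuotientGroup.induction_on with
    | H a =>
    induction q using QuotientGroup.induction_on with
    | H b => exact congrArg _ (mul_smul a b x)

theorem OrbitSet.smul_mk [N.Normal] (g : G) (x : X) :
    (g : G ⧸ N) • OrbitSet.mk N x = OrbitSet.mk N (g • x) := rfl

end OrbitSet

section TracePerm

open Representation

variable {k G : Type u} [Field k] [Group G] (N : Subgroup G) [Finite N] [N.Normal]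
  {X : Type u} [MulAction G X]

variable (k) in
/-- The element `tr_1^N(x)` of `k[X]`. -/
noncomputable abbrev trPt (x : X) : MonoidAlgebra k X :=
  relTrace N (Representation.ofMulAction k G X) (MonoidAlgebra.single x 1)

theorem smul_trPt (g : G) (x : X) :
    Representation.ofMulAction k G X g (trPt k N x) = trPt k N (g • x) := by
  rw [trPt, relTrace_comm, Representation.ofMulAction_single]

theorem trPt_smul (n : G) (hn : n ∈ N) (x : X) : trPt k N (n • x) = trPt k N x := by
  rw [← smul_trPt, self_relTrace N _ n hn]

theorem trPt_coeff_smul (g : G) (x : X) :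
    (trPt k N (g • x)).coeff (g • x) = (trPt k N x).coeff x := by
  rw [← smul_trPt, Representation.coeff_ofMulAction, inv_smul_smul]

theorem coeff_smul_of_mem (v : MonoidAlgebra k X)
    (hv : v ∈ LinearMap.range (relTrace N (Representation.ofMulAction k G X))) (n : G)
    (hn : n ∈ N) (x : X) : v.coeff (n • x) = v.coeff x := by
  obtain ⟨w, rfl⟩ := hv
  conv_lhs => rw [← self_relTrace N _ n hn]
  rw [Representation.coeff_ofMulAction, inv_smul_smul]

theorem trPt_coeff_eq_zero (x y : X) (h : OrbitSet.mk N x ≠ OrbitSet.mk N y) :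
    (trPt k N x).coeff y = 0 := by
  classical
  let _ := Fintype.ofFinite N
  rw [trPt, relTrace_apply]
  simp only [Representation.ofMulAction_single, MonoidAlgebra.coeff_sum, Finsupp.finsetSum_apply]
  refine Finset.sum_eq_zero fun n _ => ?_
  rw [MonoidAlgebra.coeff_single, Finsupp.single_apply, if_neg]
  rintro rfl
  exact h ((OrbitSet.mk_eq_iff N).2 ⟨(n : G)⁻¹, inv_mem n.2, inv_smul_smul _ _⟩)

theorem trPt_congr {x y : X} (h : OrbitSet.mk N x = OrbitSet.mk N y) :
    trPt k N x = trPt k N y := by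
  obtain ⟨n, hn, rfl⟩ := (OrbitSet.mk_eq_iff N).1 h
  exact trPt_smul N n hn y

theorem trPt_coeff_congr {x y : X} (h : OrbitSet.mk N x = OrbitSet.mk N y) :
    (trPt k N x).coeff x = (trPt k N y).coeff y := by
  obtain ⟨n, hn, rfl⟩ := (OrbitSet.mk_eq_iff N).1 h
  exact trPt_coeff_smul N n y

variable [Finite X]

/-- The map `k[X] → k[N\X]` whose coefficient at an orbit is the coefficient at a chosen
representative. -/
noncomputable def outMap : MonoidAlgebra k X →ₗ[k] MonoidAlgebra k (OrbitSet N X) :=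
  (MonoidAlgebra.coeffLinearEquiv k).symm.toLinearMap ∘ₗ
    (Finsupp.linearEquivFunOnFinite k k (OrbitSet N X)).symm.toLinearMap ∘ₗ
      LinearMap.funLeft k k Quotient.out ∘ₗ Finsupp.lcoeFun ∘ₗ
        (MonoidAlgebra.coeffLinearEquiv k).toLinearMap

theorem outMap_coeff (v : MonoidAlgebra k X) (o : OrbitSet N X) :
    (outMap N v).coeff o = v.coeff o.out := rfl

/-- The inclusion `tr_1^N(k[X]) → k[N\X]`: an element of `tr_1^N(k[X])` is constant on the
`N`-orbits. -/
noncomputable def traceIncl :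
    (traceFunctor N).obj (Rep.ofMulAction k G X) ⟶ Rep.ofMulAction k (G ⧸ N) (OrbitSet N X) :=
  Rep.ofHom
    ⟨outMap N ∘ₗ (LinearMap.range (relTrace N (Representation.ofMulAction k G X))).subtype, by
      intro q
      induction q using QuotientGroup.induction_on with
      | H g =>
      refine LinearMap.ext fun v => MonoidAlgebra.ext (Finsupp.ext fun o => ?_)
      change (Representation.ofMulAction k G X g v.1).coeff o.out =
        (Representation.ofMulAction k (G ⧸ N) (OrbitSet N X) g (outMap N v.1)).coeff o
      rw [Representation.coeff_ofMulAction, Representation.coeff_ofMulAction, outMap_coeff]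
      have h : OrbitSet.mk N (Quotient.out ((g : G ⧸ N)⁻¹ • o)) = OrbitSet.mk N (g⁻¹ • o.out) := by
        rw [← OrbitSet.smul_mk, OrbitSet.mk, OrbitSet.mk, Quotient.out_eq', Quotient.out_eq']
        rfl
      obtain ⟨n, hn, e⟩ := (OrbitSet.mk_eq_iff N).1 h
      rw [← e, coeff_smul_of_mem N v.1 v.2 n hn]⟩

/-- The map `k[N\X] → tr_1^N(k[X])`, `Nx ↦ |N_x|⁻¹ tr_1^N(x)` (zero if `|N_x| = 0` in `k`). -/
noncomputable def traceProj :
    Rep.ofMulAction k (G ⧸ N) (OrbitSet N X) ⟶ (traceFunctor N).obj (Rep.ofMulAction k G X) :=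
  Rep.permHom (fun o => (⟨((trPt k N o.out).coeff o.out)⁻¹ • trPt k N o.out,
      Submodule.smul_mem _ _ ⟨_, rfl⟩⟩ :
        LinearMap.range (relTrace N (Representation.ofMulAction k G X)))) fun q o => by
    induction q using QuotientGroup.induction_on with
    | H g =>
    refine Subtype.ext ?_
    change _ = Representation.ofMulAction k G X g
      (((trPt k N o.out).coeff o.out)⁻¹ • trPt k N o.out)
    have h : OrbitSet.mk N (Quotient.out ((g : G ⧸ N) • o)) = OrbitSet.mk N (g • o.out) := by
      rw [← OrbitSet.smul_mk, OrbitSet.mk, OrbitSet.mk, Quotient.out_eq', Quotient.out_eq']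
    rw [map_smul, smul_trPt, ← trPt_coeff_smul N g o.out, ← trPt_coeff_congr N h,
      ← trPt_congr N h]

theorem traceProj_single (o : OrbitSet N X) (r : k) :
    ((traceProj N).hom (r • MonoidAlgebra.single o (1 : k)) :
      LinearMap.range (relTrace N (Representation.ofMulAction k G X))).1 =
      r • ((trPt k N o.out).coeff o.out)⁻¹ • trPt k N o.out := by
  rw [map_smul]
  have h : (traceProj N).hom (MonoidAlgebra.single o (1 : k)) =
      (⟨((trPt k N o.out).coeff o.out)⁻¹ • trPt k N o.out, Submodule.smul_mem _ _ ⟨_, rfl⟩⟩ :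
        LinearMap.range (relTrace N (Representation.ofMulAction k G X))) :=
    (Rep.permHom_single _ _ o 1).trans (one_smul k _)
  rw [h]
  rfl

theorem traceIncl_traceProj :
    traceIncl N ≫ traceProj N = 𝟙 ((traceFunctor N).obj (Rep.ofMulAction k G X)) := by
  let T := relTrace N (Representation.ofMulAction k G X)
  have key : (LinearMap.range T).subtype ∘ₗ (traceProj (k := k) N (X := X)).hom.toLinearMap ∘ₗ
      outMap N ∘ₗ T = T := by
    refine MonoidAlgebra.lhom_ext' fun x => LinearMap.ext_ring ?_
    change ((traceProj N).hom (outMap N (trPt k N x))).1 = trPt k N x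
    have h0 : OrbitSet.mk N x = OrbitSet.mk N (Quotient.out (OrbitSet.mk N x)) :=
      (Quotient.out_eq' (OrbitSet.mk N x)).symm
    have h1 : outMap N (trPt k N x) =
        (trPt k N x).coeff x • MonoidAlgebra.single (OrbitSet.mk N x) 1 := by
      classical
      refine MonoidAlgebra.ext (Finsupp.ext fun o => ?_)
      rw [outMap_coeff]
      by_cases ho : OrbitSet.mk N x = o
      · subst ho
        obtain ⟨n, hn, e⟩ := (OrbitSet.mk_eq_iff N).1 h0.symm
        rw [← e, coeff_smul_of_mem N _ ⟨_, rfl⟩ n hn]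
        simp
      · rw [trPt_coeff_eq_zero N x o.out (fun h => ho (h.trans (Quotient.out_eq' o)))]
        simp [ho]
    rw [h1]
    refine (traceProj_single N _ _).trans ?_
    rw [← trPt_coeff_congr N h0, ← trPt_congr N h0, smul_smul]
    by_cases hx : (trPt k N x).coeff x = 0
    · have : trPt k N x = 0 := by
        refine MonoidAlgebra.ext (Finsupp.ext fun y => ?_)
        by_cases hy : OrbitSet.mk N x = OrbitSet.mk N y
        · obtain ⟨n, hn, e⟩ := (OrbitSet.mk_eq_iff N).1 hy.symm
          rw [← e, coeff_smul_of_mem N _ ⟨_, rfl⟩ n hn, hx]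
          rfl
        · exact trPt_coeff_eq_zero N x y hy
      rw [this, smul_zero]
    · rw [mul_inv_cancel₀ hx, one_smul]
  refine Rep.hom_ext (Representation.IntertwiningMap.ext (LinearMap.ext ?_))
  rintro ⟨_, w, rfl⟩
  exact Subtype.ext (LinearMap.congr_fun key w)

theorem isPermSummand_traceFunctor {W : Rep.{u} k G} (hW : IsPermSummand k G W) :
    IsPermSummand k (G ⧸ N) ((traceFunctor N).obj W) := by
  obtain ⟨X, _, _, ⟨e⟩⟩ := hW
  exact ⟨OrbitSet N X, inferInstance, inferInstance,
    ⟨(e.map (traceFunctor N)).trans ⟨traceIncl N, traceProj N, traceIncl_traceProj N⟩⟩⟩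

variable (k) in
/-- The functor `tr_1^N : perm⁺_k(G) → perm⁺_k(G/N)`. -/
noncomputable def tracePerm : PermPlus k G ⥤ PermPlus k (G ⧸ N) :=
  ObjectProperty.lift _ ((IsPermSummand k G).ι ⋙ traceFunctor N) fun W =>
    isPermSummand_traceFunctor N W.property

variable (k) in
/-- Precomposition with `tr_1^N : perm⁺_k(G) → perm⁺_k(G/N)`, as a functor from `Fun⁺_k(G/N)` to
`Fun⁺_k(G)`. -/
noncomputable def FunPlus.precompTrace : FunPlus k (G ⧸ N) ⥤ FunPlus k G :=
  ObjectProperty.lift _ ((IsLinearContravariant (k := k) (G := G ⧸ N)).ι ⋙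
    (Functor.whiskeringLeft _ _ _).obj (tracePerm k N).op) fun F =>
      ⟨fun _ _ a b => F.property.1 _ _ ((tracePerm k N).map a) ((tracePerm k N).map b),
        fun _ _ r a => F.property.2 _ _ r ((tracePerm k N).map a)⟩

end TracePerm

section SimpleFunctor

open Representation

variable {k G : Type u} [CommRing k] [Group G] [Finite G]

/-- The module `tr_1^G Hom_k(W, V)`, where `G` acts on `Hom_k(W, V)` by
`(g • f)(w) = g f(g⁻¹ w)`. -/
noncomputable abbrev trHom (W V : Rep.{u} k G) : Submodule k (W.V →ₗ[k] V.V) :=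
  LinearMap.range (relTrace (⊤ : Subgroup G) (linHom W.ρ V.ρ))

theorem comp_mem_trHom {W W' : Rep.{u} k G} (V : Rep.{u} k G) (a : W ⟶ W') (f : W'.V →ₗ[k] V.V)
    (hf : f ∈ trHom W' V) : LinearMap.lcomp k V.V a.hom.toLinearMap f ∈ trHom W V := by
  obtain ⟨f, rfl⟩ := hf
  let _ := Fintype.ofFinite (⊤ : Subgroup G)
  refine ⟨f ∘ₗ a.hom.toLinearMap, ?_⟩
  rw [relTrace_apply, relTrace_apply, map_sum]
  refine Finset.sum_congr rfl fun g _ => LinearMap.ext fun w => ?_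
  change V.ρ g (f (a.hom (W.ρ (g⁻¹ : G) w))) = V.ρ g (f (W'.ρ (g⁻¹ : G) (a.hom w)))
  rw [Rep.hom_comm_apply]

/-- The functor `S_{1,V}^G : W ↦ tr_1^G Hom_k(W, V)` in `Fun⁺_k(G)`. -/
noncomputable def FunPlus.simpleOne (V : Rep.{u} k G) : FunPlus k G where
  obj :=
    { obj := fun W => ModuleCat.of k (trHom W.unop.obj V)
      map := fun {W W'} a => ModuleCat.ofHom
        ((LinearMap.lcomp k V.V a.unop.hom.hom.toLinearMap).restrict
          (comp_mem_trHom V a.unop.hom))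
      map_id := fun _ => rfl
      map_comp := fun _ _ => rfl }
  property := by
    refine ⟨fun X Y a b => ?_, fun X Y r a => ?_⟩
    · refine ModuleCat.hom_ext (LinearMap.ext fun f => Subtype.ext (LinearMap.ext fun x => ?_))
      exact map_add f.1 _ _
    · refine ModuleCat.hom_ext (LinearMap.ext fun f => Subtype.ext (LinearMap.ext fun x => ?_))
      exact map_smul f.1 _ _

/-- The cohomological Mackey functor `S_{1,V}^G`. -/
noncomputable def CohMackey.simpleOne (V : Rep.{u} k G) : CohMackey k G :=
  (CohMackey.ofFun k G).obj (FunPlus.simpleOne V)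

end SimpleFunctor

section Semidirect

variable {G : Type u} [Group G] (N H : Subgroup G) [N.Normal]

/-- The isomorphism `H ≅ G/N`, `h ↦ hN`, for `G = N ⋊ H`. -/
noncomputable def quotientIso (h : N.IsComplement' H) : G ⧸ N ≃* H :=
  Subgroup.IsComplement'.QuotientMulEquiv h.symm

theorem quotientIso_apply (h : N.IsComplement' H) (x : H) :
    quotientIso N H h ((x : G) : G ⧸ N) = x := by
  rw [← MulEquiv.eq_symm_apply]
  rfl

end Semidirect

section Semidirect

open CategoryTheory.Abelian

variable {k G : Type u} [CommRing k] [Group G] (N H : Subgroup G) [N.Normal]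

/-- The `kG`-module `Ṽ = Inf_{G/N}^G Iso_H^{G/N} V` of a `kH`-module `V`, for `G = N ⋊ H`. -/
noncomputable def Rep.tilde (hH : N.IsComplement' H) (V : Rep.{u} k H) : Rep.{u} k G :=
  Rep.res (QuotientGroup.mk' N) (Rep.res (quotientIso N H hH).toMonoidHom V)

variable (k) in
/-- The functor `Iso_H^{G/N}` from cohomological Mackey functors for `H` to cohomological Mackey
functors for `G/N`, for `G = N ⋊ H`. -/
noncomputable def CohMackey.isoFunctor (hH : N.IsComplement' H) :
    CohMackey k H ⥤ CohMackey k (G ⧸ N) :=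
  CohMackey.restrict k (quotientIso N H hH).toMonoidHom (quotientIso N H hH).injective

variable (k) in
/-- The restriction functor `Res_H^G` of cohomological Mackey functors. -/
abbrev CohMackey.resFunctor : CohMackey k G ⥤ CohMackey k H :=
  CohMackey.restrict k H.subtype H.subtype_injective

/-- The `k`-linear map `Ext^n(A, B) → Ext^n(A', B')` induced by the exact functor `Res_H^G`, after
identification of `Res_H^G A` with `A'` and of `Res_H^G B` with `B'`. -/
noncomputable def CohMackey.resExt {A B : CohMackey k G} {A' B' : CohMackey k H}
    (α : (resFunctor k H).obj A ≅ A') (β : (resFunctor k H).obj B ≅ B') (n : ℕ) :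
    Ext A B n →ₗ[k] Ext A' B' n :=
  (Ext.mk₀ α.inv).precompOfLinear k B' (zero_add n) ∘ₗ
    (Ext.mk₀ β.hom).postcompOfLinear k ((resFunctor k H).obj A) (add_zero n) ∘ₗ
      (resFunctor k H).mapExtLinearMap k A B n

end Semidirect

/-! The functor `σ` is written down directly on Mackey functors, so no inverse of Yoshida's
equivalence is needed. Its value at `H` is `|H ∩ N| · M(HN/N)`; restrictions and conjugations come
from `M`, and the transfer from `K` to `H` is multiplied by `|H ∩ N : K ∩ N|`. The rescaled functor
without the factor `|H ∩ N|` is `inflate`; `traceInflation` is the subfunctor cut out by that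
factor.

This form is dictated by permutation modules. The element `tr_1^N(xH)` of `k[G/H]` depends only on
the `N`-orbit of `xH`, that is, on a point of `(G/N)/(HN/N)`. It is constant, equal to `|H ∩ N|`, on
that orbit and zero elsewhere. So `traceQuot : k[(G/N)/(HN/N)] ⟶ tr_1^N(k[G/H])` is always
surjective, and over a field it is an isomorphism or zero according to whether `|H ∩ N|` is nonzero
in `k`. The same dichotomy makes `σ` exact: each evaluation of `σ` is either an evaluation on `G/N`
or the zero functor. The one laborious axiom is the Mackey formula (`inflate_mackey`), which reduces
to counting how the double cosets `L \ H / K` lie over those of the images in `G/N`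
(`sum_relIndex_mul_relIndex`).

For the simple functors, splitting a sum over `G` along `G/N × N` shows that a trace `tr_1^G(φ)`
into an inflated module factors through `tr_1^N : W → tr_1^N(W)` (`relTrace_linHom_inflation`).
Linear maps on `tr_1^N(W)` extend to `W`, so both trace modules agree.

If `H` is a complement of `N`, then every `L ≤ H` meets `N` trivially, all scaling factors are `1`,
and `σ(M)(L) = M(LN/N)` is the original value at `L`. Hence `F = Iso ⋙ σ` is an exact functor with
`F ⋙ Res ≅ 𝟭` which sends `S_{1,V}` to `S_{1,Ṽ}`, and this gives `Res S_{1,Ṽ} ≅ S_{1,V}`. On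
extension groups `Res` undoes `F` up to the given isomorphism; this is proved by dimension shifting
(`mapExactFunctor_mapExactFunctor_comp`). The map induced by `F`, corrected by automorphisms of the
two objects, is then the required section for any choice of identifications. -/

/-! ### Effaceability of extension classes and the action of exact functors on them. -/

namespace DerivedCategory

universe w v u₁

variable {C : Type u₁} [Category.{v} C] [Abelian C]

/-- A quasi-isomorphism from a complex in degrees `≤ i` to an object in degree `i` becomes an
epimorphism of objects when restricted to the term of degree `i`. -/
theorem exists_epi_single_map_eq_comp {X : C} {i : ℤ} {K : CochainComplex C ℤ}
    [K.IsStrictlyLE i] (π : K ⟶ (HomologicalComplex.single C (ComplexShape.up ℤ) i).obj X)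
    [QuasiIsoAt π i] :
    ∃ (p : K.X i ⟶ X)
      (ι : (HomologicalComplex.single C (ComplexShape.up ℤ) i).obj (K.X i) ⟶ K), Epi p ∧
      (HomologicalComplex.single C (ComplexShape.up ℤ) i).map p = ι ≫ π := by
  have hK : IsZero (K.X (i + 1)) := K.isZero_of_isStrictlyLE i (i + 1) (by simp)
  let e := K.iCyclesIso i (i + 1) (by simp) (hK.eq_of_tgt _ _)
  -- Since `K` vanishes in degree `i + 1`, all of `K.X i` consists of cycles. Passing to homology is
  -- an epimorphism and the remaining factors are isomorphisms, which is why `α` is epi.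
  let α : K.X i ⟶ X := e.inv ≫ K.homologyπ i ≫ HomologicalComplex.homologyMap π i ≫
    (HomologicalComplex.singleObjHomologySelfIso _ _ _).hom
  have hα : π.f i = α ≫ (HomologicalComplex.singleObjXSelf (ComplexShape.up ℤ) i X).inv := by
    rw [← cancel_epi e.hom]
    dsimp [α, e]
    rw [Category.assoc, Category.assoc, Category.assoc,
      Iso.hom_inv_id_assoc, HomologicalComplex.iCyclesIso_hom,
      HomologicalComplex.homologyπ_naturality_assoc,
      HomologicalComplex.homologyπ_singleObjHomologySelfIso_hom_assoc,
      ← HomologicalComplex.singleObjCyclesSelfIso_inv_iCycles, Iso.hom_inv_id_assoc,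
      ← HomologicalComplex.cyclesMap_i]
  refine ⟨α, HomologicalComplex.mkHomFromSingle (𝟙 _) (by
      rintro j rfl
      exact hK.eq_of_tgt _ _), inferInstance, ?_⟩
  apply HomologicalComplex.from_single_hom_ext
  rw [HomologicalComplex.comp_f, HomologicalComplex.mkHomFromSingle_f, hα,
    HomologicalComplex.single_map_f_self]
  simp

variable [HasDerivedCategory.{w} C]

/-- A morphism in the derived category from an object in degree `i` to a complex in degrees `< i`
is killed by an epimorphism onto that object. -/
theorem exists_epi_singleFunctor_map_comp_eq_zero {X : C} {L : CochainComplex C ℤ} {i : ℤ}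
    (φ : Q.obj ((HomologicalComplex.single C (ComplexShape.up ℤ) i).obj X) ⟶ Q.obj L)
    (n : ℤ) (hn : n < i) [L.IsStrictlyLE n] :
    ∃ (X' : C) (p : X' ⟶ X), Epi p ∧
      Q.map ((HomologicalComplex.single C (ComplexShape.up ℤ) i).map p) ≫ φ = 0 := by
  have : CochainComplex.IsStrictlyLE
      ((HomologicalComplex.single C (ComplexShape.up ℤ) i).obj X) i :=
    inferInstanceAs (((CochainComplex.singleFunctor C i).obj X).IsStrictlyLE i)
  -- Calculus of fractions: `φ` is `π⁻¹` followed by an honest map of complexes `g`, and the roof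
  -- `K` may be taken in degrees `≤ i`.
  obtain ⟨K, _, π, h, g, rfl⟩ := right_fac_of_isStrictlyLE φ i
  have hq : QuasiIso π := by rwa [← isIso_Q_map_iff_quasiIso]
  obtain ⟨p, ι, hp, h₁⟩ := exists_epi_single_map_eq_comp π
  refine ⟨K.X i, p, hp, ?_⟩
  -- A map out of an object placed in degree `i` is determined by its component there, and `L` is
  -- zero in degree `i` because `n < i`.
  have h₂ : ι ≫ g = 0 := by
    apply HomologicalComplex.from_single_hom_ext
    apply (L.isZero_of_isStrictlyLE n i hn).eq_of_tgt
  rw [h₁, Q.map_comp, Category.assoc, IsIso.hom_inv_id_assoc, ← Q.map_comp, h₂, Q.map_zero]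

end DerivedCategory

namespace CategoryTheory.Abelian.Ext

universe w w' v v' u₁ u₂

variable {C : Type u₁} [Category.{v} C] [Abelian C] [HasExt.{w} C]

open _root_.DerivedCategory in
/-- An extension class of positive degree is killed by an epimorphism onto the source. -/
theorem exists_epi_comp_eq_zero {X Y : C} {n : ℕ} (e : Ext X Y (n + 1)) :
    ∃ (X' : C) (p : X' ⟶ X), Epi p ∧ (mk₀ p).comp e (zero_add _) = 0 := by
  let := HasDerivedCategory.standard C
  -- A class of degree `n + 1` is a morphism from `X` in degree `0` to `Y` in degree `-(n + 1)`,
  -- which is negative even when `n = 0`.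
  obtain ⟨X', p, hp, h⟩ := exists_epi_singleFunctor_map_comp_eq_zero (i := 0)
    (L := (CochainComplex.singleFunctor C (-(n + 1))).obj Y)
    (e.hom ≫ ((singleFunctors C).shiftIso (n + 1) (-(n + 1)) 0 (by lia)).hom.app Y)
    (-(n + 1)) (by lia)
  refine ⟨X', p, hp, ?_⟩
  ext
  rw [zero_hom, comp_hom, mk₀_hom, ShiftedHom.mk₀_comp,
    ← cancel_mono (((singleFunctors C).shiftIso (n + 1) (-(n + 1)) 0 (by lia)).hom.app Y),
    Limits.zero_comp, Category.assoc]
  exact h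

variable {D : Type u₂} [Category.{v'} D] [Abelian D] [HasExt.{w'} D]
  (F : C ⥤ D) [F.Additive] [PreservesFiniteLimits F] [PreservesFiniteColimits F]
  (G : D ⥤ C) [G.Additive] [PreservesFiniteLimits G] [PreservesFiniteColimits G]

/-- If `F ⋙ G ≅ 𝟭`, then `G` undoes the action of `F` on extension classes. -/
theorem mapExactFunctor_mapExactFunctor_comp (η : F ⋙ G ≅ 𝟭 C) {n : ℕ} {X Y : C} (e : Ext X Y n) :
    ((e.mapExactFunctor F).mapExactFunctor G).comp (mk₀ (η.hom.app Y)) (add_zero n) =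
      (mk₀ (η.hom.app X)).comp e (zero_add n) := by
  induction n generalizing X with
  | zero =>
    obtain ⟨f, rfl⟩ := (mk₀_bijective X Y).2 e
    rw [mapExactFunctor_mk₀, mapExactFunctor_mk₀, mk₀_comp_mk₀, mk₀_comp_mk₀]
    exact congrArg mk₀ (η.hom.naturality f)
  | succ n ih =>
    -- Dimension shifting: as `e` dies on `X'`, it is the class of `0 → ker p → X' → X → 0` composed
    -- with a class `e'` of degree `n` on `ker p`. The source therefore has to vary in the
    -- induction.
    obtain ⟨X', p, hp, h⟩ := exists_epi_comp_eq_zero e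
    let S := ShortComplex.mk (kernel.ι p) p (kernel.condition p)
    have hS : S.ShortExact := { exact := ShortComplex.exact_kernel p }
    obtain ⟨e', rfl⟩ := contravariant_sequence_exact₃ hS Y e h (add_comm 1 n)
    have h₁ : (hS.extClass.mapExactFunctor F).mapExactFunctor G =
        ((hS.map_of_exact F).map_of_exact G).extClass :=
      (congrArg _ (mapExactFunctor_extClass F hS)).trans
        (mapExactFunctor_extClass G (hS.map_of_exact F))
    -- The degree-one factor is handled by naturality of the extension class along the morphism of
    -- short exact sequences from the image of `S` under `F ⋙ G` to `S` given by `η`.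
    have h₂ : ((hS.extClass.mapExactFunctor F).mapExactFunctor G).comp
        (mk₀ (η.hom.app (kernel p))) (add_zero 1) =
          (mk₀ (η.hom.app X)).comp hS.extClass (zero_add 1) := by
      rw [h₁]
      exact ((hS.map_of_exact F).map_of_exact G).extClass_naturality hS (S.mapNatTrans η.hom)
    rw [mapExactFunctor_comp, mapExactFunctor_comp, comp_assoc_of_third_deg_zero, ih,
      ← comp_assoc_of_second_deg_zero]
    refine (congrArg (fun t => Ext.comp t e' (add_comm 1 n)) h₂).trans ?_
    exact comp_assoc _ _ _ _ _ (by lia)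

end CategoryTheory.Abelian.Ext

/-! ### Counting double cosets in `G` and in `G/N`. -/

theorem Nat.card_eq_card_mul_of_fibres {α β : Type*} [Finite α] [Finite β] (f : α → β) (c : ℕ)
    (h : ∀ b, Nat.card {a // f a = b} = c) : Nat.card α = Nat.card β * c := by
  let _ := Fintype.ofFinite β
  rw [← Nat.card_congr (Equiv.sigmaFiberEquiv f), Nat.card_sigma]
  simp [h]

namespace Subgroup

variable {G : Type u} [Group G]

theorem card_mul_relIndex_of_le {A B : Subgroup G} (h : A ≤ B) :
    Nat.card A * A.relIndex B = Nat.card B := by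
  rw [← relIndex_bot_left, relIndex_mul_relIndex _ _ _ bot_le h, relIndex_bot_left]

theorem card_map_mk_mul (N : Subgroup G) [N.Normal] (H : Subgroup G) :
    Nat.card (H.map (QuotientGroup.mk' N)) * Nat.card (H ⊓ N : Subgroup G) = Nat.card H := by
  rw [← relIndex_ker, QuotientGroup.ker_mk', ← inf_relIndex_left, mul_comm,
    card_mul_relIndex_of_le inf_le_left]

/-- Orbit-stabiliser for `L × K → LxK`, `(l, q) ↦ lxq`: the fibre over `l₀xq₀` is identified with
`xKx⁻¹ ∩ L` through `(l, q) ↦ l₀⁻¹l`. -/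
theorem card_doubleCoset_mul [Finite G] (L K : Subgroup G) (x : G) :
    Nat.card (DoubleCoset.doubleCoset x (L : Set G) K) *
      Nat.card (MulAut.conj x • K ⊓ L : Subgroup G) = Nat.card L * Nat.card K := by
  rw [← Nat.card_prod L K]
  let f : L × K → DoubleCoset.doubleCoset x (L : Set G) K := fun p =>
    ⟨p.1 * x * p.2, DoubleCoset.mem_doubleCoset.2 ⟨_, p.1.2, _, p.2.2, rfl⟩⟩
  refine (Nat.card_eq_card_mul_of_fibres f _ ?_).symm
  rintro ⟨b, hb⟩
  obtain ⟨l₀, hl₀, q₀, hq₀, rfl⟩ := DoubleCoset.mem_doubleCoset.1 hb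
  refine Nat.card_congr
    { toFun := fun p => ⟨l₀⁻¹ * p.1.1, ?_, L.mul_mem (L.inv_mem hl₀) p.1.1.2⟩
      invFun := fun z => ⟨(⟨l₀ * z, mul_mem hl₀ z.2.2⟩, ⟨x⁻¹ * (z : G)⁻¹ * x * q₀, ?_⟩), ?_⟩
      left_inv := ?_
      right_inv := fun z => by simp }
  · obtain ⟨⟨l, q⟩, h⟩ := p
    have h : (l : G) * x * q = l₀ * x * q₀ := congrArg Subtype.val h
    refine (mem_smul_pointwise_iff_exists _ _ _).2
      ⟨q₀ * (q : G)⁻¹, mul_mem hq₀ (inv_mem q.2), ?_⟩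
    rw [MulAut.smul_def, MulAut.conj_apply, eq_inv_mul_iff_mul_eq]
    have : (l : G) = l₀ * x * q₀ * (q : G)⁻¹ * x⁻¹ := by rw [← h]; group
    rw [this]; group
  · obtain ⟨k, hk, e⟩ := (mem_smul_pointwise_iff_exists _ _ _).1 z.2.1
    rw [MulAut.smul_def, MulAut.conj_apply] at e
    rw [← e]
    have : x⁻¹ * (x * k * x⁻¹)⁻¹ * x * q₀ = k⁻¹ * q₀ := by group
    rw [this]
    exact mul_mem (inv_mem hk) hq₀
  · refine Subtype.ext ?_
    change l₀ * (z : G) * x * (x⁻¹ * (z : G)⁻¹ * x * q₀) = l₀ * x * q₀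
    group
  · rintro ⟨⟨l, q⟩, h⟩
    have h : (l : G) * x * q = l₀ * x * q₀ := congrArg Subtype.val h
    refine Subtype.ext (Prod.ext (Subtype.ext ?_) (Subtype.ext ?_))
    · simp
    · change x⁻¹ * (l₀⁻¹ * (l : G))⁻¹ * x * q₀ = q
      have : (q : G) = x⁻¹ * (l : G)⁻¹ * (l₀ * x * q₀) := by rw [← h]; group
      rw [this]; group

/-- The Mackey formula for `G/N` needs a system of representatives of its own, since the images of
those chosen in `G` may repeat double cosets. The representatives taken are the elements of `H`
fixed by the normal form `r`. -/
theorem exists_isDoubleCosetReps [Finite G] {L H K : Subgroup G} (hL : L ≤ H) (hK : K ≤ H) :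
    ∃ S : Finset G, IsDoubleCosetReps L H K S := by
  classical
  let _ := Fintype.ofFinite G
  let r : G → G := fun h => (DoubleCoset.mk L K h).out
  have hr : ∀ h, ∃ l ∈ L, ∃ q ∈ K, h = l * r h * q := fun h =>
    (DoubleCoset.eq L K _ _).1 (DoubleCoset.out_eq' L K (DoubleCoset.mk L K h))
  refine ⟨Finset.univ.filter fun s => s ∈ H ∧ r s = s, by simp +contextual, fun h hh => ?_⟩
  have hrr : r (r h) = r h :=
    congrArg Quotient.out (DoubleCoset.out_eq' L K (DoubleCoset.mk L K h))
  refine ⟨r h, ⟨?_, hr h⟩, ?_⟩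
  · obtain ⟨l, hl, q, hq, e⟩ := hr h
    have : r h = l⁻¹ * h * q⁻¹ := by rw [eq_mul_inv_iff_mul_eq, eq_inv_mul_iff_mul_eq,
      ← mul_assoc, ← e]
    simp only [Finset.mem_filter, Finset.mem_univ, true_and]
    refine ⟨?_, hrr⟩
    rw [this]
    exact mul_mem (mul_mem (inv_mem (hL hl)) hh) (inv_mem (hK hq))
  · rintro s ⟨hs, hs'⟩
    simp only [Finset.mem_filter, Finset.mem_univ, true_and] at hs
    rw [← hs.2]
    exact congrArg Quotient.out ((DoubleCoset.eq L K _ _).2 hs')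

section Quotient

variable (N : Subgroup G) [N.Normal]

/-- The order of the preimage in `H` of a double coset of images of subgroups of `H`. -/
theorem card_preimage_doubleCoset [Finite G] {K L H : Subgroup G} (hK : K ≤ H) (hL : L ≤ H)
    (y : G ⧸ N) (hy : y ∈ H.map (QuotientGroup.mk' N)) :
    Nat.card {h : G // h ∈ H ∧ (h : G ⧸ N) ∈ DoubleCoset.doubleCoset y
      (L.map (QuotientGroup.mk' N) : Set (G ⧸ N)) (K.map (QuotientGroup.mk' N))} =
    Nat.card (DoubleCoset.doubleCoset y
      (L.map (QuotientGroup.mk' N) : Set (G ⧸ N)) (K.map (QuotientGroup.mk' N))) *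
        Nat.card (H ⊓ N : Subgroup G) := by
  refine Nat.card_eq_card_mul_of_fibres (fun h => ⟨(h.1 : G ⧸ N), h.2.2⟩) _ ?_
  rintro ⟨d, hd⟩
  -- The whole double coset lies in the image of `H`, so every `d` has a preimage `h₀` in `H`; the
  -- fibre over `d` is then `h₀(H ∩ N)`.
  have hdH : d ∈ H.map (QuotientGroup.mk' N) := by
    obtain ⟨l, hl, q, hq, rfl⟩ := DoubleCoset.mem_doubleCoset.1 hd
    exact mul_mem (mul_mem (map_mono hL hl) hy) (map_mono hK hq)
  obtain ⟨h₀, hh₀, rfl⟩ := hdH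
  refine Nat.card_congr
    { toFun := fun p => ⟨h₀⁻¹ * p.1.1, H.mul_mem (H.inv_mem hh₀) p.1.2.1, ?_⟩
      invFun := fun z => ⟨⟨h₀ * z, mul_mem hh₀ z.2.1, ?_⟩, ?_⟩
      left_inv := fun p => Subtype.ext (Subtype.ext (mul_inv_cancel_left h₀ p.1.1))
      right_inv := fun z => Subtype.ext (inv_mul_cancel_left h₀ z) }
  · have h := congrArg Subtype.val p.2
    exact QuotientGroup.eq.1 h.symm
  · have : ((h₀ * (z : G) : G) : G ⧸ N) = (h₀ : G ⧸ N) := by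
      rw [eq_comm, QuotientGroup.eq, inv_mul_cancel_left]; exact z.2.2
    rw [this]
    exact hd
  · refine Subtype.ext ?_
    change ((h₀ * (z : G) : G) : G ⧸ N) = (h₀ : G ⧸ N)
    rw [eq_comm, QuotientGroup.eq, inv_mul_cancel_left]; exact z.2.2

-- The double cosets `LxK` with `x ∈ S` partition `H`, and each of them maps into a single double
-- coset of `G/N`. Those lying over a given one therefore partition its preimage in `H`.
open Classical in
theorem sum_card_doubleCoset [Finite G] {K L H : Subgroup G} (hK : K ≤ H) (hL : L ≤ H)
    {S : Finset G} (hS : IsDoubleCosetReps L H K S) (y : G ⧸ N) :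
    ∑ x ∈ S.filter (fun x : G => (x : G ⧸ N) ∈ DoubleCoset.doubleCoset y
      (L.map (QuotientGroup.mk' N) : Set (G ⧸ N)) (K.map (QuotientGroup.mk' N))),
        Nat.card (DoubleCoset.doubleCoset x (L : Set G) K) =
    Nat.card {h : G // h ∈ H ∧ (h : G ⧸ N) ∈ DoubleCoset.doubleCoset y
      (L.map (QuotientGroup.mk' N) : Set (G ⧸ N)) (K.map (QuotientGroup.mk' N))} := by
  rw [← Finset.sum_coe_sort, ← Nat.card_sigma]
  have key : ∀ x h : G, h ∈ DoubleCoset.doubleCoset x (L : Set G) K →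
      (h : G ⧸ N) ∈ DoubleCoset.doubleCoset (x : G ⧸ N)
        (L.map (QuotientGroup.mk' N) : Set (G ⧸ N)) (K.map (QuotientGroup.mk' N)) := by
    intro x h hh
    obtain ⟨l, hl, q, hq, rfl⟩ := DoubleCoset.mem_doubleCoset.1 hh
    exact DoubleCoset.mem_doubleCoset.2 ⟨_, mem_map_of_mem _ hl, _, mem_map_of_mem _ hq, rfl⟩
  refine Nat.card_congr (Equiv.ofBijective (fun p => ⟨p.2.1, ?_, ?_⟩) ⟨?_, ?_⟩)
  · obtain ⟨⟨x, hx⟩, ⟨h, hh⟩⟩ := p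
    obtain ⟨l, hl, q, hq, rfl⟩ := DoubleCoset.mem_doubleCoset.1 hh
    exact mul_mem (mul_mem (hL hl) (hS.1 x (Finset.mem_filter.1 hx).1)) (hK hq)
  · obtain ⟨⟨x, hx⟩, ⟨h, hh⟩⟩ := p
    exact (DoubleCoset.doubleCoset_eq_of_mem (Finset.mem_filter.1 hx).2).subset (key x h hh)
  · rintro ⟨⟨x, hx⟩, ⟨h, hh⟩⟩ ⟨⟨x', hx'⟩, ⟨h', hh'⟩⟩ e
    obtain rfl : h = h' := congrArg Subtype.val e
    obtain ⟨l, hl, q, hq, rfl⟩ := DoubleCoset.mem_doubleCoset.1 hh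
    have hx := (Finset.mem_filter.1 hx).1
    have hx' := (Finset.mem_filter.1 hx').1
    obtain rfl : x = x' := (hS.2 (l * x * q) (mul_mem (mul_mem (hL hl) (hS.1 x hx)) (hK hq))).unique
      ⟨hx, l, hl, q, hq, rfl⟩ ⟨hx', DoubleCoset.mem_doubleCoset.1 hh'⟩
    rfl
  · rintro ⟨h, hh, hd⟩
    obtain ⟨x, ⟨hx, e⟩, -⟩ := hS.2 h hh
    have e := DoubleCoset.mem_doubleCoset.2 e
    refine ⟨⟨⟨x, Finset.mem_filter.2 ⟨hx, ?_⟩⟩, ⟨h, e⟩⟩, rfl⟩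
    rw [← DoubleCoset.doubleCoset_eq_of_mem hd, DoubleCoset.doubleCoset_eq_of_mem (key x h e)]
    exact DoubleCoset.mem_doubleCoset_self _ _ _

open Classical in
/-- Comparison of the double cosets `L \ H / K` with those of the images in `G/N`. -/
theorem sum_relIndex_mul_relIndex [Finite G] {K L H : Subgroup G} (hK : K ≤ H) (hL : L ≤ H)
    {S : Finset G} (hS : IsDoubleCosetReps L H K S) (y : G ⧸ N)
    (hy : y ∈ H.map (QuotientGroup.mk' N)) :
    ∑ x ∈ S.filter (fun x : G => (x : G ⧸ N) ∈ DoubleCoset.doubleCoset y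
      (L.map (QuotientGroup.mk' N) : Set (G ⧸ N)) (K.map (QuotientGroup.mk' N))),
        ((MulAut.conj x • K ⊓ L) ⊓ N).relIndex (L ⊓ N) *
          ((MulAut.conj x • K ⊓ L).map (QuotientGroup.mk' N)).relIndex
            (MulAut.conj (x : G ⧸ N) • K.map (QuotientGroup.mk' N) ⊓
              L.map (QuotientGroup.mk' N)) =
    (K ⊓ N).relIndex (H ⊓ N) := by
  set D := DoubleCoset.doubleCoset y
      (L.map (QuotientGroup.mk' N) : Set (G ⧸ N)) (K.map (QuotientGroup.mk' N)) with hD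
  have hD0 : 0 < Nat.card D :=
    have : Nonempty D := ⟨y, DoubleCoset.mem_doubleCoset_self _ _ _⟩
    Nat.card_pos
  have hle : ∀ x : G, (MulAut.conj x • K ⊓ L).map (QuotientGroup.mk' N) ≤
      MulAut.conj (x : G ⧸ N) • K.map (QuotientGroup.mk' N) ⊓ L.map (QuotientGroup.mk' N) :=
    fun x => by
      refine (map_inf_le _ _ _).trans (inf_le_inf_right _ ?_)
      exact (CohMackey.conj_smul_map (QuotientGroup.mk' N) x K).ge
  -- Written in terms of orders of subgroups, each summand times `|K ∩ N| · |D|` is the size of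
  -- `LxK`. The orders of the images are eliminated with `|HN/N| · |H ∩ N| = |H|`, applied to `xKx⁻¹
  -- ∩ L`, `L` and `K`.
  have hterm : ∀ x ∈ S.filter (fun x : G => (x : G ⧸ N) ∈ D),
      ((MulAut.conj x • K ⊓ L) ⊓ N).relIndex (L ⊓ N) *
          ((MulAut.conj x • K ⊓ L).map (QuotientGroup.mk' N)).relIndex
            (MulAut.conj (x : G ⧸ N) • K.map (QuotientGroup.mk' N) ⊓
              L.map (QuotientGroup.mk' N)) * (Nat.card (K ⊓ N : Subgroup G) * Nat.card D) =
        Nat.card (DoubleCoset.doubleCoset x (L : Set G) K) := by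
    intro x hx
    have h1 := card_mul_relIndex_of_le
      (inf_le_inf_right N (inf_le_right : MulAut.conj x • K ⊓ L ≤ L))
    have h2 := card_mul_relIndex_of_le (hle x)
    have h3 := card_map_mk_mul N (MulAut.conj x • K ⊓ L)
    have h4 := card_doubleCoset_mul L K x
    have h5 := card_doubleCoset_mul (L.map (QuotientGroup.mk' N)) (K.map (QuotientGroup.mk' N))
      (x : G ⧸ N)
    rw [DoubleCoset.doubleCoset_eq_of_mem (Finset.mem_filter.1 hx).2, ← hD] at h5
    have h6 := card_map_mk_mul N L
    have h7 := card_map_mk_mul N K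
    have h8 : 0 < Nat.card (MulAut.conj x • K ⊓ L : Subgroup G) := Nat.card_pos
    refine Nat.eq_of_mul_eq_mul_right h8 ?_
    rw [h4, ← h3, ← h6, ← h7]
    generalize Nat.card (DoubleCoset.doubleCoset x (L : Set G) K) = c at *
    calc _ = (Nat.card (MulAut.conj x • K ⊓ L ⊓ N : Subgroup G) *
            (MulAut.conj x • K ⊓ L ⊓ N).relIndex (L ⊓ N)) *
          (Nat.card ((MulAut.conj x • K ⊓ L).map (QuotientGroup.mk' N)) *
            ((MulAut.conj x • K ⊓ L).map (QuotientGroup.mk' N)).relIndex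
            (MulAut.conj (x : G ⧸ N) • K.map (QuotientGroup.mk' N) ⊓
              L.map (QuotientGroup.mk' N))) * (Nat.card (K ⊓ N : Subgroup G) * Nat.card D) := by
          ring
      _ = Nat.card (L ⊓ N : Subgroup G) * (Nat.card D *
          Nat.card (MulAut.conj (x : G ⧸ N) • K.map (QuotientGroup.mk' N) ⊓
              L.map (QuotientGroup.mk' N) : Subgroup (G ⧸ N))) *
                Nat.card (K ⊓ N : Subgroup G) := by rw [h1, h2]; ring
      _ = _ := by rw [h5]; ring
  -- The sizes add up to the preimage of `D` in `H`, which has `|D| · |H ∩ N|` elements; dividing by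
  -- `|K ∩ N| · |D|` leaves `|H ∩ N : K ∩ N|`.
  have hsum := Finset.sum_congr rfl hterm
  rw [← Finset.sum_mul, sum_card_doubleCoset N hK hL hS y,
    card_preimage_doubleCoset N hK hL y hy, ← hD] at hsum
  have h9 := card_mul_relIndex_of_le (inf_le_inf_right N hK)
  have h10 : 0 < Nat.card (K ⊓ N : Subgroup G) := Nat.card_pos
  refine Nat.eq_of_mul_eq_mul_right (mul_pos h10 hD0) (hsum.trans ?_)
  rw [← h9]; ring

end Quotient

end Subgroup

/-! ### Inflation of Mackey functors with rescaled transfers. -/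

namespace CohMackey

section Normal

variable {G : Type u} [Group G] (N : Subgroup G)

theorem relIndex_inf_trans {L K H : Subgroup G} (h : L ≤ K) (h' : K ≤ H) :
    (L ⊓ N).relIndex (K ⊓ N) * (K ⊓ N).relIndex (H ⊓ N) = (L ⊓ N).relIndex (H ⊓ N) :=
  Subgroup.relIndex_mul_relIndex _ _ _ (inf_le_inf_right N h) (inf_le_inf_right N h')

variable [N.Normal]

theorem relIndex_conj_inf (g : G) {K H K' H' : Subgroup G} (hK : MulAut.conj g • K = K')
    (hH : MulAut.conj g • H = H') : (K' ⊓ N).relIndex (H' ⊓ N) = (K ⊓ N).relIndex (H ⊓ N) := by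
  have hN : MulAut.conj g • N = N := Subgroup.Normal.conjAct ‹N.Normal› (ConjAct.toConjAct g)
  rw [← hK, ← hH]
  conv_lhs => rw [← hN, ← Subgroup.smul_inf, ← Subgroup.smul_inf]
  exact Subgroup.relIndex_pointwise_smul _ _ _

theorem conj_mk_smul_map (g : G) {H L : Subgroup G} (h : MulAut.conj g • H = L) :
    MulAut.conj (g : G ⧸ N) • H.map (QuotientGroup.mk' N) = L.map (QuotientGroup.mk' N) :=
  (conj_smul_map (QuotientGroup.mk' N) g H).trans (congrArg (Subgroup.map (QuotientGroup.mk' N)) h)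

end Normal

section MackeyTerm

variable {k G : Type u} [CommRing k] [Group G] (M : CohMackey k G)

/-- The term of the Mackey formula at `x`. -/
abbrev mackeyTerm (K L : Subgroup G) (x : G) : M.obj K ⟶ M.obj L :=
  M.res (inf_le_left : K ⊓ MulAut.conj x⁻¹ • L ≤ K) ≫
    M.conj x (Subgroup.conj_smul_inf_conj_inv x K L) ≫
      M.tr (inf_le_right : MulAut.conj x • K ⊓ L ≤ L)

/-- Conjugation by `yq` is conjugation by `q` followed by conjugation by `y`. The first can be moved
before the restriction, where it acts on `M(K)` with `q ∈ K`, hence trivially. On the left the same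
argument uses the transfer into `L`. -/
theorem mackeyTerm_mul_right (K L : Subgroup G) (y q : G) (hq : q ∈ K) :
    M.mackeyTerm K L (y * q) = M.mackeyTerm K L y := by
  have hK : MulAut.conj q • K = K := Subgroup.conj_smul_eq_self_of_mem hq
  have hA : MulAut.conj q • (K ⊓ MulAut.conj (y * q)⁻¹ • L) = K ⊓ MulAut.conj y⁻¹ • L := by
    rw [Subgroup.smul_inf, hK, smul_smul, ← map_mul]
    simp
  have hB : MulAut.conj (y * q) • (K ⊓ MulAut.conj (y * q)⁻¹ • L) = MulAut.conj y • K ⊓ L := by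
    rw [Subgroup.conj_smul_inf_conj_inv, map_mul, mul_smul, hK]
  have h := Subgroup.conj_smul_inf_conj_inv y K L
  refine (mackey_term M (y * q) rfl (by rw [← hB, Subgroup.conj_smul_inf_conj_inv])
    _ _ _ inf_le_left hB inf_le_right).trans ?_
  rw [← M.conj_conj q y hA h hB, Category.assoc, ← Category.assoc (M.res _),
    M.res_conj q inf_le_left inf_le_left hA hK, M.conj_self q hK hq, Category.id_comp]

theorem mackeyTerm_mul_left (K L : Subgroup G) (y l : G) (hl : l ∈ L) :
    M.mackeyTerm K L (l * y) = M.mackeyTerm K L y := by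
  have hL : MulAut.conj l • L = L := Subgroup.conj_smul_eq_self_of_mem hl
  have hA : K ⊓ MulAut.conj (l * y)⁻¹ • L = K ⊓ MulAut.conj y⁻¹ • L := by
    have hL' : MulAut.conj l⁻¹ • L = L := Subgroup.conj_smul_eq_self_of_mem (inv_mem hl)
    rw [mul_inv_rev, map_mul, mul_smul, hL']
  have h := Subgroup.conj_smul_inf_conj_inv y K L
  have hB : MulAut.conj l • (MulAut.conj y • K ⊓ L) = MulAut.conj (l * y) • K ⊓ L := by
    rw [Subgroup.smul_inf, hL, smul_smul, ← map_mul]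
  have hC : MulAut.conj (l * y) • (K ⊓ MulAut.conj y⁻¹ • L) = MulAut.conj (l * y) • K ⊓ L := by
    rw [← hB, ← h, smul_smul, ← map_mul]
  refine (mackey_term M (l * y) hA rfl _ _ _ inf_le_left hC inf_le_right).trans ?_
  rw [← M.conj_conj y l h hB hC, Category.assoc,
    ← M.tr_conj l inf_le_right inf_le_right hB hL, M.conj_self l hL hl, Category.comp_id]

theorem mackeyTerm_eq_of_mem_doubleCoset (K L : Subgroup G) {x y : G}
    (h : x ∈ DoubleCoset.doubleCoset y (L : Set G) K) :
    M.mackeyTerm K L x = M.mackeyTerm K L y := by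
  obtain ⟨l, hl, q, hq, rfl⟩ := DoubleCoset.mem_doubleCoset.1 h
  rw [mackeyTerm_mul_right _ _ _ _ _ hq, mackeyTerm_mul_left _ _ _ _ _ hl]

/-- Restricting and transferring through subgroups smaller than those of the Mackey term costs an
index, by the cohomological condition. This is needed because the image in `G/N` of an intersection
can be smaller than the intersection of the images. -/
theorem res_conj_tr_eq_relIndex_smul_mackeyTerm (K L : Subgroup G) (x : G) {A B : Subgroup G}
    (hA : A ≤ K) (hB : B ≤ L) (h : MulAut.conj x • A = B) :
    M.res hA ≫ M.conj x h ≫ M.tr hB =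
      (B.relIndex (MulAut.conj x • K ⊓ L) : k) • M.mackeyTerm K L x := by
  have hB' : B ≤ MulAut.conj x • K ⊓ L :=
    le_inf (h ▸ Subgroup.pointwise_smul_le_pointwise_smul_iff.2 hA) hB
  have hA' : A ≤ K ⊓ MulAut.conj x⁻¹ • L := by
    rw [← Subgroup.pointwise_smul_le_pointwise_smul_iff (a := MulAut.conj x), h,
      Subgroup.conj_smul_inf_conj_inv]
    exact hB'
  rw [← M.res_res hA' inf_le_left, ← M.tr_tr hB' inf_le_right, Category.assoc,
    reassoc_of% M.res_conj x hA' hB' h (Subgroup.conj_smul_inf_conj_inv x K L),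
    reassoc_of% M.res_tr hB']
  simp

end MackeyTerm

section Inflate

variable {k G : Type u} [CommRing k] [Group G] [Finite G] (N : Subgroup G) [N.Normal]

theorem relIndex_mul_relIndex_map {K H : Subgroup G} (h : K ≤ H) :
    (K ⊓ N).relIndex (H ⊓ N) *
      (K.map (QuotientGroup.mk' N)).relIndex (H.map (QuotientGroup.mk' N)) = K.relIndex H := by
  have h1 := Subgroup.card_mul_relIndex_of_le (inf_le_inf_right N h)
  have h2 := Subgroup.card_mul_relIndex_of_le (Subgroup.map_mono (f := QuotientGroup.mk' N) h)
  have h3 := Subgroup.card_mul_relIndex_of_le h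
  have h4 := Subgroup.card_map_mk_mul N K
  have h5 := Subgroup.card_map_mk_mul N H
  have h6 : 0 < Nat.card K := Nat.card_pos
  refine Nat.eq_of_mul_eq_mul_left h6 ?_
  rw [h3, ← h5, ← h1, ← h2, ← h4]
  ring

-- The term at `x ∈ S` is a multiple of the Mackey term in `G/N` of the double coset containing the
-- image of `x`. Collecting the terms over each `y ∈ T`, the multiplicities sum to `|H ∩ N : K ∩
-- N|`, the factor put on the transfer.
open Classical in
theorem inflate_mackey (M : CohMackey k (G ⧸ N)) {K L H : Subgroup G} (hK : K ≤ H) (hL : L ≤ H)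
    {S : Finset G} (hS : Subgroup.IsDoubleCosetReps L H K S) :
    (((K ⊓ N).relIndex (H ⊓ N) : k) • M.tr (Subgroup.map_mono (f := QuotientGroup.mk' N) hK)) ≫
      M.res (Subgroup.map_mono (f := QuotientGroup.mk' N) hL) = ∑ x ∈ S,
      M.res (Subgroup.map_mono (f := QuotientGroup.mk' N)
          (inf_le_left : K ⊓ MulAut.conj x⁻¹ • L ≤ K)) ≫
        M.conj (x : G ⧸ N) (conj_mk_smul_map N x (Subgroup.conj_smul_inf_conj_inv x K L)) ≫
          (((MulAut.conj x • K ⊓ L ⊓ N).relIndex (L ⊓ N) : k) •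
            M.tr (Subgroup.map_mono (f := QuotientGroup.mk' N)
              (inf_le_right : MulAut.conj x • K ⊓ L ≤ L))) := by
  obtain ⟨T, hT⟩ := Subgroup.exists_isDoubleCosetReps
    (Subgroup.map_mono (f := QuotientGroup.mk' N) hL)
    (Subgroup.map_mono (f := QuotientGroup.mk' N) hK)
  rw [Linear.smul_comp, M.mackey _ _ T hT, Finset.smul_sum]
  have hterm : ∀ x ∈ S, M.res (Subgroup.map_mono (f := QuotientGroup.mk' N)
          (inf_le_left : K ⊓ MulAut.conj x⁻¹ • L ≤ K)) ≫
        M.conj (x : G ⧸ N) (conj_mk_smul_map N x (Subgroup.conj_smul_inf_conj_inv x K L)) ≫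
          (((MulAut.conj x • K ⊓ L ⊓ N).relIndex (L ⊓ N) : k) •
            M.tr (Subgroup.map_mono (f := QuotientGroup.mk' N)
              (inf_le_right : MulAut.conj x • K ⊓ L ≤ L))) =
      ∑ y ∈ T.filter (fun y => (x : G ⧸ N) ∈ DoubleCoset.doubleCoset y
        (L.map (QuotientGroup.mk' N) : Set (G ⧸ N)) (K.map (QuotientGroup.mk' N))),
        (((MulAut.conj x • K ⊓ L ⊓ N).relIndex (L ⊓ N) *
          ((MulAut.conj x • K ⊓ L).map (QuotientGroup.mk' N)).relIndex
            (MulAut.conj (x : G ⧸ N) • K.map (QuotientGroup.mk' N) ⊓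
              L.map (QuotientGroup.mk' N)) : ℕ) : k) •
          M.mackeyTerm (K.map (QuotientGroup.mk' N)) (L.map (QuotientGroup.mk' N)) y := by
    intro x hx
    obtain ⟨y, ⟨hy, e⟩, hu⟩ := hT.2 (x : G ⧸ N) (Subgroup.mem_map_of_mem _ (hS.1 x hx))
    have hfil : T.filter (fun y => (x : G ⧸ N) ∈ DoubleCoset.doubleCoset y
        (L.map (QuotientGroup.mk' N) : Set (G ⧸ N)) (K.map (QuotientGroup.mk' N))) = {y} := by
      ext z
      rw [Finset.mem_filter, Finset.mem_singleton, DoubleCoset.mem_doubleCoset]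
      exact ⟨fun hz => hu z hz, fun hz => hz ▸ ⟨hy, e⟩⟩
    rw [hfil, Finset.sum_singleton, Linear.comp_smul, Linear.comp_smul,
      res_conj_tr_eq_relIndex_smul_mackeyTerm, smul_smul, Nat.cast_mul,
      M.mackeyTerm_eq_of_mem_doubleCoset _ _ (DoubleCoset.mem_doubleCoset.2 e)]
  rw [Finset.sum_congr rfl hterm]
  -- Exchange the sums, so that for each `y` the inner sum runs over the `x ∈ S` whose image lies in
  -- the double coset of `y`.
  rw [Finset.sum_comm' (t' := T) (s' := fun y => S.filter (fun x : G => (x : G ⧸ N) ∈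
    DoubleCoset.doubleCoset y (L.map (QuotientGroup.mk' N) : Set (G ⧸ N))
      (K.map (QuotientGroup.mk' N)))) (fun x y => by
      rw [Finset.mem_filter, Finset.mem_filter]; tauto)]
  refine Finset.sum_congr rfl fun y hy => ?_
  rw [← Finset.sum_smul, ← Nat.cast_sum,
    Subgroup.sum_relIndex_mul_relIndex N hK hL hS y (hT.1 y hy)]

/-- The cohomological Mackey functor `H ↦ M(HN/N)` for `G` given by a cohomological Mackey
functor `M` for `G/N`, with the transfers from `K` to `H` multiplied by `|H ∩ N : K ∩ N|`. -/
noncomputable def inflate (M : CohMackey k (G ⧸ N)) : CohMackey k G :=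
    { obj := fun H => M.obj (H.map (QuotientGroup.mk' N))
      res := fun h => M.res (Subgroup.map_mono h)
      -- Without the factor, restriction followed by transfer would only give `|HN/N : KN/N|`; the
      -- missing part of `|H : K|` is exactly `|H ∩ N : K ∩ N|`.
      tr := fun {K H} h => ((K ⊓ N).relIndex (H ⊓ N) : k) • M.tr (Subgroup.map_mono h)
      conj := fun g _ _ h => M.conj (g : G ⧸ N) (conj_mk_smul_map N g h)
      res_self := fun _ => M.res_self _
      tr_self := fun H => by rw [M.tr_self, Subgroup.relIndex_self, Nat.cast_one, one_smul]
      conj_self := fun g _ _ hg => M.conj_self _ _ (Subgroup.mem_map_of_mem _ hg)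
      res_res := fun _ _ => M.res_res _ _
      tr_tr := fun h h' => by
        rw [Linear.smul_comp, Linear.comp_smul, M.tr_tr, smul_smul, ← Nat.cast_mul,
          relIndex_inf_trans N h h']
      conj_conj := fun g g' _ _ _ h h' h'' => M.conj_conj _ _ _ _ _
      res_conj := fun g _ _ _ _ _ _ _ _ => M.res_conj _ _ _ _ _
      tr_conj := fun g _ _ _ _ h h' hK hH => by
        rw [Linear.smul_comp, Linear.comp_smul, relIndex_conj_inf N g hK hH, M.tr_conj]
      mackey := fun hK hL _ hS => inflate_mackey N M hK hL hS
      res_tr := fun h => by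
        rw [Linear.comp_smul, M.res_tr, smul_smul, ← Nat.cast_mul,
          relIndex_mul_relIndex_map N h] }

theorem inflate_tr (M : CohMackey k (G ⧸ N)) {K H : Subgroup G} (h : K ≤ H) :
    (inflate N M).tr h = ((K ⊓ N).relIndex (H ⊓ N) : k) • M.tr (Subgroup.map_mono h) := rfl

/-- The morphism of inflated functors induced by a morphism of Mackey functors. -/
noncomputable def inflateMap {M M' : CohMackey k (G ⧸ N)} (f : M ⟶ M') : inflate N M ⟶ inflate N M' where
  app H := f.app (H.map (QuotientGroup.mk' N))
  res _ := f.res _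
  tr h := by
    rw [inflate_tr, inflate_tr]
    exact (Linear.smul_comp _ _ _ _ _ _).trans ((congrArg _ (f.tr _)).trans
      (Linear.comp_smul _ _ _ _ _ _).symm)
  conj _ _ _ _ := f.conj _ _

end Inflate

section Sub

variable {k G : Type u} [CommRing k] [Group G]

/-- The subfunctor of a cohomological Mackey functor given by submodules stable under restrictions,
transfers and conjugations. -/
def sub (M : CohMackey k G) (P : ∀ H, Submodule k (M.obj H))
    (hres : ∀ {K H : Subgroup G} (h : K ≤ H), P H ≤ (P K).comap (M.res h).hom)
    (htr : ∀ {K H : Subgroup G} (h : K ≤ H), P K ≤ (P H).comap (M.tr h).hom)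
    (hconj : ∀ (g : G) {H L : Subgroup G} (h : MulAut.conj g • H = L),
      P H ≤ (P L).comap (M.conj g h).hom) : CohMackey k G where
  obj H := ModuleCat.of k (P H)
  res h := ModuleCat.ofHom ((M.res h).hom.restrict (hres h))
  tr h := ModuleCat.ofHom ((M.tr h).hom.restrict (htr h))
  conj g _ _ h := ModuleCat.ofHom ((M.conj g h).hom.restrict (hconj g h))
  res_self H := by
    ext x
    exact congrArg (fun f => f.hom x.1) (M.res_self H)
  tr_self H := by
    ext x
    exact congrArg (fun f => f.hom x.1) (M.tr_self H)
  conj_self g _ h hg := by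
    ext x
    exact congrArg (fun f => f.hom x.1) (M.conj_self g h hg)
  res_res h h' := by
    ext x
    exact congrArg (fun f => f.hom x.1) (M.res_res h h')
  tr_tr h h' := by
    ext x
    exact congrArg (fun f => f.hom x.1) (M.tr_tr h h')
  conj_conj g g' _ _ _ h h' h'' := by
    ext x
    exact congrArg (fun f => f.hom x.1) (M.conj_conj g g' h h' h'')
  res_conj g _ _ _ _ h h' hK hH := by
    ext x
    exact congrArg (fun f => f.hom x.1) (M.res_conj g h h' hK hH)
  tr_conj g _ _ _ _ h h' hK hH := by
    ext x
    exact congrArg (fun f => f.hom x.1) (M.tr_conj g h h' hK hH)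
  mackey hK hL S hS := by
    ext x
    refine (congrArg (fun f => f.hom x.1) (M.mackey hK hL S hS)).trans ?_
    simp only [ModuleCat.hom_sum, LinearMap.sum_apply, Submodule.coe_sum]
    rfl
  res_tr h := by
    ext x
    exact congrArg (fun f => f.hom x.1) (M.res_tr h)

end Sub

end CohMackey

/-! ### The functor `σ` and its exactness. -/

namespace CohMackey

section TraceInflation

variable {k G : Type u} [CommRing k] [Group G] [Finite G] (N : Subgroup G) [N.Normal]

/-- The submodule `|H ∩ N| M(HN/N)` of `M(HN/N)`. -/
noncomputable def cardMulSubmodule (M : CohMackey k (G ⧸ N)) (H : Subgroup G) :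
    Submodule k ((inflate N M).obj H) :=
  LinearMap.range (LinearMap.lsmul k ((inflate N M).obj H)
    (Nat.card (H ⊓ N : Subgroup G) : k))

variable {N} in
theorem mem_cardMulSubmodule {M : CohMackey k (G ⧸ N)} {H : Subgroup G}
    {v : (inflate N M).obj H} :
    v ∈ cardMulSubmodule N M H ↔ ∃ w, (Nat.card (H ⊓ N : Subgroup G) : k) • w = v := Iff.rfl

/-- The cohomological Mackey functor `H ↦ |H ∩ N| M(HN/N)` for `G`. -/
noncomputable def traceInflationObj (M : CohMackey k (G ⧸ N)) : CohMackey k G :=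
  sub (inflate N M) (cardMulSubmodule N M)
    (fun {K H} h => by
      rintro _ ⟨w, rfl⟩
      refine mem_cardMulSubmodule.2
        ⟨((K ⊓ N).relIndex (H ⊓ N) : k) • ((inflate N M).res h).hom w, ?_⟩
      rw [smul_smul, ← Nat.cast_mul,
        Subgroup.card_mul_relIndex_of_le (inf_le_inf_right N h)]
      exact (map_smul ((inflate N M).res h).hom _ w).symm)
    -- Stability under transfers relies on the rescaling: the factor `|H ∩ N : K ∩ N|` turns a
    -- multiple of `|K ∩ N|` into a multiple of `|H ∩ N|`.
    (fun {K H} h => by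
      rintro _ ⟨w, rfl⟩
      let w' : (inflate N M).obj H := (M.tr (Subgroup.map_mono h)).hom w
      refine mem_cardMulSubmodule.2 ⟨w', Eq.trans ?_ (map_smul ((inflate N M).tr h).hom _ w).symm⟩
      have e : ((inflate N M).tr h).hom w = ((K ⊓ N).relIndex (H ⊓ N) : k) • w' := rfl
      rw [e, smul_smul, ← Nat.cast_mul, Subgroup.card_mul_relIndex_of_le (inf_le_inf_right N h)])
    (fun g {H L} h => by
      rintro _ ⟨w, rfl⟩
      refine mem_cardMulSubmodule.2 ⟨((inflate N M).conj g h).hom w, ?_⟩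
      have : Nat.card (L ⊓ N : Subgroup G) = Nat.card (H ⊓ N : Subgroup G) := by
        have hN : MulAut.conj g • N = N :=
          Subgroup.Normal.conjAct ‹N.Normal› (ConjAct.toConjAct g)
        rw [← h]
        conv_lhs => rw [← hN, ← Subgroup.smul_inf]
        exact Nat.card_congr (Subgroup.equivSMul (MulAut.conj g) (H ⊓ N)).toEquiv.symm
      rw [this]
      exact (map_smul ((inflate N M).conj g h).hom _ w).symm)

/-- The inclusion of `H ↦ |H ∩ N| M(HN/N)` into `H ↦ M(HN/N)`. -/
noncomputable def traceInflationIncl (M : CohMackey k (G ⧸ N)) :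
    traceInflationObj N M ⟶ inflate N M where
  app H := ModuleCat.ofHom (cardMulSubmodule N M H).subtype
  res _ := rfl
  tr _ := rfl
  conj _ _ _ _ := rfl

instance (M : CohMackey k (G ⧸ N)) (H : Subgroup G) : Mono ((traceInflationIncl N M).app H) :=
  (ModuleCat.mono_iff_injective _).2 Subtype.val_injective

/-- A family of maps into the values of `traceInflationObj N M` is a morphism if its composite
with the inclusion is. -/
noncomputable def traceInflationLift {M : CohMackey k (G ⧸ N)} {A : CohMackey k G}
    (f : A ⟶ inflate N M) (hf : ∀ H v, (f.app H).hom v ∈ cardMulSubmodule N M H) :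
    A ⟶ traceInflationObj N M where
  app H := ModuleCat.ofHom ((f.app H).hom.codRestrict (cardMulSubmodule N M H) (hf H))
  res h := by
    ext x
    exact Subtype.ext (congrArg (fun f => f.hom x) (f.res h))
  tr h := by
    ext x
    exact Subtype.ext (congrArg (fun f => f.hom x) (f.tr h))
  conj g _ _ h := by
    ext x
    exact Subtype.ext (congrArg (fun f => f.hom x) (f.conj g h))

variable (k) in
/-- The functor `σ : M ↦ (H ↦ |H ∩ N| M(HN/N))` from cohomological Mackey functors for `G/N` to
cohomological Mackey functors for `G`. -/
noncomputable def traceInflation : CohMackey k (G ⧸ N) ⥤ CohMackey k G where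
  obj M := traceInflationObj N M
  map {M M'} f := traceInflationLift N (traceInflationIncl N M ≫ inflateMap N f) (by
    rintro H ⟨_, w, rfl⟩
    refine mem_cardMulSubmodule.2 ⟨((inflateMap N f).app H).hom w, ?_⟩
    exact (map_smul ((inflateMap N f).app H).hom _ w).symm)

instance : (traceInflation k N).Additive where

instance : (traceInflation k N).Linear k where

end TraceInflation

section Exact

variable {k G : Type u} [Field k] [Group G] [Finite G] (N : Subgroup G) [N.Normal]

theorem cardMulSubmodule_eq_top (M : CohMackey k (G ⧸ N)) {H : Subgroup G}
    (h : (Nat.card (H ⊓ N : Subgroup G) : k) ≠ 0) : cardMulSubmodule N M H = ⊤ :=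
  Submodule.eq_top_iff'.2 fun v => mem_cardMulSubmodule.2 ⟨_, smul_inv_smul₀ h v⟩

theorem cardMulSubmodule_eq_bot (M : CohMackey k (G ⧸ N)) {H : Subgroup G}
    (h : (Nat.card (H ⊓ N : Subgroup G) : k) = 0) : cardMulSubmodule N M H = ⊥ := by
  refine (Submodule.eq_bot_iff _).2 fun v hv => ?_
  obtain ⟨w, rfl⟩ := mem_cardMulSubmodule.1 hv
  rw [h, zero_smul]

theorem isIso_traceInflationIncl_app (M : CohMackey k (G ⧸ N)) {H : Subgroup G}
    (h : (Nat.card (H ⊓ N : Subgroup G) : k) ≠ 0) : IsIso ((traceInflationIncl N M).app H) :=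
  (ConcreteCategory.isIso_iff_bijective _).2
    ⟨Subtype.val_injective, fun v => ⟨⟨v, cardMulSubmodule_eq_top N M h ▸ trivial⟩, rfl⟩⟩

theorem isZero_traceInflation_obj (M : CohMackey k (G ⧸ N)) {H : Subgroup G}
    (h : (Nat.card (H ⊓ N : Subgroup G) : k) = 0) : IsZero ((traceInflationObj N M).obj H) := by
  have : Subsingleton (cardMulSubmodule N M H) := by
    rw [cardMulSubmodule_eq_bot N M h]
    infer_instance
  exact ModuleCat.isZero_of_subsingleton (ModuleCat.of k (cardMulSubmodule N M H))

/-- The values of `traceInflation k N` at a subgroup `H` with `|H ∩ N|` invertible. -/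
noncomputable def traceInflationEvalIso {H : Subgroup G}
    (h : (Nat.card (H ⊓ N : Subgroup G) : k) ≠ 0) :
    eval k (H.map (QuotientGroup.mk' N)) ≅ traceInflation k N ⋙ eval k H :=
  have := fun M : CohMackey k (G ⧸ N) => isIso_traceInflationIncl_app N M h
  (NatIso.ofComponents
    (F := traceInflation k N ⋙ eval k H) (G := eval k (H.map (QuotientGroup.mk' N)))
    (fun M => @asIso _ _ _ _ ((traceInflationIncl N M).app H) (this M)) fun _ => rfl).symm

theorem isZero_traceInflation_comp_eval {H : Subgroup G}
    (h : (Nat.card (H ⊓ N : Subgroup G) : k) = 0) :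
    IsZero (traceInflation k N ⋙ eval k H) :=
  Functor.isZero _ fun M => isZero_traceInflation_obj N M h

/-- Over a field `|H ∩ N|` is zero or invertible. Accordingly the composite is the zero functor or
the exact evaluation at `HN/N`. -/
instance (H : Subgroup G) : PreservesFiniteLimits (traceInflation k N ⋙ eval k H) := by
  by_cases h : (Nat.card (H ⊓ N : Subgroup G) : k) = 0
  · exact ⟨fun J _ _ => Functor.preservesLimitsOfShape_of_isZero _
      (isZero_traceInflation_comp_eval N h) J⟩
  · exact preservesFiniteLimits_of_natIso (traceInflationEvalIso N h)

instance (H : Subgroup G) : PreservesFiniteColimits (traceInflation k N ⋙ eval k H) := by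
  by_cases h : (Nat.card (H ⊓ N : Subgroup G) : k) = 0
  · exact ⟨fun J _ _ => Functor.preservesColimitsOfShape_of_isZero _
      (isZero_traceInflation_comp_eval N h) J⟩
  · exact preservesFiniteColimits_of_natIso (traceInflationEvalIso N h)

/-- Limits of Mackey functors are detected by the evaluations, so exactness of each composite with
an evaluation suffices. -/
instance : PreservesFiniteLimits (traceInflation k N) :=
  ⟨fun _ _ _ => ⟨fun {F} => preservesLimit_of_preserves_limit_cone (isLimitLimitCone F)
    (isLimitOfEval _ fun H =>
      isLimitOfPreserves (traceInflation k N ⋙ eval k H) (isLimitLimitCone F))⟩⟩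

instance : PreservesFiniteColimits (traceInflation k N) :=
  ⟨fun _ _ _ => ⟨fun {F} => preservesColimit_of_preserves_colimit_cocone
    (isColimitColimitCocone F) (isColimitOfEval _ fun H =>
      isColimitOfPreserves (traceInflation k N ⋙ eval k H) (isColimitColimitCocone F))⟩⟩

end Exact

end CohMackey

/-! ### The module `tr_1^N(k[G/H])` and its basis of orbit traces. -/

namespace Subgroup

variable {G G' : Type u} [Group G] [Group G']

/-- The map `G/H → G'/f(H)` induced by a group homomorphism `f`. -/
def quotientMapHom (f : G →* G') (H : Subgroup G) : G ⧸ H → G' ⧸ H.map f :=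
  Quotient.map' f fun a b h => by
    rw [QuotientGroup.leftRel_apply] at h ⊢
    exact ⟨_, h, by simp⟩

@[simp]
theorem quotientMapHom_mk (f : G →* G') (H : Subgroup G) (g : G) :
    quotientMapHom f H (g : G ⧸ H) = (f g : G' ⧸ H.map f) := rfl

theorem quotientMapHom_surjective (f : G →* G') (hf : Function.Surjective f) (H : Subgroup G) :
    Function.Surjective (quotientMapHom f H) := fun x => by
  induction x using QuotientGroup.induction_on with
  | H x =>
  obtain ⟨g, rfl⟩ := hf x
  exact ⟨(g : G ⧸ H), rfl⟩

variable (N : Subgroup G) [N.Normal]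

/-- Identifies `N\(G/H)` with `(G/N)/(HN/N)`: traces of cosets may be indexed by the latter. -/
theorem quotientMapHom_mk'_eq_iff (H : Subgroup G) (x y : G ⧸ H) :
    quotientMapHom (QuotientGroup.mk' N) H x = quotientMapHom (QuotientGroup.mk' N) H y ↔
      OrbitSet.mk N x = OrbitSet.mk N y := by
  induction x using QuotientGroup.induction_on with
  | H a =>
  induction y using QuotientGroup.induction_on with
  | H b =>
  rw [OrbitSet.mk_eq_iff, quotientMapHom_mk, quotientMapHom_mk, QuotientGroup.eq]
  constructor
  · rintro ⟨h, hh, e⟩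
    have hn : h⁻¹ * (a⁻¹ * b) ∈ N := QuotientGroup.eq.1 e
    refine ⟨b * (h⁻¹ * (a⁻¹ * b))⁻¹ * b⁻¹, Normal.conj_mem inferInstance _ (inv_mem hn) b, ?_⟩
    rw [MulAction.Quotient.smul_coe, QuotientGroup.eq, smul_eq_mul]
    convert inv_mem hh using 1
    group
  · rintro ⟨n, hn, e⟩
    rw [MulAction.Quotient.smul_coe, QuotientGroup.eq, smul_eq_mul] at e
    refine ⟨_, inv_mem e, ?_⟩
    have : (QuotientGroup.mk' N) n = 1 := (QuotientGroup.eq_one_iff n).2 hn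
    simp only [map_inv, map_mul, this]
    group

/-- The number of points of `G/K` over a point of `G/H` and a compatible point of
`(G/N)/(KN/N)`. -/
theorem card_fibre_quotientMapHom_mk' [Finite G] {K H : Subgroup G} (h : K ≤ H) (x : G ⧸ H)
    (z : (G ⧸ N) ⧸ K.map (QuotientGroup.mk' N))
    (hz : quotientMapOfLE (map_mono h) z = quotientMapHom (QuotientGroup.mk' N) H x) :
    Nat.card {y : G ⧸ K //
      quotientMapOfLE h y = x ∧ quotientMapHom (QuotientGroup.mk' N) K y = z} =
      (K ⊓ N).relIndex (H ⊓ N) := by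
  -- A common lift of `x` and `z`: compatibility gives `c ∈ H` by which a representative of `x` can
  -- be moved over `z` without leaving its coset of `H`.
  obtain ⟨b, rfl, rfl⟩ : ∃ b : G, (b : G ⧸ H) = x ∧
      quotientMapHom (QuotientGroup.mk' N) K (b : G ⧸ K) = z := by
    obtain ⟨z, rfl⟩ := quotientMapHom_surjective _ (QuotientGroup.mk'_surjective N) K z
    induction x using QuotientGroup.induction_on with
    | H g =>
    induction z using QuotientGroup.induction_on with
    | H a =>
    rw [quotientMapHom_mk, quotientMapHom_mk, quotientMapOfLE_apply_mk, eq_comm,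
      QuotientGroup.eq] at hz
    obtain ⟨c, hc, e⟩ := hz
    refine ⟨g * c, ?_, ?_⟩
    · rw [eq_comm, QuotientGroup.eq, inv_mul_cancel_left]
      exact hc
    · rw [quotientMapHom_mk, quotientMapHom_mk, map_mul, e, mul_inv_cancel_left]
  -- The fibre is parametrised by `n ↦ bnK` with `n ∈ H ∩ N`. Each point is attained exactly `|K ∩
  -- N|` times: over `cK`, the solutions are the `b⁻¹cq⁻¹m` with `m ∈ K ∩ N`, for a suitable `q ∈ K`
  -- that makes `b⁻¹cq⁻¹` an element of `N`.
  let f : (H ⊓ N : Subgroup G) → {y : G ⧸ K // quotientMapOfLE h y = (b : G ⧸ H) ∧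
      quotientMapHom (QuotientGroup.mk' N) K y =
        quotientMapHom (QuotientGroup.mk' N) K (b : G ⧸ K)} := fun n =>
    ⟨((b * n : G) : G ⧸ K), by
      rw [quotientMapOfLE_apply_mk, eq_comm, QuotientGroup.eq, inv_mul_cancel_left]
      exact n.2.1, by
      have hn : QuotientGroup.mk' N (n : G) = 1 := (QuotientGroup.eq_one_iff (n : G)).2 n.2.2
      rw [quotientMapHom_mk, quotientMapHom_mk, map_mul, hn, mul_one]⟩
  have hf : ∀ y, Nat.card {n // f n = y} = Nat.card (K ⊓ N : Subgroup G) := by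
    rintro ⟨y, hy, hy'⟩
    induction y using QuotientGroup.induction_on with
    | H c =>
    rw [quotientMapOfLE_apply_mk, eq_comm, QuotientGroup.eq] at hy
    rw [quotientMapHom_mk, quotientMapHom_mk, eq_comm, QuotientGroup.eq] at hy'
    obtain ⟨q, hq, e⟩ := hy'
    have hn : q⁻¹ * (b⁻¹ * c) ∈ N := QuotientGroup.eq.1 e
    have hn' : b⁻¹ * c * q⁻¹ ∈ N := by
      have := Normal.conj_mem (inferInstance : N.Normal) _ hn q
      rwa [mul_inv_cancel_left] at this
    refine Nat.card_congr
      { toFun := fun n => ⟨q * (b⁻¹ * c)⁻¹ * n.1, ?_, ?_⟩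
        invFun := fun m => ⟨⟨b⁻¹ * c * q⁻¹ * m,
          (H ⊓ N).mul_mem ⟨H.mul_mem hy (H.inv_mem (h hq)), hn'⟩ ⟨h m.2.1, m.2.2⟩⟩, ?_⟩
        left_inv := fun n => ?_
        right_inv := fun m => ?_ }
    · have := congrArg Subtype.val n.2
      change ((b * (n.1 : G) : G) : G ⧸ K) = (c : G ⧸ K) at this
      rw [eq_comm, QuotientGroup.eq] at this
      have e : q * (b⁻¹ * c)⁻¹ * (n.1 : G) = q * (c⁻¹ * (b * (n.1 : G))) := by group
      rw [e]
      exact K.mul_mem hq this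
    · have e : q * (b⁻¹ * c)⁻¹ * (n.1 : G) = (b⁻¹ * c * q⁻¹)⁻¹ * n.1 := by group
      rw [e]
      exact N.mul_mem (N.inv_mem hn') n.1.2.2
    · refine Subtype.ext ?_
      change ((b * (b⁻¹ * c * q⁻¹ * (m : G)) : G) : G ⧸ K) = (c : G ⧸ K)
      rw [eq_comm, QuotientGroup.eq]
      convert K.mul_mem (K.inv_mem hq) m.2.1 using 1
      group
    · refine Subtype.ext (Subtype.ext ?_)
      change b⁻¹ * c * q⁻¹ * (q * (b⁻¹ * c)⁻¹ * (n.1 : G)) = n.1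
      group
    · refine Subtype.ext ?_
      change q * (b⁻¹ * c)⁻¹ * (b⁻¹ * c * q⁻¹ * (m : G)) = m
      group
  have h1 := Nat.card_eq_card_mul_of_fibres f _ hf
  have h2 := card_mul_relIndex_of_le (inf_le_inf_right N h)
  have h3 : 0 < Nat.card (K ⊓ N : Subgroup G) := Nat.card_pos
  refine Nat.eq_of_mul_eq_mul_right h3 (h1.symm.trans ?_)
  rw [← h2, mul_comm]

end Subgroup

theorem Rep.fibreSum_eq_sum {k X Y : Type u} [CommRing k] [Finite X] {φ : X → Y} {y : Y}
    (s : Finset X) (hs : ∀ x, x ∈ s ↔ φ x = y) :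
    Rep.fibreSum k φ y = ∑ x ∈ s, MonoidAlgebra.single x (1 : k) := by
  classical
  let _ := Fintype.ofFinite X
  rw [Rep.fibreSum]
  refine Finset.sum_congr (Finset.ext fun x => ?_) fun _ _ => rfl
  rw [hs, Finset.mem_filter]
  exact ⟨fun h => h.2, fun h => ⟨Finset.mem_univ _, h⟩⟩

section TraceQuot

open Representation

theorem hom_relTrace {k G : Type u} [CommRing k] [Group G] (N : Subgroup G) [Finite N]
    {W W' : Rep.{u} k G} (f : W ⟶ W') (v : W.V) :
    f.hom (relTrace N W.ρ v) = relTrace N W'.ρ (f.hom v) := by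
  let _ := Fintype.ofFinite N
  rw [relTrace_apply, relTrace_apply, map_sum]
  exact Finset.sum_congr rfl fun n _ => Rep.hom_comm_apply f n v

variable {k G : Type u} [Field k] [Group G] (N : Subgroup G) [Finite N] [N.Normal]

theorem trPt_eq_zero {X : Type u} [MulAction G X] {x : X} (hx : (trPt k N x).coeff x = 0) :
    trPt k N x = 0 := by
  refine MonoidAlgebra.ext (Finsupp.ext fun y => ?_)
  by_cases hy : OrbitSet.mk N x = OrbitSet.mk N y
  · obtain ⟨n, hn, e⟩ := (OrbitSet.mk_eq_iff N).1 hy.symm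
    rw [← e, coeff_smul_of_mem N _ ⟨_, rfl⟩ n hn, hx]
    rfl
  · exact trPt_coeff_eq_zero N x y hy

/-- The coefficient counts the elements of `N` fixing `x`. Translation by `G` reduces this to the
base point, whose stabiliser in `N` is `H ∩ N`. -/
theorem trPt_coeff_self (H : Subgroup G) (x : G ⧸ H) :
    (trPt k N x).coeff x = (Nat.card (H ⊓ N : Subgroup G) : k) := by
  classical
  let _ := Fintype.ofFinite N
  induction x using QuotientGroup.induction_on with
  | H g =>
  have hg : (g : G ⧸ H) = g • ((1 : G) : G ⧸ H) := by
    rw [MulAction.Quotient.smul_coe, smul_eq_mul, mul_one]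
  rw [hg, trPt_coeff_smul, trPt, relTrace_apply]
  simp only [Representation.ofMulAction_single, MonoidAlgebra.coeff_sum, Finsupp.finsetSum_apply,
    MonoidAlgebra.coeff_single, Finsupp.single_apply]
  rw [Finset.sum_boole]
  congr 1
  rw [← Fintype.card_subtype, ← Nat.card_eq_fintype_card]
  refine Nat.card_congr
    { toFun := fun n => ⟨n.1, ?_, n.1.2⟩
      invFun := fun m => ⟨⟨m, m.2.2⟩, ?_⟩
      left_inv := fun _ => rfl
      right_inv := fun _ => rfl }
  · have := n.2
    rw [MulAction.Quotient.smul_coe, eq_comm, QuotientGroup.eq] at this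
    simpa using this
  · rw [MulAction.Quotient.smul_coe, eq_comm, QuotientGroup.eq]
    simpa using m.2.1

variable (k) in
/-- The element of `tr_1^N(k[G/H])` attached to a point of `(G/N)/(HN/N)`. -/
noncomputable def tracePoint (H : Subgroup G) (z : (G ⧸ N) ⧸ H.map (QuotientGroup.mk' N)) :
    LinearMap.range (relTrace N (Representation.ofMulAction k G (G ⧸ H))) :=
  ⟨trPt k N (Function.surjInv (Subgroup.quotientMapHom_surjective _
    (QuotientGroup.mk'_surjective N) H) z), _, rfl⟩

/-- Frees `tracePoint` from the chosen preimage: two preimages lie in the same `N`-orbit and have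
the same trace. -/
theorem tracePoint_quotientMapHom (H : Subgroup G) (x : G ⧸ H) :
    (tracePoint k N H (Subgroup.quotientMapHom (QuotientGroup.mk' N) H x)).1 = trPt k N x :=
  trPt_congr N ((Subgroup.quotientMapHom_mk'_eq_iff N H _ _).1 (Function.surjInv_eq _ _))

variable (k) in
/-- The morphism `k[(G/N)/(HN/N)] ⟶ tr_1^N(k[G/H])`, `xHN/N ↦ tr_1^N(xH)`. -/
noncomputable def traceQuot (H : Subgroup G) :
    Rep.ofMulAction k (G ⧸ N) ((G ⧸ N) ⧸ H.map (QuotientGroup.mk' N)) ⟶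
      (traceFunctor N).obj (Rep.ofMulAction k G (G ⧸ H)) :=
  Rep.permHom (tracePoint k N H) fun q z => by
    obtain ⟨x, rfl⟩ := Subgroup.quotientMapHom_surjective _ (QuotientGroup.mk'_surjective N) H z
    induction q using QuotientGroup.induction_on with
    | H g =>
    refine Subtype.ext ?_
    have : (g : G ⧸ N) • Subgroup.quotientMapHom (QuotientGroup.mk' N) H x =
        Subgroup.quotientMapHom (QuotientGroup.mk' N) H (g • x) := by
      induction x using QuotientGroup.induction_on with
      | H x => rfl
    rw [this, tracePoint_quotientMapHom]
    change _ = Representation.ofMulAction k G (G ⧸ H) g (tracePoint k N H _).1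
    rw [tracePoint_quotientMapHom, smul_trPt]

theorem traceQuot_single (H : Subgroup G) (z : (G ⧸ N) ⧸ H.map (QuotientGroup.mk' N)) :
    (traceQuot k N H).hom (MonoidAlgebra.single z 1) = tracePoint k N H z :=
  (Rep.permHom_single _ _ z 1).trans (one_smul k _)

/-- Two morphisms from a permutation module to `tr_1^N(W)` agree if they agree on the basis
elements given by points of `G/H`. -/
theorem traceFunctor_hom_ext {H : Subgroup G} {W : Rep.{u} k G}
    {a b : Rep.ofMulAction k (G ⧸ N) ((G ⧸ N) ⧸ H.map (QuotientGroup.mk' N)) ⟶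
      (traceFunctor N).obj W}
    (h : ∀ x : G ⧸ H,
      (a.hom (MonoidAlgebra.single (Subgroup.quotientMapHom (QuotientGroup.mk' N) H x) 1) :
        LinearMap.range (relTrace N W.ρ)).1 =
      (b.hom (MonoidAlgebra.single (Subgroup.quotientMapHom (QuotientGroup.mk' N) H x) 1) :
        LinearMap.range (relTrace N W.ρ)).1) : a = b :=
  Rep.perm_hom_ext fun z => by
    obtain ⟨x, rfl⟩ := Subgroup.quotientMapHom_surjective _ (QuotientGroup.mk'_surjective N) H z
    exact Subtype.ext (h x)

theorem traceQuot_traceFunctor_map_single {H : Subgroup G} {W : Rep.{u} k G}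
    (f : Rep.ofMulAction k G (G ⧸ H) ⟶ W) (x : G ⧸ H) :
    ((traceQuot k N H ≫ (traceFunctor N).map f).hom (MonoidAlgebra.single
      (Subgroup.quotientMapHom (QuotientGroup.mk' N) H x) 1) :
        LinearMap.range (relTrace N W.ρ)).1 = relTrace N W.ρ (f.hom (MonoidAlgebra.single x 1)) := by
  rw [← hom_relTrace]
  change f.hom ((traceQuot k N H).hom (MonoidAlgebra.single
      (Subgroup.quotientMapHom (QuotientGroup.mk' N) H x) 1) :
        LinearMap.range (relTrace N (Representation.ofMulAction k G (G ⧸ H)))).1 = _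
  rw [traceQuot_single, tracePoint_quotientMapHom]

open CohMackey

theorem traceQuot_projHom {K H : Subgroup G} (h : K ≤ H) :
    traceQuot k N K ≫ (traceFunctor N).map (projHom k h) =
      projHom k (Subgroup.map_mono h) ≫ traceQuot k N H :=
  traceFunctor_hom_ext N fun x => by
    rw [traceQuot_traceFunctor_map_single, Rep.push_single]
    change _ = ((traceQuot k N H).hom ((projHom k (Subgroup.map_mono h)).hom
      (MonoidAlgebra.single _ 1)) :
        LinearMap.range (relTrace N (Representation.ofMulAction k G (G ⧸ H)))).1
    rw [Rep.push_single, traceQuot_single]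
    refine (tracePoint_quotientMapHom N H _).symm.trans ?_
    congr 2
    induction x using QuotientGroup.induction_on; rfl

theorem traceQuot_conjHom (g : G) {H L : Subgroup G} (h : MulAut.conj g • H = L) :
    traceQuot k N L ≫ (traceFunctor N).map (conjHom k g h) =
      conjHom k (g : G ⧸ N) (conj_mk_smul_map N g h) ≫ traceQuot k N H :=
  traceFunctor_hom_ext N fun x => by
    rw [traceQuot_traceFunctor_map_single, Rep.push_single]
    change _ = ((traceQuot k N H).hom ((conjHom k (g : G ⧸ N) (conj_mk_smul_map N g h)).hom
      (MonoidAlgebra.single _ 1)) :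
        LinearMap.range (relTrace N (Representation.ofMulAction k G (G ⧸ H)))).1
    rw [Rep.push_single, traceQuot_single]
    refine (tracePoint_quotientMapHom N H _).symm.trans ?_
    congr 2
    induction x using QuotientGroup.induction_on; rfl

/-- The points of `G/K` over `xH` are sorted by their images in `(G/N)/(KN/N)`. Each admissible
image occurs `|H ∩ N : K ∩ N|` times, and points with the same image have the same trace. This is
the origin of the factor on the transfers of `inflate`. -/
theorem traceQuot_sumHom [Finite G] {K H : Subgroup G} (h : K ≤ H) :
    traceQuot k N H ≫ (traceFunctor N).map (sumHom k h) =
      ((K ⊓ N).relIndex (H ⊓ N) : k) • (sumHom k (Subgroup.map_mono h) ≫ traceQuot k N K) :=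
  traceFunctor_hom_ext N fun x => by
    classical
    let _ := Fintype.ofFinite (G ⧸ K)
    let _ := Fintype.ofFinite ((G ⧸ N) ⧸ K.map (QuotientGroup.mk' N))
    rw [traceQuot_traceFunctor_map_single, Rep.pull_single]
    change _ = ((K ⊓ N).relIndex (H ⊓ N) : k) •
      ((traceQuot k N K).hom ((sumHom k (Subgroup.map_mono h)).hom
        (MonoidAlgebra.single (Subgroup.quotientMapHom (QuotientGroup.mk' N) H x) 1)) :
        LinearMap.range (relTrace N (Representation.ofMulAction k G (G ⧸ K)))).1
    rw [Rep.pull_single]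
    have e1 : ((traceQuot k N K).hom (Rep.fibreSum k
        (Subgroup.quotientMapOfLE (Subgroup.map_mono h))
        (Subgroup.quotientMapHom (QuotientGroup.mk' N) H x)) :
        LinearMap.range (relTrace N (Representation.ofMulAction k G (G ⧸ K)))) =
        ∑ z with Subgroup.quotientMapOfLE (Subgroup.map_mono h) z =
          Subgroup.quotientMapHom (QuotientGroup.mk' N) H x, tracePoint k N K z := by
      rw [Rep.fibreSum_eq_sum (Finset.univ.filter fun z =>
        Subgroup.quotientMapOfLE (Subgroup.map_mono h) z =
          Subgroup.quotientMapHom (QuotientGroup.mk' N) H x) (by simp), map_sum]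
      exact Finset.sum_congr rfl fun z _ => traceQuot_single N K z
    rw [e1, Rep.fibreSum_eq_sum (Finset.univ.filter fun y => Subgroup.quotientMapOfLE h y = x)
        (by simp), map_sum, Submodule.coe_sum, Finset.smul_sum,
      ← Finset.sum_fiberwise_of_maps_to (g := Subgroup.quotientMapHom (QuotientGroup.mk' N) K)
        (t := Finset.univ.filter fun z => Subgroup.quotientMapOfLE (Subgroup.map_mono h) z =
          Subgroup.quotientMapHom (QuotientGroup.mk' N) H x)]
    · refine Finset.sum_congr rfl fun z hz => ?_
      rw [Finset.sum_congr rfl (g := fun _ => (tracePoint k N K z).1), Finset.sum_const,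
        Nat.cast_smul_eq_nsmul, ← Subgroup.card_fibre_quotientMapHom_mk' N h x z
          (Finset.mem_filter.1 hz).2, Nat.card_eq_fintype_card, Fintype.card_subtype,
        Finset.filter_filter]
      intro y hy
      rw [← (Finset.mem_filter.1 hy).2, tracePoint_quotientMapHom]
    · intro y hy
      rw [Finset.mem_filter] at hy ⊢
      refine ⟨Finset.mem_univ _, ?_⟩
      rw [← hy.2]
      induction y using QuotientGroup.induction_on; rfl

theorem traceQuot_eq_zero {H : Subgroup G} (h : (Nat.card (H ⊓ N : Subgroup G) : k) = 0) :
    traceQuot k N H = 0 :=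
  traceFunctor_hom_ext N fun x => by
    rw [traceQuot_single, tracePoint_quotientMapHom]
    exact trPt_eq_zero N (by rw [trPt_coeff_self, h])

/-- As `tr_1^N(k[G/H])` is spanned by the traces of cosets, no condition on `|H ∩ N|` is needed. -/
theorem traceQuot_surjective (H : Subgroup G) : Function.Surjective (traceQuot k N H).hom := by
  rintro ⟨_, w, rfl⟩
  induction w using MonoidAlgebra.induction_linear with
  | zero => exact ⟨0, (map_zero _).trans (Subtype.ext (map_zero _).symm)⟩
  | add v w hv hw =>
    obtain ⟨a, ha⟩ := hv
    obtain ⟨b, hb⟩ := hw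
    refine ⟨a + b, ?_⟩
    rw [map_add, ha, hb]
    exact Subtype.ext (map_add _ _ _).symm
  | single x r =>
    refine ⟨r • MonoidAlgebra.single (Subgroup.quotientMapHom (QuotientGroup.mk' N) H x) 1, ?_⟩
    rw [map_smul, traceQuot_single]
    refine Subtype.ext ((congrArg (r • ·) (tracePoint_quotientMapHom N H x)).trans ?_)
    refine (map_smul _ _ _).symm.trans ?_
    rw [MonoidAlgebra.smul_single, smul_eq_mul, mul_one]

end TraceQuot

section TraceQuot

open Representation

variable {k G : Type u} [Field k] [Group G] (N : Subgroup G) [Finite N] [N.Normal]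

/-- Orbits are disjoint, so a coefficient of `v` reappears multiplied by `|H ∩ N|`; injectivity for
nonzero `|H ∩ N|` is then immediate. -/
theorem traceQuot_coeff (H : Subgroup G)
    (v : MonoidAlgebra k ((G ⧸ N) ⧸ H.map (QuotientGroup.mk' N))) (x : G ⧸ H) :
    ((traceQuot k N H).hom v :
      LinearMap.range (relTrace N (Representation.ofMulAction k G (G ⧸ H)))).1.coeff x =
      v.coeff (Subgroup.quotientMapHom (QuotientGroup.mk' N) H x) *
        (Nat.card (H ⊓ N : Subgroup G) : k) := by
  classical
  induction v using MonoidAlgebra.induction_linear with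
  | zero =>
    rw [map_zero, MonoidAlgebra.coeff_zero, Finsupp.zero_apply, zero_mul]
    rfl
  | add v w hv hw =>
    rw [map_add, MonoidAlgebra.coeff_add, Finsupp.add_apply, add_mul, ← hv, ← hw]
    rfl
  | single z r =>
    have e : (MonoidAlgebra.single z r : MonoidAlgebra k _) =
        r • MonoidAlgebra.single z (1 : k) := by
      rw [MonoidAlgebra.smul_single, smul_eq_mul, mul_one]
    rw [e, map_smul, traceQuot_single, ← e, MonoidAlgebra.coeff_single]
    change r * (tracePoint k N H z).1.coeff x = _
    obtain ⟨y, rfl⟩ := Subgroup.quotientMapHom_surjective _ (QuotientGroup.mk'_surjective N) H z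
    rw [tracePoint_quotientMapHom]
    by_cases h : Subgroup.quotientMapHom (QuotientGroup.mk' N) H y =
        Subgroup.quotientMapHom (QuotientGroup.mk' N) H x
    · rw [h, Finsupp.single_eq_same,
        trPt_congr N ((Subgroup.quotientMapHom_mk'_eq_iff N H _ _).1 h), trPt_coeff_self]
    · rw [Finsupp.single_apply, if_neg h, zero_mul, trPt_coeff_eq_zero N y x
        (fun h' => h ((Subgroup.quotientMapHom_mk'_eq_iff N H _ _).2 h')), mul_zero]

theorem traceQuot_injective {H : Subgroup G} (h : (Nat.card (H ⊓ N : Subgroup G) : k) ≠ 0) :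
    Function.Injective (traceQuot k N H).hom := by
  refine (injective_iff_map_eq_zero (traceQuot k N H).hom).2 fun v hv => ?_
  refine MonoidAlgebra.ext (Finsupp.ext fun z => ?_)
  obtain ⟨x, rfl⟩ := Subgroup.quotientMapHom_surjective _ (QuotientGroup.mk'_surjective N) H z
  have := traceQuot_coeff N H v x
  rw [hv] at this
  exact (mul_eq_zero.1 this.symm).resolve_right h

theorem isIso_traceQuot {H : Subgroup G} (h : (Nat.card (H ⊓ N : Subgroup G) : k) ≠ 0) :
    IsIso (traceQuot k N H) :=
  (ConcreteCategory.isIso_iff_bijective _).2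
    ⟨traceQuot_injective N h, traceQuot_surjective N H⟩

end TraceQuot

/-! ### Comparison of `σ` with precomposition by `tr_1^N`. -/

theorem FunPlus.map_zero {k G : Type u} [Field k] [Group G] (F : FunPlus k G) {A B : PermPlus k G} :
    F.obj.map (0 : A ⟶ B).op = 0 := by
  have := F.property.2 A B 0 0
  rwa [zero_smul, zero_smul] at this

section TraceIso

variable {k G : Type u} [Field k] [Group G] [Finite G] (N : Subgroup G) [N.Normal]

variable (k) in
/-- The morphism `k[(G/N)/(HN/N)] ⟶ tr_1^N(k[G/H])` in `perm⁺_k(G/N)`. -/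
noncomputable def PermPlus.traceQuot (H : Subgroup G) :
    PermPlus.perm k ((G ⧸ N) ⧸ H.map (QuotientGroup.mk' N)) ⟶
      (tracePerm k N).obj (PermPlus.perm k (G ⧸ H)) :=
  ObjectProperty.homMk (_root_.traceQuot k N H)

theorem PermPlus.isIso_traceQuot {H : Subgroup G}
    (h : (Nat.card (H ⊓ N : Subgroup G) : k) ≠ 0) : IsIso (PermPlus.traceQuot k N H) :=
  have : IsIso ((IsPermSummand k (G ⧸ N)).ι.map (PermPlus.traceQuot k N H)) :=
    _root_.isIso_traceQuot N h
  isIso_of_reflects_iso _ (IsPermSummand k (G ⧸ N)).ι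

theorem PermPlus.traceQuot_eq_zero {H : Subgroup G}
    (h : (Nat.card (H ⊓ N : Subgroup G) : k) = 0) : PermPlus.traceQuot k N H = 0 :=
  congrArg ObjectProperty.homMk (_root_.traceQuot_eq_zero N h)

namespace CohMackey

/-- The morphism of Mackey functors from `H ↦ F(tr_1^N(k[G/H]))` to `H ↦ F(k[(G/N)/(HN/N)])`. -/
noncomputable def precompTraceToInflate (F : FunPlus k (G ⧸ N)) :
    (ofFun k G).obj ((FunPlus.precompTrace k N).obj F) ⟶ inflate N ((ofFun k (G ⧸ N)).obj F) where
  app H := F.obj.map (PermPlus.traceQuot k N H).op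
  res {K H} h := by
    refine (F.obj.map_comp _ _).symm.trans (Eq.trans ?_ (F.obj.map_comp _ _))
    exact congrArg (fun f => F.obj.map (Quiver.Hom.op
      (X := PermPlus.perm k ((G ⧸ N) ⧸ K.map (QuotientGroup.mk' N)))
      (Y := (tracePerm k N).obj (PermPlus.perm k (G ⧸ H))) (ObjectProperty.homMk f)))
      (traceQuot_projHom N h)
  tr {K H} h := by
    refine (F.obj.map_comp _ _).symm.trans ?_
    refine Eq.trans ?_ (Linear.comp_smul _ _ _ (F.obj.map (PermPlus.traceQuot k N K).op)
      ((K ⊓ N).relIndex (H ⊓ N) : k) (((ofFun k (G ⧸ N)).obj F).tr (Subgroup.map_mono h))).symm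
    refine Eq.trans ?_ (congrArg _ (F.obj.map_comp _ _))
    refine Eq.trans ?_ (F.property.2 _ _ _ _)
    exact congrArg (fun f => F.obj.map (Quiver.Hom.op
      (X := PermPlus.perm k ((G ⧸ N) ⧸ H.map (QuotientGroup.mk' N)))
      (Y := (tracePerm k N).obj (PermPlus.perm k (G ⧸ K))) (ObjectProperty.homMk f)))
      (traceQuot_sumHom N h)
  conj g {H L} h := by
    refine (F.obj.map_comp _ _).symm.trans (Eq.trans ?_ (F.obj.map_comp _ _))
    exact congrArg (fun f => F.obj.map (Quiver.Hom.op
      (X := PermPlus.perm k ((G ⧸ N) ⧸ L.map (QuotientGroup.mk' N)))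
      (Y := (tracePerm k N).obj (PermPlus.perm k (G ⧸ H))) (ObjectProperty.homMk f)))
      (traceQuot_conjHom N g h)

theorem precompTraceToInflate_app_eq_zero (F : FunPlus k (G ⧸ N)) {H : Subgroup G}
    (h : (Nat.card (H ⊓ N : Subgroup G) : k) = 0) : (precompTraceToInflate N F).app H = 0 :=
  (congrArg (fun f => F.obj.map (Quiver.Hom.op f)) (PermPlus.traceQuot_eq_zero N h)).trans
    (FunPlus.map_zero F)

/-- The morphism of Mackey functors from `H ↦ F(tr_1^N(k[G/H]))` to
`H ↦ |H ∩ N| F(k[(G/N)/(HN/N)])`. -/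
noncomputable def precompTraceToTraceInflation (F : FunPlus k (G ⧸ N)) :
    (ofFun k G).obj ((FunPlus.precompTrace k N).obj F) ⟶
      (traceInflation k N).obj ((ofFun k (G ⧸ N)).obj F) :=
  traceInflationLift N (precompTraceToInflate N F) fun H v => by
    by_cases h : (Nat.card (H ⊓ N : Subgroup G) : k) = 0
    · rw [precompTraceToInflate_app_eq_zero N F h]
      exact Submodule.zero_mem _
    · rw [cardMulSubmodule_eq_top N _ h]
      trivial

/-- Here `traceQuot` is both surjective and zero, so `tr_1^N(k[G/H])` vanishes, and a linear functor
sends zero objects to zero objects. -/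
theorem isZero_precompTrace_obj (F : FunPlus k (G ⧸ N)) {H : Subgroup G}
    (h : (Nat.card (H ⊓ N : Subgroup G) : k) = 0) :
    IsZero (((ofFun k G).obj ((FunPlus.precompTrace k N).obj F)).obj H) := by
  refine (IsZero.iff_id_eq_zero _).2 ?_
  have h0 : 𝟙 ((tracePerm k N).obj (PermPlus.perm k (G ⧸ H))) = 0 := by
    refine ObjectProperty.hom_ext _ (Rep.hom_ext (Representation.IntertwiningMap.ext
      (LinearMap.ext fun v => ?_)))
    obtain ⟨w, rfl⟩ := traceQuot_surjective N H v
    change (_root_.traceQuot k N H).hom w = 0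
    rw [traceQuot_eq_zero N h]
    rfl
  exact (F.obj.map_id _).symm.trans ((congrArg (fun f => F.obj.map (Quiver.Hom.op f)) h0).trans
    (FunPlus.map_zero F))

instance (F : FunPlus k (G ⧸ N)) : IsIso (precompTraceToTraceInflation N F) :=
  isIso_of_app _ fun H => by
    by_cases h : (Nat.card (H ⊓ N : Subgroup G) : k) = 0
    · exact (isZero_precompTrace_obj N F h).isIso
        (isZero_traceInflation_obj N ((ofFun k (G ⧸ N)).obj F) h) _
    · have : IsIso ((traceInflationIncl N ((ofFun k (G ⧸ N)).obj F)).app H) :=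
        isIso_traceInflationIncl_app N ((ofFun k (G ⧸ N)).obj F) h
      have := PermPlus.isIso_traceQuot N h
      -- Followed by the inclusion, the comparison map is `F(traceQuot)`, and the inclusion is
      -- itself invertible in this case.
      have : IsIso ((precompTraceToTraceInflation N F).app H ≫
          (traceInflationIncl N ((ofFun k (G ⧸ N)).obj F)).app H) :=
        inferInstanceAs (IsIso (F.obj.map (PermPlus.traceQuot k N H).op))
      exact @IsIso.of_isIso_comp_right _ _ _ _ _ _
        ((traceInflationIncl N ((ofFun k (G ⧸ N)).obj F)).app H) ‹_› ‹_›

variable (k) in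
/-- The functor `traceInflation k N` is induced by `tr_1^N : perm⁺_k(G) → perm⁺_k(G/N)`. -/
noncomputable def ofFunCompTraceInflation :
    ofFun k (G ⧸ N) ⋙ traceInflation k N ≅ FunPlus.precompTrace k N ⋙ ofFun k G :=
  (NatIso.ofComponents (F := FunPlus.precompTrace k N ⋙ ofFun k G)
    (G := ofFun k (G ⧸ N) ⋙ traceInflation k N)
    (fun F => asIso (precompTraceToTraceInflation N F)) fun {F F'} φ => by
      ext1 H
      ext v
      exact Subtype.ext (congrArg (fun f => f.hom v)
        (φ.hom.naturality (PermPlus.traceQuot k N H).op).symm)).symm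

end CohMackey

end TraceIso

/-! ### Simple functors under inflation. -/

section SimpleInflation

open Representation

theorem relTrace_top_apply {k G : Type u} [CommRing k] [Group G] [Fintype G] {V : Type u}
    [AddCommGroup V] [Module k V] (ρ : Representation k G V) (v : V) :
    relTrace ⊤ ρ v = ∑ g : G, ρ g v := by
  let _ := Fintype.ofFinite (⊤ : Subgroup G)
  rw [relTrace_apply]
  exact Fintype.sum_equiv Subgroup.topEquiv.toEquiv _ _ fun _ => rfl

variable {k G : Type u} [Group G] [Finite G] (N : Subgroup G) [N.Normal]

/-- The bijection `G ≃ G/N × N` which sends `n⁻¹ q` to `(qN, n)`, for `q` in a set of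
representatives of `G/N`. -/
noncomputable def Subgroup.equivQuotientProd : G ≃ (G ⧸ N) × N where
  toFun g := ((g : G ⧸ N), ⟨(g : G ⧸ N).out * g⁻¹, by
    refine Normal.mem_comm inferInstance ?_
    exact QuotientGroup.eq.1 (QuotientGroup.out_eq' (g : G ⧸ N)).symm⟩)
  invFun p := (p.2 : G)⁻¹ * p.1.out
  left_inv g := by simp
  right_inv := by
    rintro ⟨q, n⟩
    have h : (((n : G)⁻¹ * q.out : G) : G ⧸ N) = q := by
      rw [QuotientGroup.mk_mul, (QuotientGroup.eq_one_iff _).2 (N.inv_mem n.2), one_mul,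
        QuotientGroup.out_eq']
    refine Prod.ext h (Subtype.ext ?_)
    change Quotient.out (((n : G)⁻¹ * q.out : G) : G ⧸ N) * ((n : G)⁻¹ * q.out)⁻¹ = n
    rw [h]
    group

/-- Since `N` acts trivially on the inflated module, the sum of the `g φ(g⁻¹ w)` over a coset of `N`
is `q φ(q⁻¹ tr_1^N(w))`. So the trace over `G` sees `w` only through `tr_1^N(w)`. -/
theorem relTrace_linHom_inflation [CommRing k] (W : Rep.{u} k G) (V : Rep.{u} k (G ⧸ N))
    (φ : W.V →ₗ[k] V.V) :
    relTrace ⊤ (linHom W.ρ (Rep.res (QuotientGroup.mk' N) V).ρ) φ =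
      relTrace ⊤ (linHom ((traceFunctor N).obj W).ρ V.ρ)
        (φ ∘ₗ (LinearMap.range (relTrace N W.ρ)).subtype) ∘ₗ
          (relTrace N W.ρ).rangeRestrict := by
  let _ := Fintype.ofFinite G
  let _ := Fintype.ofFinite N
  let _ := Fintype.ofFinite (G ⧸ N)
  rw [relTrace_top_apply, relTrace_top_apply]
  refine LinearMap.ext fun w => ?_
  have key (q : G ⧸ N) : linHom ((traceFunctor N).obj W).ρ V.ρ q
      (φ ∘ₗ (LinearMap.range (relTrace N W.ρ)).subtype) ((relTrace N W.ρ).rangeRestrict w) =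
        ∑ n : N, V.ρ q (φ (W.ρ (q.out⁻¹ * n) w)) := by
    have e : (LinearMap.range (relTrace N W.ρ)).subtype
        (((traceFunctor N).obj W).ρ q⁻¹ ((relTrace N W.ρ).rangeRestrict w)) =
          W.ρ q.out⁻¹ (relTrace N W.ρ w) := by
      conv_lhs => rw [← QuotientGroup.out_eq' q]
      rfl
    change V.ρ q (φ ((LinearMap.range (relTrace N W.ρ)).subtype
      (((traceFunctor N).obj W).ρ q⁻¹ ((relTrace N W.ρ).rangeRestrict w)))) = _
    rw [e, relTrace_apply, map_sum, map_sum, map_sum]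
    refine Finset.sum_congr rfl fun n _ => ?_
    rw [map_mul]
    rfl
  refine (LinearMap.sum_apply _ _ _).trans (Eq.trans ?_ (LinearMap.sum_apply _ _ _).symm)
  refine Eq.trans ?_ (Finset.sum_congr rfl fun q _ => key q).symm
  rw [← Fintype.sum_prod_type' (f := fun (q : G ⧸ N) (n : N) => V.ρ q (φ (W.ρ (q.out⁻¹ * n) w)))]
  -- The `N`-component of `g` was chosen so that `(gN).out⁻¹ * n` is exactly `g⁻¹`.
  refine Fintype.sum_equiv (Subgroup.equivQuotientProd N) _ _ fun g => ?_
  change V.ρ (g : G ⧸ N) (φ (W.ρ g⁻¹ w)) =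
    V.ρ (g : G ⧸ N) (φ (W.ρ ((g : G ⧸ N).out⁻¹ * ((g : G ⧸ N).out * g⁻¹)) w))
  rw [inv_mul_cancel_left]

/-- A surjective linear map which identifies `tr_1^B Hom_k(U, V)` with `tr_1^A Hom_k(W, Res V)`
induces an isomorphism of `k`-modules. -/
noncomputable def trHomIso {A B : Type u} [CommRing k] [Group A] [Group B] [Finite A] [Finite B]
    (f : A →* B) (V : Rep.{u} k B) {W : Rep.{u} k A} {U : Rep.{u} k B} (t : W.V →ₗ[k] U.V)
    (ht : Function.Surjective t)
    (h : ∀ φ ∈ trHom U V, LinearMap.lcomp k V.V t φ ∈ trHom W (Rep.res f V))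
    (h' : ∀ ψ ∈ trHom W (Rep.res f V), ∃ φ ∈ trHom U V, LinearMap.lcomp k V.V t φ = ψ) :
    ModuleCat.of k (trHom U V) ≅ ModuleCat.of k (trHom W (Rep.res f V)) :=
  (LinearEquiv.ofBijective ((LinearMap.lcomp k V.V t).restrict h) (by
    constructor
    · rintro ⟨φ, _⟩ ⟨φ', _⟩ e
      refine Subtype.ext (LinearMap.ext fun x => ?_)
      obtain ⟨w, rfl⟩ := ht x
      exact LinearMap.congr_fun (congrArg Subtype.val e) w
    · rintro ⟨ψ, hψ⟩
      obtain ⟨φ, hφ, e⟩ := h' ψ hψ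
      exact ⟨⟨φ, hφ⟩, Subtype.ext e⟩)).toModuleIso

variable [Field k]

/-- The isomorphism `tr_1^{G/N} Hom_k(tr_1^N(W), V) ≅ tr_1^G Hom_k(W, Inf V)`. -/
noncomputable def trHomInflation (W : Rep.{u} k G) (V : Rep.{u} k (G ⧸ N)) :=
  trHomIso (QuotientGroup.mk' N) V (W := W) (U := (traceFunctor N).obj W)
    (relTrace N W.ρ).rangeRestrict (LinearMap.surjective_rangeRestrict _)
    (by
      rintro _ ⟨φ, rfl⟩
      -- Only a linear extension from the subspace `tr_1^N(W)` is needed, and one exists over a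
      -- field; averaging takes care of equivariance.
      obtain ⟨ψ, rfl⟩ : ∃ ψ : W.V →ₗ[k] V.V,
        ψ ∘ₗ (LinearMap.range (relTrace N W.ρ)).subtype = φ := LinearMap.exists_extend φ
      exact ⟨ψ, relTrace_linHom_inflation N W V ψ⟩)
    (by
      rintro _ ⟨φ, rfl⟩
      exact ⟨_, ⟨φ ∘ₗ (LinearMap.range (relTrace N W.ρ)).subtype, rfl⟩,
        (relTrace_linHom_inflation N W V φ).symm⟩)

/-- The functor `S_{1,V}^{G/N} ∘ tr_1^N` is `S_{1,Inf V}^G`. -/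
noncomputable def FunPlus.precompTraceSimpleOne (V : Rep.{u} k (G ⧸ N)) :
    (FunPlus.precompTrace k N).obj (FunPlus.simpleOne V) ≅
      FunPlus.simpleOne (Rep.res (QuotientGroup.mk' N) V) :=
  ObjectProperty.isoMk _ <| NatIso.ofComponents
    (fun W => trHomInflation N W.unop.obj V) fun {W W'} a => by
      ext f
      refine Subtype.ext (LinearMap.ext fun w => ?_)
      refine congrArg (β := V.V) f.1 ?_
      exact Subtype.ext (p := fun x => x ∈ LinearMap.range (relTrace N W.unop.obj.ρ))
        (hom_relTrace N a.unop.hom w)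

/-- The functor `traceInflation k N` sends `S_{1,V}^{G/N}` to `S_{1,Inf V}^G`. -/
noncomputable def CohMackey.traceInflationSimpleOne (V : Rep.{u} k (G ⧸ N)) :
    (traceInflation k N).obj (simpleOne V) ≅ simpleOne (Rep.res (QuotientGroup.mk' N) V) :=
  (ofFunCompTraceInflation k N).app (FunPlus.simpleOne V) ≪≫
    (ofFun k G).mapIso (FunPlus.precompTraceSimpleOne N V)

end SimpleInflation

/-! ### Transport of simple functors along group isomorphisms. -/

theorem Subgroup.quotientMapHom_injective {G G' : Type u} [Group G] [Group G'] (f : G →* G')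
    (hf : Function.Injective f) (H : Subgroup G) : Function.Injective (quotientMapHom f H) := by
  intro x y h
  induction x using QuotientGroup.induction_on with
  | H a =>
  induction y using QuotientGroup.induction_on with
  | H b =>
  rw [quotientMapHom_mk, quotientMapHom_mk, QuotientGroup.eq, ← map_inv, ← map_mul,
    Subgroup.mem_map_iff_mem hf] at h
  exact QuotientGroup.eq.2 h

section Transport

open Representation CohMackey

variable {k A B : Type u} [CommRing k] [Group A] [Group B] (f : A →* B)

variable (k) in
/-- The morphism `k[A/L] ⟶ Res k[B/f(L)]` induced by a group homomorphism `f : A → B`. -/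
noncomputable def quotientPermHom (L : Subgroup A) :
    Rep.ofMulAction k A (A ⧸ L) ⟶ Rep.res f (Rep.ofMulAction k B (B ⧸ L.map f)) :=
  Rep.permHom (W := Rep.res f (Rep.ofMulAction k B (B ⧸ L.map f)))
    (fun x => MonoidAlgebra.single (Subgroup.quotientMapHom f L x) (1 : k)) fun a x => by
      refine Eq.trans ?_ (Representation.ofMulAction_single (f a) _ _).symm
      congr 1
      induction x using QuotientGroup.induction_on with
      | H x => exact congrArg QuotientGroup.mk (map_mul f a x)

theorem quotientPermHom_single (L : Subgroup A) (x : A ⧸ L) :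
    (quotientPermHom k f L).hom (MonoidAlgebra.single x 1) =
      (MonoidAlgebra.single (Subgroup.quotientMapHom f L x) 1 : MonoidAlgebra k (B ⧸ L.map f)) :=
  (Rep.permHom_single _ _ x 1).trans (one_smul k _)

theorem quotientPermHom_projHom {K H : Subgroup A} (h : K ≤ H) :
    quotientPermHom k f K ≫ Rep.resMap f (projHom k (Subgroup.map_mono h)) =
      projHom k h ≫ quotientPermHom k f H := by
  refine Rep.perm_hom_ext fun x => ?_
  change (projHom k (Subgroup.map_mono h)).hom
      ((quotientPermHom k f K).hom (MonoidAlgebra.single x 1)) =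
    (quotientPermHom k f H).hom ((projHom k h).hom (MonoidAlgebra.single x 1))
  refine (congrArg _ (quotientPermHom_single f K x)).trans ((Rep.push_single _ _ _).trans ?_)
  refine Eq.trans ?_ (congrArg _ (Rep.push_single _ _ _)).symm
  refine Eq.trans ?_ (quotientPermHom_single f H _).symm
  induction x using QuotientGroup.induction_on; rfl

theorem quotientPermHom_conjHom (a : A) {H L : Subgroup A} (h : MulAut.conj a • H = L)
    (h' : MulAut.conj (f a) • H.map f = L.map f) :
    quotientPermHom k f L ≫ Rep.resMap f (conjHom k (f a) h') =
      conjHom k a h ≫ quotientPermHom k f H := by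
  refine Rep.perm_hom_ext fun x => ?_
  change (conjHom k (f a) h').hom ((quotientPermHom k f L).hom (MonoidAlgebra.single x 1)) =
    (quotientPermHom k f H).hom ((conjHom k a h).hom (MonoidAlgebra.single x 1))
  refine (congrArg _ (quotientPermHom_single f L x)).trans ((Rep.push_single _ _ _).trans ?_)
  refine Eq.trans ?_ (congrArg _ (Rep.push_single _ _ _)).symm
  refine Eq.trans ?_ (quotientPermHom_single f H _).symm
  congr 1
  induction x using QuotientGroup.induction_on with
  | H x => exact congrArg QuotientGroup.mk (map_mul f x a).symm

/-- Unlike projections and conjugations, sums over fibres are respected only because `f` matches the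
fibres bijectively. -/
theorem quotientPermHom_sumHom [Finite A] [Finite B] (hf : Function.Bijective f)
    {K H : Subgroup A} (h : K ≤ H) :
    quotientPermHom k f H ≫ Rep.resMap f (sumHom k (Subgroup.map_mono h)) =
      sumHom k h ≫ quotientPermHom k f K := by
  classical
  let _ := Fintype.ofFinite (A ⧸ K)
  refine Rep.perm_hom_ext fun x => ?_
  change (sumHom k (Subgroup.map_mono h)).hom
      ((quotientPermHom k f H).hom (MonoidAlgebra.single x 1)) =
    (quotientPermHom k f K).hom ((sumHom k h).hom (MonoidAlgebra.single x 1))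
  have inj (L : Subgroup A) := Subgroup.quotientMapHom_injective f hf.1 L
  have comm (y : A ⧸ K) : Subgroup.quotientMapOfLE (Subgroup.map_mono h)
      (Subgroup.quotientMapHom f K y) =
        Subgroup.quotientMapHom f H (Subgroup.quotientMapOfLE h y) := by
    induction y using QuotientGroup.induction_on; rfl
  refine (congrArg _ (quotientPermHom_single f H x)).trans ((Rep.pull_single _ _ _).trans ?_)
  refine Eq.trans ?_ (congrArg _ (Rep.pull_single _ _ _)).symm
  rw [Rep.fibreSum_eq_sum ((Finset.univ.filter fun y => Subgroup.quotientMapOfLE h y = x).map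
      ⟨_, inj K⟩), Rep.fibreSum_eq_sum (Finset.univ.filter fun y => Subgroup.quotientMapOfLE h y = x)
        (by simp), Finset.sum_map]
  · refine Eq.trans ?_ (map_sum (quotientPermHom k f K).hom _ _).symm
    exact Finset.sum_congr rfl fun y _ => (quotientPermHom_single f K y).symm
  · intro z
    obtain ⟨y, rfl⟩ := Subgroup.quotientMapHom_surjective f hf.2 K z
    rw [comm, (inj H).eq_iff]
    simp

theorem quotientPermHom_coeff (hf : Function.Injective f) (L : Subgroup A)
    (v : MonoidAlgebra k (A ⧸ L)) (x : A ⧸ L) :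
    ((quotientPermHom k f L).hom v : MonoidAlgebra k (B ⧸ L.map f)).coeff
      (Subgroup.quotientMapHom f L x) = v.coeff x := by
  classical
  induction v using MonoidAlgebra.induction_linear with
  | zero =>
    refine congrArg (fun w : MonoidAlgebra k (B ⧸ L.map f) => w.coeff _)
      (map_zero (quotientPermHom k f L).hom)
  | add v w hv hw =>
    refine (congrArg (fun w : MonoidAlgebra k (B ⧸ L.map f) => w.coeff _)
      (map_add (quotientPermHom k f L).hom v w)).trans ?_
    exact congrArg₂ (· + ·) hv hw
  | single y r =>
    refine (congrArg (fun w : MonoidAlgebra k (B ⧸ L.map f) => w.coeff _)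
      (Rep.permHom_single _ _ y r)).trans ?_
    change r * (MonoidAlgebra.single (Subgroup.quotientMapHom f L y) (1 : k)).coeff _ = _
    rw [MonoidAlgebra.coeff_single, MonoidAlgebra.coeff_single, Finsupp.single_apply,
      Finsupp.single_apply, mul_ite, mul_one, mul_zero]
    exact if_congr (Subgroup.quotientMapHom_injective f hf L).eq_iff rfl rfl

theorem quotientPermHom_bijective (hf : Function.Bijective f) (L : Subgroup A) :
    Function.Bijective (quotientPermHom k f L).hom.toLinearMap := by
  refine ⟨fun v w h => ?_, fun v => ?_⟩
  · refine MonoidAlgebra.ext (Finsupp.ext fun x => ?_)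
    rw [← quotientPermHom_coeff f hf.1, ← quotientPermHom_coeff f hf.1]
    exact congrArg (fun w : MonoidAlgebra k (B ⧸ L.map f) => w.coeff _) h
  · induction v using MonoidAlgebra.induction_linear with
    | zero => exact ⟨0, map_zero _⟩
    | add v w hv hw =>
      obtain ⟨a, rfl⟩ := hv
      obtain ⟨b, rfl⟩ := hw
      exact ⟨a + b, map_add _ _ _⟩
    | single y r =>
      obtain ⟨x, rfl⟩ := Subgroup.quotientMapHom_surjective f hf.2 L y
      refine ⟨MonoidAlgebra.single x r, (Rep.permHom_single _ _ x r).trans ?_⟩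
      refine (MonoidAlgebra.smul_single _ _ _).trans ?_
      rw [smul_eq_mul, mul_one]

/-- Reindex the sum over `B` along `f`; equivariance of `t` moves each group element across it. -/
theorem relTrace_linHom_res [Finite A] [Finite B] (hf : Function.Bijective f) {W : Rep.{u} k A}
    {U V : Rep.{u} k B} (t : W ⟶ Rep.res f U) (φ : U.V →ₗ[k] V.V) :
    relTrace ⊤ (linHom W.ρ (Rep.res f V).ρ) (φ ∘ₗ t.hom.toLinearMap) =
      relTrace ⊤ (linHom U.ρ V.ρ) φ ∘ₗ t.hom.toLinearMap := by
  let _ := Fintype.ofFinite A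
  let _ := Fintype.ofFinite B
  rw [relTrace_top_apply, relTrace_top_apply]
  refine LinearMap.ext fun w => ?_
  refine (LinearMap.sum_apply _ _ _).trans (Eq.trans ?_ (LinearMap.sum_apply _ _ _).symm)
  refine Fintype.sum_bijective f hf _ _ fun a => ?_
  change V.ρ (f a) (φ (t.hom (W.ρ a⁻¹ w))) = V.ρ (f a) (φ (U.ρ (f a)⁻¹ (t.hom w)))
  rw [Rep.hom_comm_apply, ← map_inv]
  rfl

/-- The isomorphism `tr_1^B Hom_k(k[B/f(L)], V) ≅ tr_1^A Hom_k(k[A/L], Res V)` for an isomorphism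
of groups `f : A → B`. -/
noncomputable def trHomTransport [Finite A] [Finite B] (hf : Function.Bijective f)
    (V : Rep.{u} k B) (L : Subgroup A) :=
  trHomIso f V (W := Rep.ofMulAction k A (A ⧸ L)) (U := Rep.ofMulAction k B (B ⧸ L.map f))
    (quotientPermHom k f L).hom.toLinearMap (quotientPermHom_bijective f hf L).2
    (by
      rintro _ ⟨φ, rfl⟩
      exact ⟨_, relTrace_linHom_res f hf (quotientPermHom k f L) φ⟩)
    (by
      rintro _ ⟨ψ, rfl⟩
      let u := LinearEquiv.ofBijective (quotientPermHom k f L).hom.toLinearMap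
        (quotientPermHom_bijective f hf L)
      obtain ⟨φ, rfl⟩ : ∃ φ, φ ∘ₗ (quotientPermHom k f L).hom.toLinearMap = ψ :=
        ⟨ψ ∘ₗ u.symm.toLinearMap, LinearMap.ext fun w => congrArg ψ (u.symm_apply_apply w)⟩
      exact ⟨_, ⟨φ, rfl⟩, (relTrace_linHom_res f hf (quotientPermHom k f L) φ).symm⟩)

/-- Transport of `S_{1,V}` along an isomorphism of groups. -/
noncomputable def CohMackey.restrictSimpleOne [Finite A] [Finite B] (hf : Function.Bijective f)
    (V : Rep.{u} k B) :
    (restrict k f hf.1).obj (simpleOne V) ≅ simpleOne (Rep.res f V) :=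
  let φ : (restrict k f hf.1).obj (simpleOne V) ⟶ simpleOne (Rep.res f V) :=
    { app := fun L => (trHomTransport f hf V L).hom
      res := fun {K H} h => by
        ext ψ
        refine Subtype.ext (LinearMap.ext fun w => ?_)
        exact congrArg (fun t => ψ.1 (t.hom w)) (quotientPermHom_projHom f h)
      tr := fun {K H} h => by
        ext ψ
        refine Subtype.ext (LinearMap.ext fun w => ?_)
        exact congrArg (fun t => ψ.1 (t.hom w)) (quotientPermHom_sumHom f hf h)
      conj := fun a H L h => by
        ext ψ
        refine Subtype.ext (LinearMap.ext fun w => ?_)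
        exact congrArg (fun t => ψ.1 (t.hom w)) (quotientPermHom_conjHom f a h (by rw [conj_smul_map, h])) }
  have : IsIso φ := isIso_of_app _ fun L =>
    inferInstanceAs (IsIso (trHomTransport f hf V L).hom)
  asIso φ

end Transport

/-! ### Restriction to a complement of `N`. -/

namespace CohMackey

section Conj

variable {k G : Type u} [CommRing k] [Group G] (M : CohMackey k G)

theorem conj_congr {g g' : G} (e : g = g') {H L : Subgroup G} (h : MulAut.conj g • H = L)
    (h' : MulAut.conj g' • H = L) : M.conj g h = M.conj g' h' := by
  subst e; rfl

theorem isIso_conj (g : G) {H L : Subgroup G} (h : MulAut.conj g • H = L) :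
    IsIso (M.conj g h) := by
  have h' : MulAut.conj g⁻¹ • L = H := by rw [← h, map_inv, inv_smul_smul]
  refine ⟨M.conj g⁻¹ h', ?_, ?_⟩
  · rw [M.conj_conj g g⁻¹ h h' (by simp)]
    exact M.conj_self _ _ (by simp)
  · rw [M.conj_conj g⁻¹ g h' h (by simp)]
    exact M.conj_self _ _ (by simp)

end Conj

section Complement

variable {k G : Type u} [Group G] (N H : Subgroup G)

theorem map_subtype_inf_eq_bot (hH : N.IsComplement' H) (L : Subgroup H) : L.map H.subtype ⊓ N = ⊥ :=
  le_bot_iff.1 ((inf_le_inf_right N (Subgroup.map_subtype_le L)).trans hH.symm.disjoint.le_bot)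

variable [N.Normal] (hH : N.IsComplement' H)

theorem map_quotientIso (L : Subgroup H) :
    ((L.map H.subtype).map (QuotientGroup.mk' N)).map (quotientIso N H hH).toMonoidHom = L := by
  rw [Subgroup.map_map, Subgroup.map_map]
  conv_rhs => rw [← Subgroup.map_id L]
  congr 1
  ext x
  exact congrArg Subtype.val (quotientIso_apply N H hH x)

theorem conj_one_smul_map_quotientIso (L : Subgroup H) :
    MulAut.conj (1 : H) • ((L.map H.subtype).map (QuotientGroup.mk' N)).map
      (quotientIso N H hH).toMonoidHom = L := by
  rw [map_one, one_smul, map_quotientIso]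

variable [CommRing k] [Finite G]

/-- The morphism from `L ↦ M(e(LN/N))` to `M`, where `e : G/N → H` is the isomorphism given by a
complement `H` of `N`. -/
noncomputable def resInflateIso (M : CohMackey k H) :
    (resFunctor k H).obj (inflate N ((isoFunctor k N H hH).obj M)) ⟶ M where
  -- The subgroups `e(LN/N)` and `L` are equal but not definitionally so; conjugation by `1`
  -- transports between the two values of `M` and is compatible with all structure maps.
  app L := M.conj 1 (conj_one_smul_map_quotientIso N H hH L)
  res h := M.res_conj 1 _ _ _ _
  tr {K L} h := by
    -- Both intersections with `N` are trivial, so the rescaling of the transfers disappears on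
    -- subgroups of `H`.
    have e : ((K.map H.subtype ⊓ N).relIndex (L.map H.subtype ⊓ N) : k) = 1 := by
      rw [map_subtype_inf_eq_bot N H hH, map_subtype_inf_eq_bot N H hH, Subgroup.relIndex_self,
        Nat.cast_one]
    refine Eq.trans ?_ (M.tr_conj 1 (Subgroup.map_mono (Subgroup.map_mono (Subgroup.map_mono h))) h
      (conj_one_smul_map_quotientIso N H hH K) (conj_one_smul_map_quotientIso N H hH L))
    refine congrArg (· ≫ _) ((congrArg (· • _) e).trans (one_smul k _))
  conj g L L' h := by
    have e : 1 * quotientIso N H hH ((g : G) : G ⧸ N) = g * 1 := by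
      rw [quotientIso_apply, one_mul, mul_one]
    have hB : MulAut.conj (g * 1) • ((L.map H.subtype).map (QuotientGroup.mk' N)).map
        (quotientIso N H hH).toMonoidHom = L' := by
      rw [mul_one, map_quotientIso, h]
    exact (M.conj_conj _ 1 _ _ (e ▸ hB)).trans ((M.conj_congr e _ hB).trans
      (M.conj_conj 1 g _ _ hB).symm)

instance (M : CohMackey k H) : IsIso (resInflateIso N H hH M) :=
  isIso_of_app _ fun L => M.isIso_conj 1 (conj_one_smul_map_quotientIso N H hH L)

end Complement

section Split

variable {k G : Type u} [Field k] [Group G] [Finite G] (N H : Subgroup G) [N.Normal]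
  (hH : N.IsComplement' H)

variable (k) in
/-- If `H` is a complement of `N`, then restriction to `H` undoes `traceInflation k N`. -/
noncomputable def isoFunctorCompTraceInflationCompRes :
    isoFunctor k N H hH ⋙ traceInflation k N ⋙ resFunctor k H ≅ 𝟭 (CohMackey k H) :=
  have (M : CohMackey k H) :
      IsIso ((resFunctor k H).map (traceInflationIncl N ((isoFunctor k N H hH).obj M))) :=
    -- The order of `L ∩ N` is `1`, so passing to the subfunctor loses nothing on subgroups of `H`.
    isIso_of_app _ fun L => isIso_traceInflationIncl_app N _ (by
      rw [map_subtype_inf_eq_bot N H hH, Subgroup.card_bot, Nat.cast_one]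
      exact one_ne_zero)
  have (M : CohMackey k H) : IsIso
      ((resFunctor k H).map (traceInflationIncl N ((isoFunctor k N H hH).obj M)) ≫
        resInflateIso N H hH M) := IsIso.comp_isIso' (this M) inferInstance
  NatIso.ofComponents
    (F := isoFunctor k N H hH ⋙ traceInflation k N ⋙ resFunctor k H) (G := 𝟭 (CohMackey k H))
    (fun M => @asIso _ _ _ _ ((resFunctor k H).map (traceInflationIncl N ((isoFunctor k N H hH).obj M)) ≫
      resInflateIso N H hH M) (this M)) fun {M M'} f => by
    ext1 L
    ext v
    exact (congrArg (fun t => t.hom v.1)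
      (f.conj 1 (conj_one_smul_map_quotientIso N H hH L)).symm)

/-- The composite of `traceInflation k N` with the identification of `H` and `G/N` sends `S_{1,V}`
to `S_{1,Ṽ}`. -/
noncomputable def traceInflationIsoFunctorSimpleOne (V : Rep.{u} k H) :
    (isoFunctor k N H hH ⋙ traceInflation k N).obj (simpleOne V) ≅
      simpleOne (Rep.tilde N H hH V) :=
  (traceInflation k N).mapIso (restrictSimpleOne (quotientIso N H hH).toMonoidHom
    (quotientIso N H hH).bijective V) ≪≫
    traceInflationSimpleOne N (Rep.res (quotientIso N H hH).toMonoidHom V)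

/-- The restriction of `S_{1,Ṽ}` to a complement `H` of `N` is `S_{1,V}`. -/
noncomputable def resSimpleOneTilde (V : Rep.{u} k H) :
    (resFunctor k H).obj (simpleOne (Rep.tilde N H hH V)) ≅ simpleOne V :=
  -- No direct computation of the restriction: `S_{1,Ṽ}` is in the image of `Iso ⋙ σ`, which `Res`
  -- undoes.
  (resFunctor k H).mapIso (traceInflationIsoFunctorSimpleOne N H hH V).symm ≪≫
    (isoFunctorCompTraceInflationCompRes k N H hH).app (simpleOne V)

end Split

end CohMackey

/-- The restriction of `Ṽ` to `H` is `V`. -/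
noncomputable def Rep.resTilde {k G : Type u} [CommRing k] [Group G] (N H : Subgroup G)
    [N.Normal] (hH : N.IsComplement' H) (V : Rep.{u} k H) :
    Rep.res H.subtype (Rep.tilde N H hH V) ≅ V :=
  Rep.mkIso (Representation.Equiv.mk (LinearEquiv.refl k V.V) fun h => by
    refine LinearMap.ext fun v => ?_
    change V.ρ (quotientIso N H hH ((h : G) : G ⧸ N)) v = V.ρ h v
    rw [quotientIso_apply])

/-! ### Splitting of the maps induced on extension groups. -/

namespace CategoryTheory.Abelian.Ext

universe w w' v v' u₁ u₂

section

variable {C : Type u₁} [Category.{v} C] [Abelian C] [HasExt.{w} C]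

theorem mk₀_comp_comp_mk₀ {X X' X'' Y Y' Y'' : C} {n : ℕ} (f : X ⟶ X') (f' : X' ⟶ X'')
    (e : Ext X'' Y n) (g' : Y ⟶ Y') (g : Y' ⟶ Y'') :
    (mk₀ f).comp (((mk₀ f').comp (e.comp (mk₀ g') (add_zero n)) (zero_add n)).comp (mk₀ g)
      (add_zero n)) (zero_add n) =
        (mk₀ (f ≫ f')).comp (e.comp (mk₀ (g' ≫ g)) (add_zero n)) (zero_add n) := by
  rw [comp_assoc_of_third_deg_zero, comp_assoc_of_third_deg_zero, mk₀_comp_mk₀_assoc,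
    mk₀_comp_mk₀]

variable {D : Type u₂} [Category.{v'} D] [Abelian D] [HasExt.{w'} D]
  (F : C ⥤ D) [F.Additive] [PreservesFiniteLimits F] [PreservesFiniteColimits F]
  (G : D ⥤ C) [G.Additive] [PreservesFiniteLimits G] [PreservesFiniteColimits G]

theorem mapExactFunctor_mk₀_comp_comp_mk₀ {X X' Y Y' : C} {n : ℕ} (f : X ⟶ X')
    (e : Ext X' Y n) (g : Y ⟶ Y') :
    ((mk₀ f).comp (e.comp (mk₀ g) (add_zero n)) (zero_add n)).mapExactFunctor F =
      (mk₀ (F.map f)).comp ((e.mapExactFunctor F).comp (mk₀ (F.map g)) (add_zero n))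
        (zero_add n) := by
  rw [mapExactFunctor_comp, mapExactFunctor_comp, mapExactFunctor_mk₀, mapExactFunctor_mk₀]

theorem mapExactFunctor_mapExactFunctor (η : F ⋙ G ≅ 𝟭 C) {n : ℕ} {X Y : C} (e : Ext X Y n) :
    (e.mapExactFunctor F).mapExactFunctor G =
      (mk₀ (η.hom.app X)).comp (e.comp (mk₀ (η.inv.app Y)) (add_zero n)) (zero_add n) := by
  rw [← comp_assoc_of_third_deg_zero, ← mapExactFunctor_mapExactFunctor_comp F G η,
    comp_assoc_of_third_deg_zero, mk₀_comp_mk₀, Iso.hom_inv_id_app]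
  exact (comp_mk₀_id _).symm

/-- With arbitrary comparison maps inserted, going through `F` and back through `G` still amounts to
composing the class with one morphism on each side. When the comparison maps are isomorphisms, this
distortion can be undone. -/
theorem comp_mapExactFunctor_comp_mapExactFunctor (η : F ⋙ G ≅ 𝟭 C) {X Y : C} {A B : D}
    (a : A ⟶ F.obj X) (b : F.obj Y ⟶ B) (α : X ⟶ G.obj A) (β : G.obj B ⟶ Y) {n : ℕ}
    (e : Ext X Y n) :
    (mk₀ α).comp ((((mk₀ a).comp ((e.mapExactFunctor F).comp (mk₀ b)
      (add_zero n)) (zero_add n)).mapExactFunctor G).comp (mk₀ β) (add_zero n)) (zero_add n) =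
      (mk₀ (α ≫ G.map a ≫ η.hom.app X)).comp
        (e.comp (mk₀ (η.inv.app Y ≫ G.map b ≫ β)) (add_zero n)) (zero_add n) := by
  rw [mapExactFunctor_mk₀_comp_comp_mk₀, mk₀_comp_comp_mk₀,
    mapExactFunctor_mapExactFunctor F G η]
  exact (mk₀_comp_comp_mk₀ (α ≫ G.map a) _ e _ (G.map b ≫ β)).trans (by rw [Category.assoc])

end

variable {R : Type*} [CommRing R] {C : Type u₁} [Category.{v} C] [Abelian C] [HasExt.{w} C]
  [Linear R C] {D : Type u₂} [Category.{v'} D] [Abelian D] [HasExt.{w'} D] [Linear R D]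
  (F : C ⥤ D) [F.Additive] [F.Linear R] [PreservesFiniteLimits F] [PreservesFiniteColimits F]
  (G : D ⥤ C) [G.Additive] [G.Linear R] [PreservesFiniteLimits G] [PreservesFiniteColimits G]

/-- If `F ⋙ G ≅ 𝟭`, then the maps induced by `G` on extension groups between objects in the image
of `F` are split surjections. -/
theorem exists_rightInverse_mapExtLinearMap (η : F ⋙ G ≅ 𝟭 C) {X Y : C} {A B : D}
    (a : F.obj X ≅ A) (b : F.obj Y ≅ B) (α : G.obj A ≅ X) (β : G.obj B ≅ Y) (n : ℕ) :
    ∃ s : Ext X Y n →ₗ[R] Ext A B n, ((mk₀ α.inv).precompOfLinear R Y (zero_add n) ∘ₗ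
      (mk₀ β.hom).postcompOfLinear R (G.obj A) (add_zero n) ∘ₗ G.mapExtLinearMap R A B n) ∘ₗ s =
        LinearMap.id := by
  -- The arbitrary choices of `α` and `β` need not be compatible with `η`, `a` and `b`; `θ'` and
  -- `ω'` undo the resulting automorphisms of `X` and `Y`. They are applied before `F`, which makes
  -- the section exact rather than a section up to automorphism.
  let θ' : X ⟶ X := η.inv.app X ≫ G.map a.hom ≫ α.hom
  let ω' : Y ⟶ Y := β.inv ≫ G.map b.inv ≫ η.hom.app Y
  have hθ : (α.inv ≫ G.map a.inv ≫ η.hom.app X) ≫ θ' = 𝟙 X := by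
    simp [θ', ← Functor.map_comp_assoc]
  have hω : ω' ≫ η.inv.app Y ≫ G.map b.hom ≫ β.hom = 𝟙 Y := by
    simp [ω', ← Functor.map_comp_assoc]
  refine ⟨(mk₀ a.inv).precompOfLinear R B (zero_add n) ∘ₗ
    (mk₀ b.hom).postcompOfLinear R (F.obj X) (add_zero n) ∘ₗ F.mapExtLinearMap R X Y n ∘ₗ
      (mk₀ θ').precompOfLinear R Y (zero_add n) ∘ₗ
        (mk₀ ω').postcompOfLinear R X (add_zero n), LinearMap.ext fun e => ?_⟩
  have key := comp_mapExactFunctor_comp_mapExactFunctor F G η a.inv b.hom α.inv β.hom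
    ((mk₀ θ').comp (e.comp (mk₀ ω') (add_zero n)) (zero_add n))
  rw [mk₀_comp_comp_mk₀, hθ, hω, comp_mk₀_id, mk₀_id_comp] at key
  rw [LinearMap.comp_apply, LinearMap.comp_apply, LinearMap.comp_apply, LinearMap.comp_apply,
    LinearMap.comp_apply, LinearMap.comp_apply, LinearMap.comp_apply, Functor.mapExtLinearMap_apply,
    Functor.mapExtLinearMap_apply]
  exact key

end CategoryTheory.Abelian.Ext

namespace CohMackey

section Exact

variable {k G : Type u} [CommRing k] [Group G] (N H : Subgroup G) [N.Normal]
  (hH : N.IsComplement' H)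

instance : (isoFunctor k N H hH).Additive where

instance : (isoFunctor k N H hH).Linear k where

instance : PreservesFiniteLimits (isoFunctor k N H hH) :=
  have (f : G ⧸ N →* H) (hf) : PreservesFiniteLimits (restrict k f hf) := inferInstance
  this _ _

instance : PreservesFiniteColimits (isoFunctor k N H hH) :=
  have (f : G ⧸ N →* H) (hf) : PreservesFiniteColimits (restrict k f hf) := inferInstance
  this _ _

end Exact

/-- Applies the splitting to the exact linear functor `Iso ⋙ σ`, whose composite with `Res` is the
identity and whose values on the simple functors are known. -/
theorem exists_rightInverse_resExt {k G : Type u} [Field k] [Group G] [Finite G]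
    (N H : Subgroup G) [N.Normal] (hH : N.IsComplement' H) {V W : Rep.{u} k H}
    (α : (resFunctor k H).obj (simpleOne (Rep.tilde N H hH V)) ≅ simpleOne V)
    (β : (resFunctor k H).obj (simpleOne (Rep.tilde N H hH W)) ≅ simpleOne W) (n : ℕ) :
    ∃ s : Abelian.Ext (simpleOne V) (simpleOne W) n →ₗ[k]
        Abelian.Ext (simpleOne (Rep.tilde N H hH V)) (simpleOne (Rep.tilde N H hH W)) n,
      resExt H α β n ∘ₗ s = LinearMap.id :=
  have := comp_preservesFiniteLimits (isoFunctor k N H hH) (traceInflation k N)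
  have := comp_preservesFiniteColimits (isoFunctor k N H hH) (traceInflation k N)
  Abelian.Ext.exists_rightInverse_mapExtLinearMap (R := k)
    (isoFunctor k N H hH ⋙ traceInflation k N) (resFunctor k H)
    (isoFunctorCompTraceInflationCompRes k N H hH)
    (traceInflationIsoFunctorSimpleOne N H hH V) (traceInflationIsoFunctorSimpleOne N H hH W) α β n

end CohMackey

theorem theorem1p1 {k G : Type u} [Field k] [Group G] [Finite G] (N : Subgroup G) [N.Normal] :
    ∃ σ : CohMackey k (G ⧸ N) ⥤ CohMackey k G,
      (σ.Additive ∧ σ.Linear k ∧ PreservesFiniteLimits σ ∧ PreservesFiniteColimits σ) ∧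
      Nonempty (CohMackey.ofFun k (G ⧸ N) ⋙ σ ≅
        FunPlus.precompTrace k N ⋙ CohMackey.ofFun k G) ∧
      (∀ V : Rep.{u} k (G ⧸ N), V.ρ.IsIrreducible →
        Nonempty (σ.obj (CohMackey.simpleOne V) ≅
          CohMackey.simpleOne (Rep.res (QuotientGroup.mk' N) V))) ∧
      ∀ (H : Subgroup G) (hH : N.IsComplement' H),
        (∀ V : Rep.{u} k H, Nonempty (Rep.res H.subtype (Rep.tilde N H hH V) ≅ V)) ∧
        Nonempty (CohMackey.isoFunctor k N H hH ⋙ σ ⋙ CohMackey.resFunctor k H ≅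
          𝟭 (CohMackey k H)) ∧
        (∀ V : Rep.{u} k H, V.ρ.IsIrreducible →
          Nonempty ((CohMackey.resFunctor k H).obj (CohMackey.simpleOne (Rep.tilde N H hH V)) ≅
            CohMackey.simpleOne V)) ∧
        ∀ V W : Rep.{u} k H, V.ρ.IsIrreducible → W.ρ.IsIrreducible →
          ∀ (α : (CohMackey.resFunctor k H).obj (CohMackey.simpleOne (Rep.tilde N H hH V)) ≅
              CohMackey.simpleOne V)
            (β : (CohMackey.resFunctor k H).obj (CohMackey.simpleOne (Rep.tilde N H hH W)) ≅
              CohMackey.simpleOne W) (n : ℕ),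
            ∃ s : Abelian.Ext (CohMackey.simpleOne V) (CohMackey.simpleOne W) n →ₗ[k]
                Abelian.Ext (CohMackey.simpleOne (Rep.tilde N H hH V))
                  (CohMackey.simpleOne (Rep.tilde N H hH W)) n,
              CohMackey.resExt H α β n ∘ₗ s = LinearMap.id :=
  ⟨CohMackey.traceInflation k N, ⟨inferInstance, inferInstance, inferInstance, inferInstance⟩,
    ⟨CohMackey.ofFunCompTraceInflation k N⟩,
    fun V _ => ⟨CohMackey.traceInflationSimpleOne N V⟩, fun H hH =>
    ⟨fun V => ⟨Rep.resTilde N H hH V⟩, ⟨CohMackey.isoFunctorCompTraceInflationCompRes k N H hH⟩,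
      fun V _ => ⟨CohMackey.resSimpleOneTilde N H hH V⟩,
      fun _ _ _ _ α β n => CohMackey.exists_rightInverse_resExt N H hH α β n⟩⟩
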